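/- **Theorem 1.5.** Let $n\ge 1$, $0<\alpha\le 1$ and $\lambda>\frac{3n+2\alpha}{n}$. Let $\mathcal C_\alpha$ be the family of functions $\varphi$ on $\mathbb R^n$ supported in $\{|x|\le 1\}$ with $\int_{\mathbb R^n}\varphi=0$ and $|\varphi(x)-\varphi(x')|\le|x-x'|^\alpha$ for all $x,x'\in\mathbb R^n$; write $\varphi_t(x)=t^{-n}\varphi(x/t)$ for $t>0$. For a locally integrable function $f$ on $\mathbb R^n$ put $$A_\alpha(f)(y,t)=\sup_{\varphi\in\mathcal C_\alpha}\Big|\int_{\mathbb R^n}\varphi_t(y-z)f(z)\,dz\Big|,\qquad g^*_{\lambda,\alpha}(f)(x)=\left(\int_0^\infty\!\!\int_{\mathbb R^n}\Big(\frac{t}{t+|x-y|}\Big)^{\lambda n}A_\alpha(f)(y,t)^2\,\frac{dy\,dt}{t^{n+1}}\right)^{1/2}\in[0,\infty].$$ (Scalars are real or complex; in either case both $f$ and the $\varphi\in\mathcal C_\alpha$ take values in the chosen field.) Let $\Phi:(0,\infty)\to(0,\infty)$ be nondecreasing and suppose that there is a constant $D$ with $1\le D<2^n$ and $\Phi(2r)\le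 D\,\Phi(r)$ for all $r>0$. Let $L^{1,\Phi}$ be the space of locally integrable $f$ for which there is a finite constant $C\ge 0$ with $$\int_{B(x_0,r)}|f(x)|\,dx\le C\,\Phi(r)\quad\text{for all }x_0\in\mathbb R^n,\ r>0,$$ and let $\|f\|_{L^{1,\Phi}}$ be the smallest such $C$. Let $WL^{1,\Phi}$ be the space of measurable $h$ for which there is a finite constant $C\ge 0$ with $$\sup_{\sigma>0}\sigma\,\big|\{x\in B(x_0,r):|h(x)|>\sigma\}\big|\le C\,\Phi(r)\quad\text{for all }x_0\in\mathbb R^n,\ r>0,$$ and let $\|h\|_{WL^{1,\Phi}}$ be the smallest such $C$. Here $B(x_0,r)$ is the open Euclidean ball and $|E|$ is the Lebesgue measure of $E$. Then there is a constant $C>0$, independent of $f$, such that for every $f\in L^{1,\Phi}$ the function $g^*_{\lambda,\alpha}(f)$ belongs to $WL^{1,\Phi}$ and $$\|g^*_{\lambda,\alpha}(f)\|_{WL^{1,\Phi}}\le C\,\|f\|_{L^{1,\Phi}}.$$ -/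

import Mathlib

open MeasureTheory Set
open scoped ENNReal NNReal

/-- Membership in the class `𝒞_α` of kernels on `ℝⁿ`: supported in the closed unit ball, with
vanishing integral, and satisfying `|φ(x) - φ(x')| ≤ |x - x'|^α` for all `x, x'`. -/
structure IsIntrinsicKernel {𝕜 : Type*} [RCLike 𝕜] {n : ℕ} (α : ℝ)
    (φ : EuclideanSpace ℝ (Fin n) → 𝕜) : Prop where
  support_subset : Function.support φ ⊆ {x | ‖x‖ ≤ 1}
  integral_eq_zero : ∫ x, φ x = 0
  holder : ∀ x x', ‖φ x - φ x'‖ ≤ ‖x - x'‖ ^ α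

/-- The dilate `φ_t(x) = t⁻ⁿ φ(x / t)`. -/
noncomputable def dilate {𝕜 : Type*} [RCLike 𝕜] {n : ℕ}
    (φ : EuclideanSpace ℝ (Fin n) → 𝕜) (t : ℝ) (x : EuclideanSpace ℝ (Fin n)) : 𝕜 :=
  (t ^ n)⁻¹ • φ (t⁻¹ • x)

/-- `A_α(f)(y,t) = sup_{φ ∈ 𝒞_α} |∫ φ_t(y - z) f(z) dz|`, used for `t > 0` and locally integrable
`f`, for which all the integrals converge. -/
noncomputable def intrinsicA {𝕜 : Type*} [RCLike 𝕜] {n : ℕ} (α : ℝ)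
    (f : EuclideanSpace ℝ (Fin n) → 𝕜) (y : EuclideanSpace ℝ (Fin n)) (t : ℝ) : ℝ≥0∞ :=
  ⨆ (φ : EuclideanSpace ℝ (Fin n) → 𝕜) (_ : IsIntrinsicKernel α φ),
    ‖∫ z, dilate φ t (y - z) * f z‖ₑ

/-- The intrinsic `g*`-function
`(∬_{ℝⁿ × (0,∞)} (t / (t + |x - y|))^{lam n} A_α(f)(y,t)² dy dt / t^{n+1})^{1/2}`,
with values in `[0,∞]`. -/
noncomputable def intrinsicGStar {𝕜 : Type*} [RCLike 𝕜] {n : ℕ} (lam α : ℝ)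
    (f : EuclideanSpace ℝ (Fin n) → 𝕜) (x : EuclideanSpace ℝ (Fin n)) : ℝ≥0∞ :=
  (∫⁻ p in (univ : Set (EuclideanSpace ℝ (Fin n))) ×ˢ Ioi (0 : ℝ),
    ENNReal.ofReal ((p.2 / (p.2 + ‖x - p.1‖)) ^ (lam * n)) * intrinsicA α f p.1 p.2 ^ 2
      * ENNReal.ofReal (1 / p.2 ^ (n + 1))) ^ (1 / 2 : ℝ)

/-- `C` is an admissible constant for `f` in the generalized Morrey space `L^{1,Φ}`. -/
def IsMorreyBound {𝕜 : Type*} [RCLike 𝕜] {n : ℕ} (Φ : ℝ → ℝ)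
    (f : EuclideanSpace ℝ (Fin n) → 𝕜) (C : ℝ≥0∞) : Prop :=
  ∀ (x₀ : EuclideanSpace ℝ (Fin n)) (r : ℝ), 0 < r →
    ∫⁻ x in Metric.ball x₀ r, ‖f x‖ₑ ≤ C * ENNReal.ofReal (Φ r)

/-- The generalized Morrey space `L^{1,Φ}(ℝⁿ)`. -/
def MemMorrey {𝕜 : Type*} [RCLike 𝕜] {n : ℕ} (Φ : ℝ → ℝ)
    (f : EuclideanSpace ℝ (Fin n) → 𝕜) : Prop :=
  LocallyIntegrable f volume ∧ ∃ C : ℝ≥0, IsMorreyBound Φ f C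

/-- The norm of `L^{1,Φ}`: the smallest admissible constant. -/
noncomputable def morreyNorm {𝕜 : Type*} [RCLike 𝕜] {n : ℕ} (Φ : ℝ → ℝ)
    (f : EuclideanSpace ℝ (Fin n) → 𝕜) : ℝ≥0∞ :=
  sInf {C | IsMorreyBound Φ f C}

/-- `C` is an admissible constant for the function `g ≥ 0` in the generalized weak Morrey
space `WL^{1,Φ}`. -/
def IsWeakMorreyBound {n : ℕ} (Φ : ℝ → ℝ)
    (g : EuclideanSpace ℝ (Fin n) → ℝ≥0∞) (C : ℝ≥0∞) : Prop :=
  ∀ (x₀ : EuclideanSpace ℝ (Fin n)) (r : ℝ), 0 < r →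
    ⨆ (σ : ℝ≥0) (_ : 0 < σ), (σ : ℝ≥0∞) * volume {x ∈ Metric.ball x₀ r | (σ : ℝ≥0∞) < g x}
      ≤ C * ENNReal.ofReal (Φ r)

/-- The generalized weak Morrey space `WL^{1,Φ}(ℝⁿ)`, for functions with values in `[0,∞]`
(a member is automatically finite almost everywhere). -/
def MemWeakMorrey {n : ℕ} (Φ : ℝ → ℝ) (g : EuclideanSpace ℝ (Fin n) → ℝ≥0∞) : Prop :=
  Measurable g ∧ ∃ C : ℝ≥0, IsWeakMorreyBound Φ g C

/-- The `WL^{1,Φ}` (quasi-)norm: the smallest admissible constant. -/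
noncomputable def weakMorreyNorm {n : ℕ} (Φ : ℝ → ℝ)
    (g : EuclideanSpace ℝ (Fin n) → ℝ≥0∞) : ℝ≥0∞ :=
  sInf {C | IsWeakMorreyBound Φ g C}

/-! Fix a ball B of radius r and split f at the doubled ball. The inner part is integrable with mass
at most D Φ(r) ‖f‖, so the weak type (1,1) bound `weakType_intrinsicGStar` settles it. The outer
part is cut into dyadic annuli. On B the annulus of radius about 2^j r contributes at most a
multiple of Φ(2^{j+2} r) (2^j r)^{-n}, that is of (D / 2^n)^j Φ(r) / r^n, and D < 2^n makes the
series converge (`intrinsicGStar_far_le`). A pointwise bound of size Φ(r) / r^n on a ball of volume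
comparable to r^n is what the weak Morrey norm asks for.

The weak type bound is a Calderón–Zygmund decomposition over dyadic cubes. A bad piece b lives on a
cube of side s and has mean zero there, so the Hölder condition gives A_α(b)(y,t) ≲ s^α t^{-(n+α)}
‖b‖₁. Out of the exponent λn > 3n + 2α, slightly more than n pays for the integral in y and slightly
more than 2(n+α) pays for the singularity of A_α² as t → 0. What remains is decay of order n + α
away from the cube, which is integrable (`intrinsicGStar_le_of_decay`).

The good part needs a square estimate. Integrating in x reduces g* to ∬ A_α² dy dt/t. Expand in
dyadic martingale differences. The difference at scale s meets the kernels at scale t with L² gain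
min(s/t, t/s)^ε: for s ≤ t the difference has mean zero on cubes and the kernel is Hölder; for s > t
the kernel has mean zero and the difference is piecewise constant. The scales therefore decouple,
and Pythagoras bounds the sum of the squared L² norms by the supremum of the dyadic averages times
the L¹ norm. Only the dyadic averages of the good part have to be bounded, so no differentiation
theorem enters. Every estimate is uniform over kernels and thus survives the supremum defining A_α.
-/

/-! ### Kernels of the class and their translated dilates -/

section Kernels

variable {𝕜 : Type*} [RCLike 𝕜] {n : ℕ}

/-- The properties of `z ↦ φ_t(y - z)`, for `φ` in the class `𝒞_α`, that the estimates use. -/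
structure IsTestAt (α : ℝ) (y : EuclideanSpace ℝ (Fin n)) (t : ℝ)
    (ψ : EuclideanSpace ℝ (Fin n) → 𝕜) : Prop where
  eq_zero : ∀ z, t < dist z y → ψ z = 0
  norm_le : ∀ z, ‖ψ z‖ ≤ 3 * (t ^ n)⁻¹
  holder : ∀ z z', ‖ψ z - ψ z'‖ ≤ (t ^ n)⁻¹ * (dist z z' / t) ^ α
  continuous : Continuous ψ
  integral_eq_zero : ∫ z, ψ z = 0

namespace IsIntrinsicKernel

variable {α : ℝ} {φ : EuclideanSpace ℝ (Fin n) → 𝕜}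

theorem eq_zero_of_one_lt (hφ : IsIntrinsicKernel α φ) {x : EuclideanSpace ℝ (Fin n)}
    (hx : 1 < ‖x‖) : φ x = 0 := by
  by_contra h
  exact absurd (hφ.support_subset h) (by simpa using hx)

/-- A shift by a vector of length 3 carries the unit ball off itself, where φ vanishes, so the
Hölder condition alone bounds φ by 3^α ≤ 3. Such a vector exists because n ≥ 1. -/
theorem norm_le_three (hφ : IsIntrinsicKernel α φ) (hn : 1 ≤ n) (hα1 : α ≤ 1)
    (x : EuclideanSpace ℝ (Fin n)) : ‖φ x‖ ≤ 3 := by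
  rcases lt_or_ge 1 ‖x‖ with hx | hx
  · rw [hφ.eq_zero_of_one_lt hx]; simp
  · set e : EuclideanSpace ℝ (Fin n) := EuclideanSpace.single ⟨0, hn⟩ 3 with he
    have hen : ‖e‖ = 3 := by simp [he]
    have h1 : φ (x + e) = 0 := by
      apply hφ.eq_zero_of_one_lt
      have := norm_sub_le (x + e) x
      rw [add_sub_cancel_left, hen] at this
      linarith
    have h2 := hφ.holder x (x + e)
    rw [h1, sub_zero, sub_add_cancel_left, norm_neg, hen] at h2
    refine h2.trans ?_
    calc (3 : ℝ) ^ α ≤ 3 ^ (1 : ℝ) := Real.rpow_le_rpow_of_exponent_le (by norm_num) hα1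
      _ = 3 := by norm_num

theorem continuous (hφ : IsIntrinsicKernel α φ) (hα0 : 0 < α) : Continuous φ := by
  rw [continuous_iff_continuousAt]
  intro x
  rw [ContinuousAt, tendsto_iff_norm_sub_tendsto_zero]
  refine squeeze_zero (fun _ => norm_nonneg _) (fun z => hφ.holder z x) ?_
  have h : Continuous fun z : EuclideanSpace ℝ (Fin n) => ‖z - x‖ ^ α :=
    (continuous_norm.comp (continuous_id.sub continuous_const)).rpow_const
      fun _ => Or.inr hα0.le
  simpa [Real.zero_rpow hα0.ne'] using h.tendsto x

theorem isTestAt (hφ : IsIntrinsicKernel α φ) (hn : 1 ≤ n) (hα0 : 0 < α) (hα1 : α ≤ 1)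
    (y : EuclideanSpace ℝ (Fin n)) {t : ℝ} (ht : 0 < t) :
    IsTestAt α y t (fun z => dilate φ t (y - z)) where
  eq_zero z hz := by
    rw [dilate, hφ.eq_zero_of_one_lt, smul_zero]
    rw [norm_smul, Real.norm_eq_abs, abs_of_pos (inv_pos.2 ht), ← dist_eq_norm, dist_comm,
      inv_mul_eq_div, one_lt_div ht]
    exact hz
  norm_le z := by
    rw [dilate, norm_smul, Real.norm_eq_abs, abs_of_pos (by positivity), mul_comm]
    gcongr
    exact hφ.norm_le_three hn hα1 _
  holder z z' := by
    rw [dilate, dilate, ← smul_sub, norm_smul, Real.norm_eq_abs, abs_of_pos (by positivity)]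
    gcongr
    refine (hφ.holder _ _).trans_eq ?_
    rw [← smul_sub, norm_smul, Real.norm_eq_abs, abs_of_pos (inv_pos.2 ht), inv_mul_eq_div,
      sub_sub_sub_cancel_left, dist_comm, dist_eq_norm]
  continuous := by
    have := hφ.continuous hα0
    unfold dilate
    fun_prop
  integral_eq_zero := by
    rw [integral_sub_left_eq_self (fun z => dilate φ t z) volume y]
    unfold dilate
    rw [integral_smul, Measure.integral_comp_inv_smul, hφ.integral_eq_zero]
    simp

end IsIntrinsicKernel

namespace IsTestAt

variable {α : ℝ} {y : EuclideanSpace ℝ (Fin n)} {t : ℝ} {ψ : EuclideanSpace ℝ (Fin n) → 𝕜}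

theorem hasCompactSupport (h : IsTestAt α y t ψ) : HasCompactSupport ψ :=
  HasCompactSupport.of_support_subset_isCompact (isCompact_closedBall y t) fun z hz => by
    by_contra hz'
    exact hz (h.eq_zero z (by simpa using hz'))

theorem integrable_mul (h : IsTestAt α y t ψ) {f : EuclideanSpace ℝ (Fin n) → 𝕜}
    (hf : LocallyIntegrable f) : Integrable fun z => ψ z * f z :=
  hf.integrable_smul_left_of_hasCompactSupport h.continuous h.hasCompactSupport

theorem integrable (h : IsTestAt α y t ψ) : Integrable ψ :=
  h.continuous.integrable_of_hasCompactSupport h.hasCompactSupport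

theorem enorm_le (h : IsTestAt α y t ψ) (z : EuclideanSpace ℝ (Fin n)) :
    ‖ψ z‖ₑ ≤ ENNReal.ofReal (3 * (t ^ n)⁻¹) := by
  rw [← ofReal_norm]
  exact ENNReal.ofReal_le_ofReal (h.norm_le z)

theorem enorm_integral_mul_le (h : IsTestAt α y t ψ) (f : EuclideanSpace ℝ (Fin n) → 𝕜) :
    ‖∫ z, ψ z * f z‖ₑ ≤
      ENNReal.ofReal (3 * (t ^ n)⁻¹) * ∫⁻ z in Metric.closedBall y t, ‖f z‖ₑ := by
  refine (enorm_integral_le_lintegral_enorm _).trans ?_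
  rw [← lintegral_indicator Metric.isClosed_closedBall.measurableSet,
    ← lintegral_const_mul' _ _ ENNReal.ofReal_ne_top]
  refine lintegral_mono fun z => ?_
  by_cases hz : z ∈ Metric.closedBall y t
  · simp only [hz, indicator_of_mem, enorm_mul]
    gcongr
    exact h.enorm_le z
  · rw [h.eq_zero z (by simpa using hz)]
    simp

end IsTestAt

/-! ### The intrinsic maximal quantity: subadditivity, size, measurability -/

section IntrinsicA

variable {α : ℝ} {y : EuclideanSpace ℝ (Fin n)} {t : ℝ}

theorem intrinsicA_le (hn : 1 ≤ n) (hα0 : 0 < α) (hα1 : α ≤ 1) (ht : 0 < t)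
    {f : EuclideanSpace ℝ (Fin n) → 𝕜} {c : ℝ≥0∞}
    (h : ∀ ψ : EuclideanSpace ℝ (Fin n) → 𝕜, IsTestAt α y t ψ → ‖∫ z, ψ z * f z‖ₑ ≤ c) :
    intrinsicA α f y t ≤ c :=
  iSup₂_le fun _ hφ => h _ (hφ.isTestAt hn hα0 hα1 y ht)

/-- Subadditivity is asked only of the pairings with test functions. Expansions of f that converge
merely weakly, such as the martingale expansion, are thereby admissible. -/
theorem intrinsicA_le_tsum (hn : 1 ≤ n) (hα0 : 0 < α) (hα1 : α ≤ 1) (ht : 0 < t) {ι : Type*}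
    {f : EuclideanSpace ℝ (Fin n) → 𝕜} {F : ι → EuclideanSpace ℝ (Fin n) → 𝕜}
    (h : ∀ ψ : EuclideanSpace ℝ (Fin n) → 𝕜, IsTestAt α y t ψ →
      ‖∫ z, ψ z * f z‖ₑ ≤ ∑' i, ‖∫ z, ψ z * F i z‖ₑ) :
    intrinsicA α f y t ≤ ∑' i, intrinsicA α (F i) y t :=
  iSup₂_le fun φ hφ => (h _ (hφ.isTestAt hn hα0 hα1 y ht)).trans <|
    ENNReal.tsum_le_tsum fun i =>
      le_iSup₂ (f := fun (φ : EuclideanSpace ℝ (Fin n) → 𝕜) (_ : IsIntrinsicKernel α φ) =>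
        ‖∫ z, dilate φ t (y - z) * F i z‖ₑ) φ hφ

theorem intrinsicA_add_le (hn : 1 ≤ n) (hα0 : 0 < α) (hα1 : α ≤ 1) (ht : 0 < t)
    {f g : EuclideanSpace ℝ (Fin n) → 𝕜} (hf : LocallyIntegrable f) (hg : LocallyIntegrable g) :
    intrinsicA α (f + g) y t ≤ intrinsicA α f y t + intrinsicA α g y t := by
  have := intrinsicA_le_tsum (F := fun b : Bool => if b then g else f) (f := f + g)
    (y := y) hn hα0 hα1 ht ?_
  · simpa [tsum_fintype, add_comm] using this
  · intro ψ hψ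
    simp only [Pi.add_apply, mul_add]
    rw [integral_add (hψ.integrable_mul hf) (hψ.integrable_mul hg), tsum_fintype]
    simpa [add_comm] using enorm_add_le (∫ z, ψ z * f z) (∫ z, ψ z * g z)

theorem intrinsicA_le_tsum_indicator (hn : 1 ≤ n) (hα0 : 0 < α) (hα1 : α ≤ 1) (ht : 0 < t)
    {ι : Type*} [Countable ι] {S : ι → Set (EuclideanSpace ℝ (Fin n))}
    (hS : ∀ i, MeasurableSet (S i)) (hd : Pairwise fun i j => Disjoint (S i) (S j))
    {f : EuclideanSpace ℝ (Fin n) → 𝕜} (hf : LocallyIntegrable f)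
    (hfS : ∀ x, x ∉ ⋃ i, S i → f x = 0) :
    intrinsicA α f y t ≤ ∑' i, intrinsicA α ((S i).indicator f) y t := by
  refine intrinsicA_le_tsum hn hα0 hα1 ht fun ψ hψ => ?_
  have h1 := hasSum_integral_iUnion hS hd (hψ.integrable_mul hf).integrableOn
  rw [setIntegral_eq_integral_of_forall_compl_eq_zero
    fun x hx => by rw [hfS x hx, mul_zero]] at h1
  rw [← h1.tsum_eq]
  refine enorm_tsum_le_tsum_enorm.trans_eq ?_
  congr 1 with i
  rw [← integral_indicator (hS i)]
  congr 2 with z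
  by_cases hz : z ∈ S i <;> simp [hz]

theorem intrinsicA_le_closedBall (hn : 1 ≤ n) (hα0 : 0 < α) (hα1 : α ≤ 1) (ht : 0 < t)
    (f : EuclideanSpace ℝ (Fin n) → 𝕜) :
    intrinsicA α f y t ≤
      ENNReal.ofReal (3 * (t ^ n)⁻¹) * ∫⁻ z in Metric.closedBall y t, ‖f z‖ₑ :=
  intrinsicA_le hn hα0 hα1 ht fun _ hψ => hψ.enorm_integral_mul_le f

theorem intrinsicA_eq_zero (hn : 1 ≤ n) (hα0 : 0 < α) (hα1 : α ≤ 1) (ht : 0 < t)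
    {f : EuclideanSpace ℝ (Fin n) → 𝕜} (hf : ∀ z, dist z y ≤ t → f z = 0) :
    intrinsicA α f y t = 0 := by
  refine le_antisymm ((intrinsicA_le_closedBall hn hα0 hα1 ht f).trans_eq ?_) bot_le
  rw [setLIntegral_congr_fun Metric.isClosed_closedBall.measurableSet
    (g := fun _ => 0) fun z hz => by simp [hf z hz]]
  simp

theorem continuousAt_integral_dilate (hn : 1 ≤ n) (hα0 : 0 < α) (hα1 : α ≤ 1)
    {φ : EuclideanSpace ℝ (Fin n) → 𝕜} (hφ : IsIntrinsicKernel α φ)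
    {f : EuclideanSpace ℝ (Fin n) → 𝕜} (hf : LocallyIntegrable f)
    {p : EuclideanSpace ℝ (Fin n) × ℝ} (hp : 0 < p.2) :
    ContinuousAt (fun p : EuclideanSpace ℝ (Fin n) × ℝ =>
      ∫ z, dilate φ p.2 (p.1 - z) * f z) p := by
  -- For such q the kernel sits in the fixed ball of radius 2 t + 1 and is bounded through t / 2,
  -- which gives a dominating function.
  have hnear : ∀ᶠ q in nhds p, p.2 / 2 < q.2 ∧ q.2 < 2 * p.2 ∧ dist q.1 p.1 < 1 := by
    refine (continuousAt_snd.eventually (lt_mem_nhds (by linarith))).and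
      ((continuousAt_snd.eventually (gt_mem_nhds (by linarith))).and ?_)
    exact continuousAt_fst.eventually (Metric.ball_mem_nhds _ one_pos)
  refine continuousAt_of_dominated (bound := (Metric.closedBall p.1 (2 * p.2 + 1)).indicator
    fun z => 3 * ((p.2 / 2) ^ n)⁻¹ * ‖f z‖) ?_ ?_ ?_ ?_
  · filter_upwards [hnear] with q hq
    exact ((hφ.isTestAt hn hα0 hα1 q.1 (by linarith)).integrable_mul hf).aestronglyMeasurable
  · filter_upwards [hnear] with q hq
    refine Filter.Eventually.of_forall fun z => ?_
    have hq2 : 0 < q.2 := by linarith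
    have hT := hφ.isTestAt hn hα0 hα1 q.1 hq2
    by_cases hz : z ∈ Metric.closedBall p.1 (2 * p.2 + 1)
    · rw [indicator_of_mem hz, norm_mul]
      gcongr
      refine (hT.norm_le z).trans ?_
      gcongr
      exact hq.1.le
    · have : q.2 < dist z q.1 := by
        rw [Metric.mem_closedBall, not_le] at hz
        have := dist_triangle z q.1 p.1
        linarith [hq.2.1, hq.2.2]
      rw [hT.eq_zero z this]
      simp [hz]
  · rw [integrable_indicator_iff Metric.isClosed_closedBall.measurableSet]
    exact ((hf.integrableOn_isCompact (isCompact_closedBall _ _)).norm).const_mul _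
  · refine Filter.Eventually.of_forall fun z => ?_
    have hc := hφ.continuous hα0
    unfold dilate
    refine ContinuousAt.mul (ContinuousAt.smul ?_ ?_) continuousAt_const
    · exact (continuousAt_snd.pow n).inv₀ (pow_ne_zero n hp.ne')
    · refine hc.continuousAt.comp (f := fun q : EuclideanSpace ℝ (Fin n) × ℝ =>
        q.2⁻¹ • (q.1 - z)) ?_
      exact (continuousAt_snd.inv₀ hp.ne').smul (continuousAt_fst.sub continuousAt_const)

/-- The supremum runs over an uncountable family, so measurability comes from lower semicontinuity:
each pairing is continuous in (y,t) for t > 0, and extension by 0 off the open half-space keeps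
lower semicontinuity. -/
theorem measurable_indicator_intrinsicA (hn : 1 ≤ n) (hα0 : 0 < α) (hα1 : α ≤ 1)
    {f : EuclideanSpace ℝ (Fin n) → 𝕜} (hf : LocallyIntegrable f) :
    Measurable (((univ : Set (EuclideanSpace ℝ (Fin n))) ×ˢ Ioi (0 : ℝ)).indicator
      fun p => intrinsicA α f p.1 p.2) := by
  apply LowerSemicontinuous.measurable
  intro p
  have hopen : IsOpen ((univ : Set (EuclideanSpace ℝ (Fin n))) ×ˢ Ioi (0 : ℝ)) :=
    isOpen_univ.prod isOpen_Ioi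
  by_cases hp : p ∈ (univ : Set (EuclideanSpace ℝ (Fin n))) ×ˢ Ioi (0 : ℝ)
  · have hp2 : 0 < p.2 := by simpa using hp
    have h1 : LowerSemicontinuousAt (fun p : EuclideanSpace ℝ (Fin n) × ℝ =>
        intrinsicA α f p.1 p.2) p := by
      unfold intrinsicA
      refine lowerSemicontinuousAt_iSup fun φ => lowerSemicontinuousAt_iSup fun hφ => ?_
      exact (continuousAt_integral_dilate hn hα0 hα1 hφ hf hp2).enorm.lowerSemicontinuousAt
    intro c hc
    rw [indicator_of_mem hp] at hc
    filter_upwards [h1 c hc, hopen.mem_nhds hp] with q hq hqS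
    rwa [indicator_of_mem hqS]
  · intro c hc
    simp [indicator_of_notMem hp] at hc

end IntrinsicA

end Kernels

/-! ### The g*-function as an L² norm: Minkowski and measurability -/

section GStar

theorem ENNReal.lintegral_sq_finset_sum_le {X ι : Type*} [MeasurableSpace X] {μ : Measure X}
    {f : ι → X → ℝ≥0∞} (hf : ∀ i, AEMeasurable (f i) μ) (s : Finset ι) :
    (∫⁻ x, (∑ i ∈ s, f i x) ^ 2 ∂μ) ^ (1 / 2 : ℝ) ≤
      ∑ i ∈ s, (∫⁻ x, f i x ^ 2 ∂μ) ^ (1 / 2 : ℝ) := by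
  classical
  induction s using Finset.induction_on with
  | empty => simp
  | insert a s ha ih =>
    simp only [Finset.sum_insert ha]
    have h := ENNReal.lintegral_Lp_add_le (hf a)
      (Finset.aemeasurable_fun_sum s fun i _ => hf i) (p := 2) (by norm_num)
    simp only [Pi.add_apply, ENNReal.rpow_two] at h
    exact h.trans (by gcongr)

/-- Minkowski's inequality in `L²` for countable sums of nonnegative functions. -/
theorem ENNReal.lintegral_sq_tsum_le {X ι : Type*} [Countable ι] [MeasurableSpace X]
    {μ : Measure X} {f : ι → X → ℝ≥0∞} (hf : ∀ i, AEMeasurable (f i) μ) :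
    (∫⁻ x, (∑' i, f i x) ^ 2 ∂μ) ^ (1 / 2 : ℝ) ≤
      ∑' i, (∫⁻ x, f i x ^ 2 ∂μ) ^ (1 / 2 : ℝ) := by
  classical
  have hmono : ∀ x, Monotone fun s : Finset ι => ∑ i ∈ s, f i x := fun x s t hst =>
    Finset.sum_le_sum_of_subset hst
  have h1 : ∀ x, (∑' i, f i x) ^ 2 = ⨆ s : Finset ι, (∑ i ∈ s, f i x) ^ 2 := fun x => by
    rw [ENNReal.tsum_eq_iSup_sum]
    exact (ENNReal.pow_right_strictMono two_ne_zero).monotone.map_iSup_of_continuousAt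
      (ENNReal.continuous_pow 2).continuousAt (by simp)
  simp only [h1]
  -- Monotone convergence along the directed family of finite partial sums reduces the claim to
  -- finite sums.
  rw [lintegral_iSup_directed
    (fun s => (Finset.aemeasurable_fun_sum s fun i _ => hf i).pow_const 2)]
  · rw [← ENNReal.le_rpow_inv_iff (by norm_num)]
    refine iSup_le fun s => ?_
    rw [ENNReal.le_rpow_inv_iff (by norm_num)]
    exact (ENNReal.lintegral_sq_finset_sum_le hf s).trans (ENNReal.sum_le_tsum s)
  · intro s t
    refine ⟨s ∪ t, fun x => ?_, fun x => ?_⟩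
    · exact pow_le_pow_left₀ bot_le (hmono x Finset.subset_union_left) 2
    · exact pow_le_pow_left₀ bot_le (hmono x Finset.subset_union_right) 2

variable {𝕜 : Type*} [RCLike 𝕜] {n : ℕ}

/-- The upper half-space `ℝⁿ × (0,∞)`. -/
abbrev upperHalf (n : ℕ) : Set (EuclideanSpace ℝ (Fin n) × ℝ) := univ ×ˢ Ioi (0 : ℝ)

theorem measurableSet_upperHalf : MeasurableSet (upperHalf n) :=
  MeasurableSet.univ.prod measurableSet_Ioi

/-- The density of the measure defining the `g*`-function. -/
noncomputable def gStarWeight (lam : ℝ) (x : EuclideanSpace ℝ (Fin n))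
    (p : EuclideanSpace ℝ (Fin n) × ℝ) : ℝ≥0∞ :=
  ENNReal.ofReal ((p.2 / (p.2 + ‖x - p.1‖)) ^ (lam * n)) * ENNReal.ofReal (1 / p.2 ^ (n + 1))

theorem measurable_gStarWeight_uncurry (lam : ℝ) : Measurable
    fun q : EuclideanSpace ℝ (Fin n) × (EuclideanSpace ℝ (Fin n) × ℝ) =>
      gStarWeight lam q.1 q.2 := by
  unfold gStarWeight
  fun_prop

theorem measurable_gStarWeight (lam : ℝ) (x : EuclideanSpace ℝ (Fin n)) :
    Measurable (gStarWeight lam x) := by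
  unfold gStarWeight
  fun_prop

/-- The measure defining the `g*`-function at `x`. -/
noncomputable def gStarMeasure (lam : ℝ) (x : EuclideanSpace ℝ (Fin n)) :
    Measure (EuclideanSpace ℝ (Fin n) × ℝ) :=
  (volume.restrict (upperHalf n)).withDensity (gStarWeight lam x)

/-- Writing g* as an L² norm of A_α makes Minkowski's inequality available. Finiteness of the
density lets the identity hold without measurability of A_α. -/
theorem intrinsicGStar_eq (lam α : ℝ) (f : EuclideanSpace ℝ (Fin n) → 𝕜)
    (x : EuclideanSpace ℝ (Fin n)) :
    intrinsicGStar lam α f x =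
      (∫⁻ p, intrinsicA α f p.1 p.2 ^ 2 ∂gStarMeasure lam x) ^ (1 / 2 : ℝ) := by
  rw [intrinsicGStar, gStarMeasure, lintegral_withDensity_eq_lintegral_mul_non_measurable _
    (measurable_gStarWeight lam x)]
  · congr 2
    ext p
    simp only [Pi.mul_apply, gStarWeight]
    ring
  · exact Filter.Eventually.of_forall fun p =>
      ENNReal.mul_lt_top ENNReal.ofReal_lt_top ENNReal.ofReal_lt_top

theorem gStarMeasure_ae (lam : ℝ) (x : EuclideanSpace ℝ (Fin n)) :
    ∀ᵐ p ∂gStarMeasure lam x, 0 < p.2 := by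
  apply (withDensity_absolutelyContinuous _ _).ae_le
  filter_upwards [ae_restrict_mem measurableSet_upperHalf] with p hp
  simpa using hp

variable {α : ℝ}

theorem aemeasurable_intrinsicA (hn : 1 ≤ n) (hα0 : 0 < α) (hα1 : α ≤ 1) (lam : ℝ)
    (x : EuclideanSpace ℝ (Fin n)) {f : EuclideanSpace ℝ (Fin n) → 𝕜}
    (hf : LocallyIntegrable f) :
    AEMeasurable (fun p : EuclideanSpace ℝ (Fin n) × ℝ => intrinsicA α f p.1 p.2)
      (gStarMeasure lam x) := by
  refine ⟨_, measurable_indicator_intrinsicA hn hα0 hα1 hf, ?_⟩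
  filter_upwards [gStarMeasure_ae lam x] with p hp
  rw [indicator_of_mem (by simpa using hp)]

theorem intrinsicGStar_eq_indicator (lam α : ℝ) (f : EuclideanSpace ℝ (Fin n) → 𝕜)
    (x : EuclideanSpace ℝ (Fin n)) :
    intrinsicGStar lam α f x = (∫⁻ p, gStarWeight lam x p *
      (upperHalf n).indicator (fun p => intrinsicA α f p.1 p.2) p ^ 2
        ∂volume.restrict (upperHalf n)) ^ (1 / 2 : ℝ) := by
  rw [intrinsicGStar]
  congr 1
  refine setLIntegral_congr_fun measurableSet_upperHalf fun p hp => ?_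
  simp only [gStarWeight, indicator_of_mem hp]
  ring

theorem measurable_intrinsicGStar (hn : 1 ≤ n) (hα0 : 0 < α) (hα1 : α ≤ 1) (lam : ℝ)
    {f : EuclideanSpace ℝ (Fin n) → 𝕜} (hf : LocallyIntegrable f) :
    Measurable (intrinsicGStar lam α f) := by
  simp only [funext fun x => intrinsicGStar_eq_indicator lam α f x]
  apply Measurable.pow_const
  apply Measurable.lintegral_prod_right
  exact (measurable_gStarWeight_uncurry lam).mul
    (((measurable_indicator_intrinsicA hn hα0 hα1 hf).comp measurable_snd).pow_const 2)

theorem intrinsicGStar_le_tsum (hn : 1 ≤ n) (hα0 : 0 < α) (hα1 : α ≤ 1) (lam : ℝ)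
    {ι : Type*} [Countable ι] {f : EuclideanSpace ℝ (Fin n) → 𝕜}
    {F : ι → EuclideanSpace ℝ (Fin n) → 𝕜} (hF : ∀ i, LocallyIntegrable (F i))
    (h : ∀ y t, 0 < t → intrinsicA α f y t ≤ ∑' i, intrinsicA α (F i) y t)
    (x : EuclideanSpace ℝ (Fin n)) :
    intrinsicGStar lam α f x ≤ ∑' i, intrinsicGStar lam α (F i) x := by
  simp only [intrinsicGStar_eq]
  refine le_trans ?_ (ENNReal.lintegral_sq_tsum_le
    fun i => aemeasurable_intrinsicA hn hα0 hα1 lam x (hF i))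
  refine ENNReal.rpow_le_rpow (lintegral_mono_ae ?_) (by norm_num)
  filter_upwards [gStarMeasure_ae lam x] with p hp
  exact pow_le_pow_left₀ bot_le (h _ _ hp) 2

theorem intrinsicGStar_add_le (hn : 1 ≤ n) (hα0 : 0 < α) (hα1 : α ≤ 1) (lam : ℝ)
    {f g : EuclideanSpace ℝ (Fin n) → 𝕜} (hf : LocallyIntegrable f) (hg : LocallyIntegrable g)
    (x : EuclideanSpace ℝ (Fin n)) :
    intrinsicGStar lam α (f + g) x ≤ intrinsicGStar lam α f x + intrinsicGStar lam α g x := by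
  have := intrinsicGStar_le_tsum (F := fun b : Bool => if b then g else f) (f := f + g)
    (α := α) hn hα0 hα1 lam (fun b => by cases b <;> simpa) ?_ x
  · simpa [tsum_fintype, add_comm] using this
  · intro y t ht
    simpa [tsum_fintype, add_comm] using intrinsicA_add_le (y := y) hn hα0 hα1 ht hf hg

theorem intrinsicGStar_le_tsum_indicator (hn : 1 ≤ n) (hα0 : 0 < α) (hα1 : α ≤ 1) (lam : ℝ)
    {ι : Type*} [Countable ι] {S : ι → Set (EuclideanSpace ℝ (Fin n))}
    (hS : ∀ i, MeasurableSet (S i)) (hd : Pairwise fun i j => Disjoint (S i) (S j))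
    {f : EuclideanSpace ℝ (Fin n) → 𝕜} (hf : LocallyIntegrable f)
    (hfS : ∀ x, x ∉ ⋃ i, S i → f x = 0) (x : EuclideanSpace ℝ (Fin n)) :
    intrinsicGStar lam α f x ≤ ∑' i, intrinsicGStar lam α ((S i).indicator f) x :=
  intrinsicGStar_le_tsum hn hα0 hα1 lam (fun i => hf.indicator (hS i))
    (fun _ _ ht => intrinsicA_le_tsum_indicator hn hα0 hα1 ht hS hd hf hfS) x

end GStar

/-! ### Dyadic cubes, averages, and cancellation -/

section Dyadic

variable {n : ℕ}

/-- The side length `2⁻ᵏ` of the dyadic cubes of generation `k`. -/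
noncomputable def dyadicSide (k : ℤ) : ℝ := (2 : ℝ) ^ (-k)

theorem dyadicSide_pos (k : ℤ) : 0 < dyadicSide k := by unfold dyadicSide; positivity

theorem dyadicSide_succ (k : ℤ) : dyadicSide k = 2 * dyadicSide (k + 1) := by
  rw [dyadicSide, dyadicSide, neg_add, zpow_add₀ two_ne_zero]
  norm_num
  ring

theorem dyadicSide_eq_mul {j k : ℤ} (h : j ≤ k) :
    dyadicSide j = dyadicSide k * ((2 ^ (k - j).toNat : ℕ) : ℝ) := by
  rw [dyadicSide, dyadicSide, Nat.cast_pow, Nat.cast_ofNat, ← zpow_natCast,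
    Int.toNat_of_nonneg (by omega), ← zpow_add₀ two_ne_zero]
  congr 1
  ring

/-- The index of the dyadic cube of generation `k` containing `x`. -/
noncomputable def cubeIdx (k : ℤ) (x : EuclideanSpace ℝ (Fin n)) : Fin n → ℤ :=
  fun i => ⌊x i / dyadicSide k⌋

/-- The half-open dyadic cube of generation `k` with index `m`. -/
def dyadicCube (k : ℤ) (m : Fin n → ℤ) : Set (EuclideanSpace ℝ (Fin n)) :=
  {x | cubeIdx k x = m}

/-- Nestedness of the cubes: the coarse side is a natural multiple of the fine one, and the floor
after division by a natural number depends only on the floor before it. -/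
theorem cubeIdx_congr {j k : ℤ} (h : j ≤ k) {x z : EuclideanSpace ℝ (Fin n)}
    (hxz : cubeIdx k x = cubeIdx k z) : cubeIdx j x = cubeIdx j z := by
  ext i
  have := congrFun hxz i
  simp only [cubeIdx] at this ⊢
  rw [dyadicSide_eq_mul h, ← div_div, ← div_div, Int.floor_div_natCast, Int.floor_div_natCast,
    this]

theorem measurable_cubeIdx (k : ℤ) : Measurable (cubeIdx (n := n) k) := by
  unfold cubeIdx
  fun_prop

theorem measurableSet_dyadicCube (k : ℤ) (m : Fin n → ℤ) : MeasurableSet (dyadicCube k m) :=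
  measurable_cubeIdx k (measurableSet_singleton m)

theorem iUnion_dyadicCube (k : ℤ) : ⋃ m, dyadicCube (n := n) k m = univ :=
  eq_univ_of_forall fun x => mem_iUnion.2 ⟨cubeIdx k x, rfl⟩

theorem disjoint_dyadicCube (k : ℤ) :
    Pairwise fun m m' => Disjoint (dyadicCube (n := n) k m) (dyadicCube k m') :=
  fun _ _ h => Set.disjoint_left.2 fun _ hx hx' => h (hx.symm.trans hx')

/-- The corner of a dyadic cube. -/
noncomputable def cubeCorner (k : ℤ) (m : Fin n → ℤ) : EuclideanSpace ℝ (Fin n) :=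
  WithLp.toLp 2 fun i => dyadicSide k * m i

theorem cubeIdx_cubeCorner (k : ℤ) (m : Fin n → ℤ) : cubeIdx k (cubeCorner k m) = m := by
  ext i
  simp [cubeIdx, cubeCorner, mul_div_cancel_left₀ _ (dyadicSide_pos k).ne']

theorem floor_div_dyadicSide_eq_iff (k : ℤ) (u : ℝ) (a : ℤ) : ⌊u / dyadicSide k⌋ = a ↔
    u ∈ Ico (dyadicSide k * a) (dyadicSide k * a + dyadicSide k) := by
  have := dyadicSide_pos k
  rw [Int.floor_eq_iff, le_div_iff₀ this, div_lt_iff₀ this, mem_Ico, mul_comm, add_mul, one_mul,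
    mul_comm (a : ℝ)]

theorem dist_le_of_cubeIdx_eq {k : ℤ} {x z : EuclideanSpace ℝ (Fin n)}
    (h : cubeIdx k x = cubeIdx k z) : dist x z ≤ √n * dyadicSide k := by
  have hs := dyadicSide_pos k
  rw [EuclideanSpace.dist_eq]
  calc √(∑ i, dist (x i) (z i) ^ 2) ≤ √(∑ _i : Fin n, dyadicSide k ^ 2) := by
        gcongr with i
        have h1 := (floor_div_dyadicSide_eq_iff k (x i) _).1 (congrFun h i)
        have h2 := (floor_div_dyadicSide_eq_iff k (z i) _).1 rfl
        rw [mem_Ico] at h1 h2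
        rw [Real.dist_eq, abs_le]
        simp only [cubeIdx] at h1 h2
        constructor <;> linarith
    _ = √n * dyadicSide k := by
        rw [Finset.sum_const, Finset.card_univ, Fintype.card_fin, nsmul_eq_mul,
          Real.sqrt_mul (by positivity), Real.sqrt_sq hs.le]

theorem volume_preimage_ofLp_pi (S : Fin n → Set ℝ) (hS : ∀ i, MeasurableSet (S i)) :
    volume {x : EuclideanSpace ℝ (Fin n) | ∀ i, x i ∈ S i} = ∏ i, volume (S i) := by
  rw [← volume_pi_pi, ← (PiLp.volume_preserving_ofLp (Fin n)).measure_preimage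
    (MeasurableSet.univ_pi hS).nullMeasurableSet]
  congr 1
  ext x
  simp

theorem dyadicCube_eq (k : ℤ) (m : Fin n → ℤ) : dyadicCube k m =
    {x | ∀ i, x i ∈ Ico (dyadicSide k * m i) (dyadicSide k * m i + dyadicSide k)} := by
  ext x
  simp only [dyadicCube, mem_ofPred_eq, funext_iff, cubeIdx, floor_div_dyadicSide_eq_iff]

theorem volume_dyadicCube (k : ℤ) (m : Fin n → ℤ) :
    volume (dyadicCube k m) = ENNReal.ofReal (dyadicSide k ^ n) := by
  rw [dyadicCube_eq, volume_preimage_ofLp_pi _ fun _ => measurableSet_Ico]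
  simp [Real.volume_Ico, ENNReal.ofReal_pow (dyadicSide_pos k).le]

theorem volume_Ico_inter_shift_le (a s h : ℝ) :
    volume (Ico a (a + s) ∩ {u | u + h ∉ Ico a (a + s)}) ≤ ENNReal.ofReal |h| := by
  rcases le_total 0 h with hh | hh
  · refine (measure_mono (t := Ico (a + s - h) (a + s)) ?_).trans ?_
    · rintro u ⟨hu, hu'⟩
      simp only [mem_ofPred_eq, mem_Ico, not_and, not_lt] at hu hu' ⊢
      have := hu' (by linarith)
      constructor <;> linarith
    · rw [Real.volume_Ico, abs_of_nonneg hh, sub_sub_cancel]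
  · refine (measure_mono (t := Ico a (a - h)) ?_).trans ?_
    · rintro u ⟨hu, hu'⟩
      simp only [mem_ofPred_eq, mem_Ico, not_and_or, not_lt, not_le] at hu hu' ⊢
      refine ⟨hu.1, ?_⟩
      rcases hu' with hu' | hu' <;> linarith
    · rw [Real.volume_Ico, abs_of_nonpos hh, sub_sub_cancel_left]

/-- A point leaves its cube under the shift only if some coordinate leaves its interval. For one
coordinate this is a slab of thickness at most |h i| ≤ ‖h‖; the factor n counts coordinates. -/
theorem volume_dyadicCube_shift_le (k : ℤ) (m : Fin n → ℤ) (h : EuclideanSpace ℝ (Fin n)) :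
    volume (dyadicCube k m ∩ {x | cubeIdx k (x + h) ≠ m}) ≤
      n * ENNReal.ofReal (‖h‖ / dyadicSide k) * volume (dyadicCube k m) := by
  have hs := dyadicSide_pos k
  set I : Fin n → Set ℝ := fun i => Ico (dyadicSide k * m i) (dyadicSide k * m i + dyadicSide k)
  have hsub : dyadicCube k m ∩ {x | cubeIdx k (x + h) ≠ m} ⊆
      ⋃ i, {x : EuclideanSpace ℝ (Fin n) |
        ∀ j, x j ∈ Function.update I i (I i ∩ {u | u + h i ∉ I i}) j} := by
    rintro x ⟨hx, hx'⟩
    rw [dyadicCube_eq] at hx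
    obtain ⟨i, hi⟩ := Function.ne_iff.1 hx'
    refine mem_iUnion.2 ⟨i, fun j => ?_⟩
    rcases eq_or_ne j i with rfl | hj
    · rw [Function.update_self]
      refine ⟨hx j, fun hj => hi ?_⟩
      exact (floor_div_dyadicSide_eq_iff k _ _).2 hj
    · rw [Function.update_of_ne hj]
      exact hx j
  refine (measure_mono hsub).trans ((measure_iUnion_le _).trans ?_)
  rw [tsum_fintype]
  have hone : ∀ i, volume {x : EuclideanSpace ℝ (Fin n) |
      ∀ j, x j ∈ Function.update I i (I i ∩ {u | u + h i ∉ I i}) j} ≤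
      ENNReal.ofReal (‖h‖ / dyadicSide k) * volume (dyadicCube k m) := by
    intro i
    rw [volume_preimage_ofLp_pi]
    · have : (fun j => volume (Function.update I i (I i ∩ {u | u + h i ∉ I i}) j)) =
          Function.update (fun j => volume (I j)) i (volume (I i ∩ {u | u + h i ∉ I i})) := by
        ext j
        rcases eq_or_ne j i with rfl | hj
        · simp
        · simp [Function.update_of_ne hj]
      rw [this, Finset.prod_update_of_mem (Finset.mem_univ i), volume_dyadicCube]
      simp only [I, Real.volume_Ico, add_sub_cancel_left, Finset.prod_const, Finset.card_sdiff,
        Finset.card_univ, Fintype.card_fin]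
      have hn : n ≠ 0 := fun h0 => by subst h0; exact i.elim0
      rw [Finset.inter_univ, Finset.card_singleton, ← ENNReal.ofReal_pow hs.le,
        ← ENNReal.ofReal_mul (by positivity)]
      have h2 : ‖h‖ / dyadicSide k * dyadicSide k ^ n = ‖h‖ * dyadicSide k ^ (n - 1) := by
        rw [← mul_pow_sub_one hn]
        field_simp
      rw [h2, ENNReal.ofReal_mul (norm_nonneg _)]
      gcongr
      refine (volume_Ico_inter_shift_le _ _ _).trans (ENNReal.ofReal_le_ofReal ?_)
      exact PiLp.norm_apply_le h i
    · intro j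
      rcases eq_or_ne j i with rfl | hj
      · rw [Function.update_self]
        refine measurableSet_Ico.inter ?_
        exact (measurable_id.add_const _) measurableSet_Ico.compl
      · rw [Function.update_of_ne hj]
        exact measurableSet_Ico
  refine (Finset.sum_le_sum fun i _ => hone i).trans_eq ?_
  rw [Finset.sum_const, Finset.card_univ, Fintype.card_fin, nsmul_eq_mul, mul_assoc]

theorem lintegral_eq_tsum_dyadicCube (k : ℤ) (u : EuclideanSpace ℝ (Fin n) → ℝ≥0∞) :
    ∫⁻ x, u x = ∑' m, ∫⁻ x in dyadicCube k m, u x := by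
  rw [← lintegral_iUnion (measurableSet_dyadicCube k) (disjoint_dyadicCube k), iUnion_dyadicCube,
    setLIntegral_univ]

/-- The average of a nonnegative function over the dyadic cube of generation `k`
containing `x`. -/
noncomputable def dyadicLAvg (k : ℤ) (u : EuclideanSpace ℝ (Fin n) → ℝ≥0∞)
    (x : EuclideanSpace ℝ (Fin n)) : ℝ≥0∞ :=
  (ENNReal.ofReal (dyadicSide k ^ n))⁻¹ * ∫⁻ z in dyadicCube k (cubeIdx k x), u z

theorem ofReal_dyadicSide_pow_ne_zero (k : ℤ) : ENNReal.ofReal (dyadicSide k ^ n) ≠ 0 := by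
  have := dyadicSide_pos k
  simpa using pow_pos this n

theorem dyadicLAvg_congr {k : ℤ} (u : EuclideanSpace ℝ (Fin n) → ℝ≥0∞)
    {x z : EuclideanSpace ℝ (Fin n)} (h : cubeIdx k x = cubeIdx k z) :
    dyadicLAvg k u x = dyadicLAvg k u z := by
  rw [dyadicLAvg, h, dyadicLAvg]

theorem setLIntegral_dyadicLAvg (k : ℤ) (m : Fin n → ℤ) (u : EuclideanSpace ℝ (Fin n) → ℝ≥0∞) :
    ∫⁻ x in dyadicCube k m, dyadicLAvg k u x = ∫⁻ x in dyadicCube k m, u x := by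
  rw [setLIntegral_congr_fun (measurableSet_dyadicCube k m)
    (g := fun _ => (ENNReal.ofReal (dyadicSide k ^ n))⁻¹ * ∫⁻ z in dyadicCube k m, u z)
    fun x hx => by
      simp only [dyadicCube, mem_ofPred_eq] at hx
      rw [dyadicLAvg, hx],
    setLIntegral_const, volume_dyadicCube, mul_right_comm,
    ENNReal.inv_mul_cancel (ofReal_dyadicSide_pow_ne_zero k) ENNReal.ofReal_ne_top, one_mul]

theorem lintegral_dyadicLAvg (k : ℤ) (u : EuclideanSpace ℝ (Fin n) → ℝ≥0∞) :
    ∫⁻ x, dyadicLAvg k u x = ∫⁻ x, u x := by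
  rw [lintegral_eq_tsum_dyadicCube k, lintegral_eq_tsum_dyadicCube k u]
  simp only [setLIntegral_dyadicLAvg]

theorem dyadicLAvg_le_lintegral (k : ℤ) (u : EuclideanSpace ℝ (Fin n) → ℝ≥0∞)
    (x : EuclideanSpace ℝ (Fin n)) :
    dyadicLAvg k u x ≤ (ENNReal.ofReal (dyadicSide k ^ n))⁻¹ * ∫⁻ z, u z := by
  unfold dyadicLAvg
  gcongr
  exact Measure.restrict_le_self

theorem dyadicLAvg_succ_le (k : ℤ) (u : EuclideanSpace ℝ (Fin n) → ℝ≥0∞)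
    (x : EuclideanSpace ℝ (Fin n)) : dyadicLAvg (k + 1) u x ≤ 2 ^ n * dyadicLAvg k u x := by
  unfold dyadicLAvg
  have h1 : (ENNReal.ofReal (dyadicSide (k + 1) ^ n))⁻¹ =
      2 ^ n * (ENNReal.ofReal (dyadicSide k ^ n))⁻¹ := by
    have h2 : (2 : ℝ≥0∞) ^ n ≠ 0 := by positivity
    have h3 : (2 : ℝ≥0∞) ^ n ≠ ⊤ := by simp
    rw [dyadicSide_succ k, mul_pow, ENNReal.ofReal_mul (by positivity),
      ENNReal.ofReal_pow zero_le_two, ENNReal.ofReal_ofNat,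
      ENNReal.mul_inv (Or.inl h2) (Or.inl h3), ← mul_assoc, ENNReal.mul_inv_cancel h2 h3, one_mul]
  rw [h1, mul_assoc]
  gcongr
  intro z hz
  exact cubeIdx_congr (by omega) hz

variable {𝕜 : Type*} [RCLike 𝕜]

/-- The average of a function over the dyadic cube of generation `k` containing `x`. -/
noncomputable def dyadicAvg (k : ℤ) (f : EuclideanSpace ℝ (Fin n) → 𝕜)
    (x : EuclideanSpace ℝ (Fin n)) : 𝕜 :=
  (dyadicSide k ^ n)⁻¹ • ∫ z in dyadicCube k (cubeIdx k x), f z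

theorem dyadicAvg_congr {k : ℤ} (f : EuclideanSpace ℝ (Fin n) → 𝕜)
    {x z : EuclideanSpace ℝ (Fin n)} (h : cubeIdx k x = cubeIdx k z) :
    dyadicAvg k f x = dyadicAvg k f z := by
  rw [dyadicAvg, h, dyadicAvg]

theorem enorm_dyadicAvg_le (k : ℤ) (f : EuclideanSpace ℝ (Fin n) → 𝕜)
    (x : EuclideanSpace ℝ (Fin n)) :
    ‖dyadicAvg k f x‖ₑ ≤ dyadicLAvg k (fun z => ‖f z‖ₑ) x := by
  have := dyadicSide_pos k
  rw [dyadicAvg, enorm_smul, Real.enorm_of_nonneg (by positivity),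
    ENNReal.ofReal_inv_of_pos (by positivity)]
  unfold dyadicLAvg
  gcongr
  exact enorm_integral_le_lintegral_enorm _

theorem measurable_comp_cubeIdx {β : Type*} [MeasurableSpace β] (k : ℤ)
    (h : (Fin n → ℤ) → β) : Measurable fun x : EuclideanSpace ℝ (Fin n) => h (cubeIdx k x) :=
  (measurable_of_countable h).comp (measurable_cubeIdx k)

theorem measurable_dyadicAvg (k : ℤ) (f : EuclideanSpace ℝ (Fin n) → 𝕜) :
    Measurable (dyadicAvg k f) :=
  measurable_comp_cubeIdx k fun m => (dyadicSide k ^ n)⁻¹ • ∫ z in dyadicCube k m, f z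

theorem lintegral_enorm_dyadicAvg_le (k : ℤ) (f : EuclideanSpace ℝ (Fin n) → 𝕜) :
    ∫⁻ x, ‖dyadicAvg k f x‖ₑ ≤ ∫⁻ x, ‖f x‖ₑ :=
  (lintegral_mono (enorm_dyadicAvg_le k f)).trans_eq (lintegral_dyadicLAvg k _)

theorem integrable_dyadicAvg (k : ℤ) {f : EuclideanSpace ℝ (Fin n) → 𝕜} (hf : Integrable f) :
    Integrable (dyadicAvg k f) :=
  ⟨(measurable_dyadicAvg k f).aestronglyMeasurable,
    (lintegral_enorm_dyadicAvg_le k f).trans_lt hf.2⟩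

theorem setIntegral_dyadicAvg (k : ℤ) (m : Fin n → ℤ) (f : EuclideanSpace ℝ (Fin n) → 𝕜) :
    ∫ x in dyadicCube k m, dyadicAvg k f x = ∫ x in dyadicCube k m, f x := by
  have := dyadicSide_pos k
  rw [setIntegral_congr_fun (measurableSet_dyadicCube k m)
    (g := fun _ => (dyadicSide k ^ n)⁻¹ • ∫ z in dyadicCube k m, f z)
    fun x hx => by
      simp only [dyadicCube, mem_ofPred_eq] at hx
      rw [dyadicAvg, hx],
    setIntegral_const, measureReal_def, volume_dyadicCube, ENNReal.toReal_ofReal (by positivity),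
    smul_smul, mul_inv_cancel₀ (by positivity), one_smul]

/-- A function with vanishing integral over each dyadic cube of generation `k` is orthogonal to
all functions that are constant on these cubes. -/
theorem integral_comp_cubeIdx_mul_eq_zero {k : ℤ} {f : EuclideanSpace ℝ (Fin n) → 𝕜}
    (hf : ∀ m, ∫ x in dyadicCube k m, f x = 0) (h : (Fin n → ℤ) → 𝕜)
    (hi : Integrable fun x => h (cubeIdx k x) * f x) : ∫ x, h (cubeIdx k x) * f x = 0 := by
  rw [← setIntegral_univ, ← iUnion_dyadicCube k, integral_iUnion (measurableSet_dyadicCube k)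
    (disjoint_dyadicCube k) hi.integrableOn]
  refine (tsum_congr fun m => ?_).trans tsum_zero
  rw [setIntegral_congr_fun (measurableSet_dyadicCube k m) (g := fun x => h m * f x)
    fun x hx => by
      simp only [dyadicCube, mem_ofPred_eq] at hx
      simp only [hx], integral_const_mul, hf, mul_zero]

theorem setIntegral_sub_dyadicAvg (k : ℤ) {f : EuclideanSpace ℝ (Fin n) → 𝕜} (hf : Integrable f)
    (m : Fin n → ℤ) : ∫ x in dyadicCube k m, (f x - dyadicAvg k f x) = 0 := by
  rw [integral_sub hf.integrableOn (integrable_dyadicAvg k hf).integrableOn,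
    setIntegral_dyadicAvg, sub_self]

theorem setIntegral_dyadicAvg_of_le {j k : ℤ} (hjk : j ≤ k) (m : Fin n → ℤ)
    {f : EuclideanSpace ℝ (Fin n) → 𝕜} (hf : Integrable f) :
    ∫ x in dyadicCube j m, dyadicAvg k f x = ∫ x in dyadicCube j m, f x := by
  classical
  have hE := integrable_dyadicAvg k hf
  -- The indicator of a coarse cube is constant on the finer cubes, hence orthogonal to f minus its
  -- fine average.
  have key : ∀ x, (if cubeIdx j (cubeCorner k (cubeIdx k x)) = m then (1 : 𝕜) else 0) *
      (f x - dyadicAvg k f x) =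
      (dyadicCube j m).indicator (fun x => f x - dyadicAvg k f x) x := by
    intro x
    have : cubeIdx j (cubeCorner k (cubeIdx k x)) = cubeIdx j x :=
      cubeIdx_congr hjk (cubeIdx_cubeCorner k _)
    rw [this]
    by_cases hx : cubeIdx j x = m
    · rw [indicator_of_mem (show x ∈ dyadicCube j m from hx), if_pos hx, one_mul]
    · rw [indicator_of_notMem (show x ∉ dyadicCube j m from hx), if_neg hx, zero_mul]
  have hint := (hf.sub hE).indicator (measurableSet_dyadicCube j m)
  have h0 := integral_comp_cubeIdx_mul_eq_zero (setIntegral_sub_dyadicAvg k hf)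
    (fun m' => if cubeIdx j (cubeCorner k m') = m then (1 : 𝕜) else 0)
    (hint.congr (Filter.Eventually.of_forall fun x => (key x).symm))
  simp only [key] at h0
  rw [integral_indicator (measurableSet_dyadicCube j m),
    integral_sub hf.integrableOn hE.integrableOn, sub_eq_zero] at h0
  exact h0.symm

/-- Gain from the Hölder condition against functions with mean zero on dyadic cubes. -/
theorem IsTestAt.enorm_integral_mul_le_of_mean_zero {α : ℝ} (hα0 : 0 < α)
    {y : EuclideanSpace ℝ (Fin n)} {t : ℝ} (ht : 0 < t)
    {ψ : EuclideanSpace ℝ (Fin n) → 𝕜} (hψ : IsTestAt α y t ψ) {k : ℤ}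
    {f : EuclideanSpace ℝ (Fin n) → 𝕜} (hfi : Integrable f)
    (hf : ∀ m, ∫ x in dyadicCube k m, f x = 0) :
    ‖∫ z, ψ z * f z‖ₑ ≤ ENNReal.ofReal ((t ^ n)⁻¹ * (√n * dyadicSide k / t) ^ α) *
      ∫⁻ z in Metric.closedBall y (t + √n * dyadicSide k), ‖f z‖ₑ := by
  -- Replacing z by the corner of its cube freezes ψ on each cube. The frozen function integrates to
  -- 0 against f, and the remainder is controlled by the Hölder condition at the cube diameter.
  set c : EuclideanSpace ℝ (Fin n) → EuclideanSpace ℝ (Fin n) :=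
    fun z => cubeCorner k (cubeIdx k z) with hc
  have hs := dyadicSide_pos k
  have hdist : ∀ z, dist z (c z) ≤ √n * dyadicSide k := fun z =>
    dist_le_of_cubeIdx_eq (cubeIdx_cubeCorner k _).symm
  have hi : Integrable fun z => ψ (c z) * f z :=
    hfi.bdd_mul (c := 3 * (t ^ n)⁻¹)
      (measurable_comp_cubeIdx k fun m => ψ (cubeCorner k m)).aestronglyMeasurable
      (Filter.Eventually.of_forall fun z => hψ.norm_le _)
  have h0 := integral_comp_cubeIdx_mul_eq_zero hf (fun m => ψ (cubeCorner k m)) hi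
  have h1 : ∫ z, ψ z * f z = ∫ z, (ψ z - ψ (c z)) * f z := by
    simp only [sub_mul]
    rw [integral_sub (hψ.integrable_mul hfi.locallyIntegrable) hi]
    simp only [hc, h0, sub_zero]
  rw [h1]
  refine (enorm_integral_le_lintegral_enorm _).trans ?_
  rw [← lintegral_indicator Metric.isClosed_closedBall.measurableSet,
    ← lintegral_const_mul' _ _ ENNReal.ofReal_ne_top]
  refine lintegral_mono fun z => ?_
  by_cases hz : z ∈ Metric.closedBall y (t + √n * dyadicSide k)
  · simp only [hz, indicator_of_mem, enorm_mul]
    gcongr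
    rw [← ofReal_norm]
    refine ENNReal.ofReal_le_ofReal ((hψ.holder _ _).trans ?_)
    gcongr
    exact hdist z
  -- Outside the enlarged ball both z and its corner are farther than t from y, so both values of ψ
  -- vanish.
  · rw [Metric.mem_closedBall, not_le] at hz
    have hd := hdist z
    rw [hψ.eq_zero z (by nlinarith [Real.sqrt_nonneg (n : ℝ)]), hψ.eq_zero (c z)]
    · simp
    · have := dist_triangle z (c z) y
      linarith

theorem intrinsicA_le_of_mean_zero {α : ℝ} (hn : 1 ≤ n) (hα0 : 0 < α) (hα1 : α ≤ 1)
    {y : EuclideanSpace ℝ (Fin n)} {t : ℝ} (ht : 0 < t) {k : ℤ}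
    {f : EuclideanSpace ℝ (Fin n) → 𝕜} (hfi : Integrable f)
    (hf : ∀ m, ∫ x in dyadicCube k m, f x = 0) :
    intrinsicA α f y t ≤ ENNReal.ofReal ((t ^ n)⁻¹ * (√n * dyadicSide k / t) ^ α) *
      ∫⁻ z in Metric.closedBall y (t + √n * dyadicSide k), ‖f z‖ₑ :=
  intrinsicA_le hn hα0 hα1 ht fun _ hψ => hψ.enorm_integral_mul_le_of_mean_zero hα0 ht hfi hf

end Dyadic

/-! ### L² estimates at a single scale -/

section SquareFunction

/-- The Cauchy–Schwarz inequality with a weight. -/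
theorem ENNReal.sq_lintegral_le_mul {X : Type*} [MeasurableSpace X] {μ : Measure X}
    {a w : X → ℝ≥0∞} (ha : AEMeasurable a μ) (hw : AEMeasurable w μ) (hw0 : ∀ x, w x ≠ 0)
    (hwt : ∀ x, w x ≠ ⊤) :
    (∫⁻ x, a x ∂μ) ^ 2 ≤ (∫⁻ x, w x ∂μ) * ∫⁻ x, (w x)⁻¹ * a x ^ 2 ∂μ := by
  have h := ENNReal.lintegral_mul_le_Lp_mul_Lq μ Real.HolderConjugate.two_two
    (f := fun x => w x ^ (1 / 2 : ℝ)) (g := fun x => (w x)⁻¹ ^ (1 / 2 : ℝ) * a x)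
    (hw.pow_const _) ((hw.inv.pow_const _).mul ha)
  have h1 : ∀ x, w x ^ (1 / 2 : ℝ) * ((w x)⁻¹ ^ (1 / 2 : ℝ) * a x) = a x := fun x => by
    rw [← mul_assoc, ← ENNReal.mul_rpow_of_nonneg _ _ (by norm_num),
      ENNReal.mul_inv_cancel (hw0 x) (hwt x), ENNReal.one_rpow, one_mul]
  have h2 : ∀ b : ℝ≥0∞, (b ^ (1 / 2 : ℝ)) ^ (2 : ℝ) = b := fun b => by
    rw [← ENNReal.rpow_mul]; norm_num
  simp only [Pi.mul_apply, h1, h2, ENNReal.mul_rpow_of_nonneg _ _ (zero_le_two (α := ℝ))] at h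
  calc (∫⁻ x, a x ∂μ) ^ 2 ≤ _ := pow_le_pow_left₀ bot_le h 2
    _ = _ := by
      rw [mul_pow, ← ENNReal.rpow_two, ← ENNReal.rpow_two, h2, h2]
      simp only [ENNReal.rpow_two]

theorem ENNReal.sq_lintegral_le {X : Type*} [MeasurableSpace X] {μ : Measure X}
    {a : X → ℝ≥0∞} (ha : AEMeasurable a μ) :
    (∫⁻ x, a x ∂μ) ^ 2 ≤ μ univ * ∫⁻ x, a x ^ 2 ∂μ := by
  simpa using ENNReal.sq_lintegral_le_mul ha (w := fun _ => 1) aemeasurable_const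
    (by simp) (by simp)

theorem ENNReal.sq_tsum_le_mul {ι : Type*} {a w : ι → ℝ≥0∞}
    (hw0 : ∀ x, w x ≠ 0) (hwt : ∀ x, w x ≠ ⊤) :
    (∑' i, a i) ^ 2 ≤ (∑' i, w i) * ∑' i, (w i)⁻¹ * a i ^ 2 := by
  let _ : MeasurableSpace ι := ⊤
  simpa [lintegral_count] using ENNReal.sq_lintegral_le_mul (μ := Measure.count) (a := a) (w := w)
    (measurable_from_top).aemeasurable (measurable_from_top).aemeasurable hw0 hwt

variable {n : ℕ} {𝕜 : Type*} [RCLike 𝕜] {α : ℝ}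

/-- The volume of the unit ball. -/
noncomputable def unitBallVolume (n : ℕ) : ℝ≥0∞ :=
  volume (Metric.ball (0 : EuclideanSpace ℝ (Fin n)) 1)

theorem unitBallVolume_ne_top : unitBallVolume n ≠ ⊤ := measure_ball_lt_top.ne

theorem volume_closedBall_eq (y : EuclideanSpace ℝ (Fin n)) {r : ℝ} (hr : 0 ≤ r) :
    volume (Metric.closedBall y r) = ENNReal.ofReal (r ^ n) * unitBallVolume n := by
  rw [Measure.addHaar_closedBall _ _ hr, finrank_euclideanSpace_fin, unitBallVolume]

/-- Convolution with the indicator of a ball has L² norm at most its volume V: Cauchy–Schwarz on the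
ball gives one factor V, Tonelli the other. -/
theorem lintegral_sq_setLIntegral_closedBall_le {u : EuclideanSpace ℝ (Fin n) → ℝ≥0∞}
    (hu : Measurable u) {r : ℝ} (hr : 0 ≤ r) :
    ∫⁻ y, (∫⁻ z in Metric.closedBall y r, u z) ^ 2 ≤
      (ENNReal.ofReal (r ^ n) * unitBallVolume n) ^ 2 * ∫⁻ z, u z ^ 2 := by
  set V := ENNReal.ofReal (r ^ n) * unitBallVolume n with hV
  have hVt : V ≠ ⊤ := ENNReal.mul_ne_top ENNReal.ofReal_ne_top unitBallVolume_ne_top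
  have hmeas : Measurable fun p : EuclideanSpace ℝ (Fin n) × EuclideanSpace ℝ (Fin n) =>
      {p : EuclideanSpace ℝ (Fin n) × EuclideanSpace ℝ (Fin n) | dist p.2 p.1 ≤ r}.indicator
        (fun p => u p.2 ^ 2) p := by
    refine Measurable.indicator (by fun_prop) (measurableSet_le (by fun_prop) (by fun_prop))
  calc ∫⁻ y, (∫⁻ z in Metric.closedBall y r, u z) ^ 2
      ≤ ∫⁻ y, V * ∫⁻ z in Metric.closedBall y r, u z ^ 2 := by
        refine lintegral_mono fun y => ?_
        have := ENNReal.sq_lintegral_le (μ := volume.restrict (Metric.closedBall y r))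
          hu.aemeasurable
        rwa [Measure.restrict_apply_univ, volume_closedBall_eq y hr] at this
    _ = V * ∫⁻ y, ∫⁻ z,
        {p : EuclideanSpace ℝ (Fin n) × EuclideanSpace ℝ (Fin n) | dist p.2 p.1 ≤ r}.indicator
          (fun p => u p.2 ^ 2) (y, z) := by
        rw [lintegral_const_mul' _ _ hVt]
        congr 2 with y
        rw [← lintegral_indicator Metric.isClosed_closedBall.measurableSet]
        rfl
    _ = V * ∫⁻ z, u z ^ 2 * V := by
        rw [lintegral_lintegral_swap hmeas.aemeasurable]
        congr 2 with z
        rw [hV, ← volume_closedBall_eq z hr, ← setLIntegral_const, ← lintegral_indicator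
          Metric.isClosed_closedBall.measurableSet]
        congr 1 with y
        simp only [indicator, mem_ofPred_eq, Metric.mem_closedBall, dist_comm]
    _ = V ^ 2 * ∫⁻ z, u z ^ 2 := by
        rw [lintegral_mul_const' _ _ hVt, pow_two]
        ring

/-- The regime of cubes smaller than t: cancellation of F against the Hölder kernel gains (s/t)^α.
The enlarged ball has radius at most (1 + √n) t, so its volume absorbs the normalisation t^{-n}. -/
theorem lintegral_sq_intrinsicA_le_of_mean_zero (hn : 1 ≤ n) (hα0 : 0 < α) (hα1 : α ≤ 1)
    {t : ℝ} (ht : 0 < t) {k : ℤ} (hk : dyadicSide k ≤ t) {F : EuclideanSpace ℝ (Fin n) → 𝕜}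
    (hFm : Measurable F) (hFi : Integrable F) (hF : ∀ m, ∫ x in dyadicCube k m, F x = 0) :
    ∫⁻ y, intrinsicA α F y t ^ 2 ≤
      (ENNReal.ofReal (√n ^ α * (1 + √n) ^ n) * unitBallVolume n) ^ 2 *
        ENNReal.ofReal (dyadicSide k / t) ^ (2 * α) * ∫⁻ x, ‖F x‖ₑ ^ 2 := by
  have hs := dyadicSide_pos k
  have hr : (0 : ℝ) ≤ t + √n * dyadicSide k := by positivity
  set c := (t ^ n)⁻¹ * (√n * dyadicSide k / t) ^ α with hc
  have hc0 : 0 ≤ c := by positivity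
  calc ∫⁻ y, intrinsicA α F y t ^ 2
      ≤ ∫⁻ y, (ENNReal.ofReal c *
          ∫⁻ z in Metric.closedBall y (t + √n * dyadicSide k), ‖F z‖ₑ) ^ 2 :=
        lintegral_mono fun y => pow_le_pow_left₀ bot_le
          (intrinsicA_le_of_mean_zero hn hα0 hα1 ht hFi hF) 2
    _ ≤ ENNReal.ofReal c ^ 2 * ((ENNReal.ofReal ((t + √n * dyadicSide k) ^ n) *
          unitBallVolume n) ^ 2 * ∫⁻ z, ‖F z‖ₑ ^ 2) := by
        simp only [mul_pow]
        rw [lintegral_const_mul' _ _ (by simp)]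
        gcongr
        simpa only [mul_pow] using lintegral_sq_setLIntegral_closedBall_le hFm.enorm hr
    _ = (ENNReal.ofReal (c * (t + √n * dyadicSide k) ^ n) * unitBallVolume n) ^ 2 *
          ∫⁻ z, ‖F z‖ₑ ^ 2 := by
        rw [ENNReal.ofReal_mul hc0]
        ring
    _ ≤ (ENNReal.ofReal (√n ^ α * (1 + √n) ^ n * (dyadicSide k / t) ^ α) *
          unitBallVolume n) ^ 2 * ∫⁻ z, ‖F z‖ₑ ^ 2 := by
        refine mul_le_mul_left (pow_le_pow_left₀ bot_le (mul_le_mul_left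
          (ENNReal.ofReal_le_ofReal ?_) _) 2) _
        calc c * (t + √n * dyadicSide k) ^ n ≤ c * ((1 + √n) * t) ^ n := by
              gcongr
              nlinarith [Real.sqrt_nonneg (n : ℝ)]
          _ = √n ^ α * (1 + √n) ^ n * (dyadicSide k / t) ^ α := by
              rw [hc, mul_div_assoc, Real.mul_rpow (by positivity) (by positivity), mul_pow]
              field_simp
    _ = _ := by
        rw [ENNReal.ofReal_mul (by positivity), ← ENNReal.ofReal_rpow_of_pos (by positivity),
          mul_comm 2 α, ENNReal.rpow_mul, ENNReal.rpow_two]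
        ring

/-- Here the cancellation is that of the kernel: the constant F y may be subtracted under the
integral. -/
theorem intrinsicA_le_of_difference (hn : 1 ≤ n) (hα0 : 0 < α) (hα1 : α ≤ 1)
    (y : EuclideanSpace ℝ (Fin n)) {t : ℝ} (ht : 0 < t) {F : EuclideanSpace ℝ (Fin n) → 𝕜}
    (hF : LocallyIntegrable F) :
    intrinsicA α F y t ≤ ENNReal.ofReal (3 * (t ^ n)⁻¹) *
      ∫⁻ h in Metric.closedBall 0 t, ‖F (y + h) - F y‖ₑ := by
  refine intrinsicA_le hn hα0 hα1 ht fun ψ hψ => ?_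
  have h1 : ∫ z, ψ z * F z = ∫ z, ψ z * (F z - F y) := by
    simp only [mul_sub]
    rw [integral_sub (hψ.integrable_mul hF) (hψ.integrable.mul_const _), integral_mul_const,
      hψ.integral_eq_zero, zero_mul, sub_zero]
  rw [h1]
  refine (hψ.enorm_integral_mul_le _).trans_eq ?_
  congr 1
  rw [← lintegral_indicator Metric.isClosed_closedBall.measurableSet,
    ← lintegral_indicator Metric.isClosed_closedBall.measurableSet,
    ← lintegral_add_left_eq_self _ y]
  congr 1 with h
  simp [indicator, dist_eq_norm]

theorem lintegral_shift_indicator_le {k : ℤ} {u : EuclideanSpace ℝ (Fin n) → ℝ≥0∞}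
    (hu : ∀ x z, cubeIdx k x = cubeIdx k z → u x = u z) (h : EuclideanSpace ℝ (Fin n)) :
    ∫⁻ x in {x | cubeIdx k (x + h) ≠ cubeIdx k x}, u x ≤
      n * ENNReal.ofReal (‖h‖ / dyadicSide k) * ∫⁻ x, u x := by
  have hN : MeasurableSet {x : EuclideanSpace ℝ (Fin n) | cubeIdx k (x + h) ≠ cubeIdx k x} :=
    (measurableSet_eq_fun ((measurable_cubeIdx k).comp (measurable_id.add_const h))
      (measurable_cubeIdx k)).compl
  rw [← lintegral_indicator hN, lintegral_eq_tsum_dyadicCube k, lintegral_eq_tsum_dyadicCube k u,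
    ← ENNReal.tsum_mul_left]
  refine ENNReal.tsum_le_tsum fun m => ?_
  have hum : ∀ x ∈ dyadicCube k m, u x = u (cubeCorner k m) := fun x hx =>
    hu _ _ (by rw [cubeIdx_cubeCorner]; exact hx)
  rw [setLIntegral_congr_fun (measurableSet_dyadicCube k m) hum, setLIntegral_const,
    setLIntegral_congr_fun (measurableSet_dyadicCube k m)
      (g := {x | cubeIdx k (x + h) ≠ cubeIdx k x}.indicator fun _ => u (cubeCorner k m))
      (fun x hx => by simp only [indicator, hum x hx]),
    lintegral_indicator hN, setLIntegral_const, Measure.restrict_apply hN]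
  have : {x | cubeIdx k (x + h) ≠ cubeIdx k x} ∩ dyadicCube k m =
      dyadicCube k m ∩ {x | cubeIdx k (x + h) ≠ m} := by
    ext x
    simp only [dyadicCube, mem_inter_iff, mem_ofPred_eq]
    constructor
    · rintro ⟨h1, h2⟩
      exact ⟨h2, h2 ▸ h1⟩
    · rintro ⟨h1, h2⟩
      exact ⟨by rwa [h1], h1⟩
  rw [this, mul_comm, mul_comm (u _), ← mul_assoc]
  gcongr
  exact volume_dyadicCube_shift_le k m h

/-- The difference vanishes unless y and y + h lie in different cubes. There |a - b|² ≤ 2 (|a|² +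
|b|²), and each of the two terms is a boundary-layer integral, whence 4 n. -/
theorem lintegral_sq_shift_sub_le {k : ℤ} {F : EuclideanSpace ℝ (Fin n) → 𝕜} (hFm : Measurable F)
    (hF : ∀ x z, cubeIdx k x = cubeIdx k z → F x = F z) (h : EuclideanSpace ℝ (Fin n)) :
    ∫⁻ y, ‖F (y + h) - F y‖ₑ ^ 2 ≤
      4 * n * ENNReal.ofReal (‖h‖ / dyadicSide k) * ∫⁻ x, ‖F x‖ₑ ^ 2 := by
  set N : Set (EuclideanSpace ℝ (Fin n)) := {x | cubeIdx k (x + h) ≠ cubeIdx k x} with hNdef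
  have hN : MeasurableSet N :=
    (measurableSet_eq_fun ((measurable_cubeIdx k).comp (measurable_id.add_const h))
      (measurable_cubeIdx k)).compl
  have hu : ∀ x z, cubeIdx k x = cubeIdx k z → ‖F x‖ₑ ^ 2 = ‖F z‖ₑ ^ 2 :=
    fun x z hxz => by rw [hF x z hxz]
  have hpt : ∀ y, ‖F (y + h) - F y‖ₑ ^ 2 ≤
      2 * (N.indicator (fun y => ‖F (y + h)‖ₑ ^ 2) y + N.indicator (fun y => ‖F y‖ₑ ^ 2) y) := by
    intro y
    by_cases hy : y ∈ N
    · rw [indicator_of_mem hy, indicator_of_mem hy]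
      calc ‖F (y + h) - F y‖ₑ ^ 2 ≤ (‖F (y + h)‖ₑ + ‖F y‖ₑ) ^ 2 := by
            gcongr
            exact enorm_sub_le
        _ ≤ _ := by
            have := add_sq_le (a := ‖F (y + h)‖₊) (b := ‖F y‖₊)
            simp only [enorm]
            exact_mod_cast this
    · have : cubeIdx k (y + h) = cubeIdx k y := by simpa [hNdef] using hy
      rw [hF _ _ this]
      simp
  -- Translating the variable turns this term into a boundary-layer integral for the opposite shift.
  have hshift : ∫⁻ y, N.indicator (fun y => ‖F (y + h)‖ₑ ^ 2) y =
      ∫⁻ x in {x | cubeIdx k (x + -h) ≠ cubeIdx k x}, ‖F x‖ₑ ^ 2 := by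
    have hN' : MeasurableSet {x : EuclideanSpace ℝ (Fin n) |
        cubeIdx k (x + -h) ≠ cubeIdx k x} :=
      (measurableSet_eq_fun ((measurable_cubeIdx k).comp (measurable_id.add_const (-h)))
        (measurable_cubeIdx k)).compl
    rw [← lintegral_indicator hN']
    refine Eq.trans ?_ (lintegral_add_right_eq_self (μ := volume) _ h)
    congr 1 with y
    simp only [indicator, hNdef, mem_ofPred_eq, add_neg_cancel_right, ne_comm]
  calc ∫⁻ y, ‖F (y + h) - F y‖ₑ ^ 2
      ≤ 2 * ((∫⁻ y, N.indicator (fun y => ‖F (y + h)‖ₑ ^ 2) y) +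
          ∫⁻ y, N.indicator (fun y => ‖F y‖ₑ ^ 2) y) := by
        rw [← lintegral_add_right _ ((hFm.enorm.pow_const 2).indicator hN),
          ← lintegral_const_mul' _ _ (by simp)]
        exact lintegral_mono hpt
    _ ≤ 2 * ((n * ENNReal.ofReal (‖h‖ / dyadicSide k) * ∫⁻ x, ‖F x‖ₑ ^ 2) +
          n * ENNReal.ofReal (‖h‖ / dyadicSide k) * ∫⁻ x, ‖F x‖ₑ ^ 2) := by
        rw [hshift, lintegral_indicator hN]
        gcongr
        · simpa only [norm_neg] using lintegral_shift_indicator_le hu (-h)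
        · exact lintegral_shift_indicator_le hu h
    _ = _ := by ring

/-- The piecewise constant F changes under shifts |h| ≤ t only near cube boundaries, which gains t/s
in the squared norm. The constant 36 n is 3² from the kernel bound times 4 n from the shift
estimate. -/
theorem lintegral_sq_intrinsicA_le_of_const (hn : 1 ≤ n) (hα0 : 0 < α) (hα1 : α ≤ 1)
    {t : ℝ} (ht : 0 < t) {k : ℤ} {F : EuclideanSpace ℝ (Fin n) → 𝕜}
    (hFm : Measurable F) (hFi : Integrable F)
    (hF : ∀ x z, cubeIdx k x = cubeIdx k z → F x = F z) :
    ∫⁻ y, intrinsicA α F y t ^ 2 ≤ 36 * n * unitBallVolume n ^ 2 *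
        ENNReal.ofReal (t / dyadicSide k) * ∫⁻ x, ‖F x‖ₑ ^ 2 := by
  set V := volume (Metric.closedBall (0 : EuclideanSpace ℝ (Fin n)) t) with hV
  have hVt : V ≠ ⊤ := measure_closedBall_lt_top.ne
  set c := ENNReal.ofReal (3 * (t ^ n)⁻¹) with hc
  have hct : c ≠ ⊤ := ENNReal.ofReal_ne_top
  have hs := dyadicSide_pos k
  have hm : Measurable fun p : EuclideanSpace ℝ (Fin n) × EuclideanSpace ℝ (Fin n) =>
      ‖F (p.1 + p.2) - F p.1‖ₑ ^ 2 := by fun_prop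
  calc ∫⁻ y, intrinsicA α F y t ^ 2
      ≤ ∫⁻ y, (c ^ 2 * V) * ∫⁻ h in Metric.closedBall 0 t, ‖F (y + h) - F y‖ₑ ^ 2 := by
        refine lintegral_mono fun y => ?_
        calc intrinsicA α F y t ^ 2
            ≤ (c * ∫⁻ h in Metric.closedBall 0 t, ‖F (y + h) - F y‖ₑ) ^ 2 :=
              pow_le_pow_left₀ bot_le
                (intrinsicA_le_of_difference hn hα0 hα1 y ht hFi.locallyIntegrable) 2
          _ ≤ c ^ 2 * (V * ∫⁻ h in Metric.closedBall 0 t, ‖F (y + h) - F y‖ₑ ^ 2) := by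
              rw [mul_pow]
              gcongr
              have := ENNReal.sq_lintegral_le (μ := volume.restrict
                (Metric.closedBall (0 : EuclideanSpace ℝ (Fin n)) t)) (a := fun h => ‖F (y + h) - F y‖ₑ) (by fun_prop)
              rwa [Measure.restrict_apply_univ] at this
          _ = _ := by ring
    _ = (c ^ 2 * V) * ∫⁻ h in Metric.closedBall 0 t, ∫⁻ y, ‖F (y + h) - F y‖ₑ ^ 2 := by
        rw [lintegral_const_mul' _ _ (by finiteness), lintegral_lintegral_swap hm.aemeasurable]
    _ ≤ (c ^ 2 * V) * ∫⁻ _h in Metric.closedBall (0 : EuclideanSpace ℝ (Fin n)) t,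
          (4 * n * ENNReal.ofReal (t / dyadicSide k) * ∫⁻ x, ‖F x‖ₑ ^ 2) := by
        refine mul_le_mul_right (setLIntegral_mono' (α := EuclideanSpace ℝ (Fin n))
          Metric.isClosed_closedBall.measurableSet fun h hh => ?_) _
        refine (lintegral_sq_shift_sub_le hFm hF h).trans ?_
        gcongr
        simpa using hh
    _ = (c * V) ^ 2 * (4 * n * ENNReal.ofReal (t / dyadicSide k) * ∫⁻ x, ‖F x‖ₑ ^ 2) := by
        rw [setLIntegral_const]
        ring
    _ = _ := by
        have : c * V = 3 * unitBallVolume n := by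
          rw [hV, volume_closedBall_eq _ ht.le, hc, ← mul_assoc,
            ← ENNReal.ofReal_mul (by positivity), inv_mul_cancel_right₀ (by positivity)]
          simp
        rw [this]
        ring

end SquareFunction

/-! ### Integrals and sums over scales -/

section Scales

theorem setLIntegral_Ioc_rpow {a R : ℝ} (ha : 0 < a) (hR : 0 < R) :
    ∫⁻ t in Ioc 0 R, ENNReal.ofReal (t ^ (a - 1)) = ENNReal.ofReal (R ^ a / a) := by
  have hi : IntegrableOn (fun t : ℝ => t ^ (a - 1)) (Ioc 0 R) := by
    rw [← intervalIntegrable_iff_integrableOn_Ioc_of_le hR.le]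
    exact intervalIntegral.intervalIntegrable_rpow' (by linarith)
  rw [← ofReal_integral_eq_lintegral_ofReal hi, ← intervalIntegral.integral_of_le hR.le,
    integral_rpow (Or.inl (by linarith)), sub_add_cancel, Real.zero_rpow ha.ne', sub_zero]
  filter_upwards [ae_restrict_mem measurableSet_Ioc] with t ht
  exact Real.rpow_nonneg ht.1.le _

theorem setLIntegral_Ioi_rpow {b R : ℝ} (hb : 0 < b) (hR : 0 < R) :
    ∫⁻ t in Ioi R, ENNReal.ofReal (t ^ (-b - 1)) = ENNReal.ofReal (R ^ (-b) / b) := by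
  have hi : IntegrableOn (fun t : ℝ => t ^ (-b - 1)) (Ioi R) :=
    integrableOn_Ioi_rpow_of_lt (by linarith) hR
  rw [← ofReal_integral_eq_lintegral_ofReal hi, integral_Ioi_rpow_of_lt (by linarith) hR,
    sub_add_cancel, neg_div_neg_eq]
  filter_upwards [ae_restrict_mem measurableSet_Ioi] with t ht
  exact Real.rpow_nonneg (hR.trans ht).le _

/-- Power decay on both sides of R makes dt/t integrable at 0 and at infinity, with a bound that
does not depend on R. -/
theorem setLIntegral_Ioi_le_of_min {a b R : ℝ} (ha : 0 < a) (hb : 0 < b) (hR : 0 < R)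
    {u : ℝ → ℝ≥0∞} {c : ℝ≥0∞} (hc : c ≠ ⊤)
    (h1 : ∀ t, 0 < t → t ≤ R → u t ≤ c * ENNReal.ofReal ((t / R) ^ a))
    (h2 : ∀ t, R < t → u t ≤ c * ENNReal.ofReal ((R / t) ^ b)) :
    ∫⁻ t in Ioi 0, u t * ENNReal.ofReal (1 / t) ≤
      c * (ENNReal.ofReal (1 / a) + ENNReal.ofReal (1 / b)) := by
  rw [← Ioc_union_Ioi_eq_Ioi hR.le, lintegral_union measurableSet_Ioi
    (Set.disjoint_left.2 fun x hx hx' => absurd hx.2 (not_le.2 hx')), mul_add]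
  gcongr
  · calc ∫⁻ t in Ioc 0 R, u t * ENNReal.ofReal (1 / t)
        ≤ ∫⁻ t in Ioc 0 R, c * ENNReal.ofReal (R ^ (-a)) * ENNReal.ofReal (t ^ (a - 1)) := by
          refine setLIntegral_mono' measurableSet_Ioc fun t ht => ?_
          have ht0 : 0 < t := ht.1
          refine (mul_le_mul_left (h1 t ht.1 ht.2) _).trans_eq ?_
          rw [mul_assoc, mul_assoc, ← ENNReal.ofReal_mul (by positivity),
            ← ENNReal.ofReal_mul (by positivity)]
          congr 2
          rw [Real.div_rpow ht0.le hR.le, Real.rpow_neg hR.le, Real.rpow_sub_one ht0.ne']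
          field_simp
      _ = c * ENNReal.ofReal (1 / a) := by
          rw [lintegral_const_mul' _ _ (by finiteness), setLIntegral_Ioc_rpow ha hR, mul_assoc,
            ← ENNReal.ofReal_mul (by positivity)]
          congr 2
          rw [Real.rpow_neg hR.le]
          field_simp
  · calc ∫⁻ t in Ioi R, u t * ENNReal.ofReal (1 / t)
        ≤ ∫⁻ t in Ioi R, c * ENNReal.ofReal (R ^ b) * ENNReal.ofReal (t ^ (-b - 1)) := by
          refine setLIntegral_mono' measurableSet_Ioi fun t ht => ?_
          have ht0 : 0 < t := hR.trans ht
          refine (mul_le_mul_left (h2 t ht) _).trans_eq ?_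
          rw [mul_assoc, mul_assoc, ← ENNReal.ofReal_mul (by positivity),
            ← ENNReal.ofReal_mul (by positivity)]
          congr 2
          rw [Real.div_rpow hR.le ht0.le, Real.rpow_sub_one ht0.ne', Real.rpow_neg ht0.le]
          field_simp
      _ = c * ENNReal.ofReal (1 / b) := by
          rw [lintegral_const_mul' _ _ (by finiteness), setLIntegral_Ioi_rpow hb hR, mul_assoc,
            ← ENNReal.ofReal_mul (by positivity)]
          congr 2
          rw [Real.rpow_neg hR.le]
          field_simp

/-- The decay factor for the interaction of the scales `s` and `t`. -/
noncomputable def scaleWeight (ε s t : ℝ) : ℝ≥0∞ :=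
  ENNReal.ofReal (min (s / t) (t / s)) ^ ε

theorem scaleWeight_ne_zero (ε : ℝ) {s t : ℝ} (hs : 0 < s) (ht : 0 < t) :
    scaleWeight ε s t ≠ 0 := by
  have : 0 < min (s / t) (t / s) := lt_min (by positivity) (by positivity)
  exact (ENNReal.rpow_pos (by simpa using this) ENNReal.ofReal_ne_top).ne'

theorem scaleWeight_ne_top {ε : ℝ} (hε : 0 < ε) (s t : ℝ) : scaleWeight ε s t ≠ ⊤ :=
  ENNReal.rpow_ne_top_of_nonneg hε.le ENNReal.ofReal_ne_top

theorem measurable_scaleWeight (ε s : ℝ) : Measurable (scaleWeight ε s) := by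
  unfold scaleWeight
  fun_prop

theorem setLIntegral_scaleWeight_le {ε s : ℝ} (hε : 0 < ε) (hs : 0 < s) :
    ∫⁻ t in Ioi 0, scaleWeight ε s t * ENNReal.ofReal (1 / t) ≤
      ENNReal.ofReal (1 / ε) + ENNReal.ofReal (1 / ε) := by
  refine (setLIntegral_Ioi_le_of_min hε hε hs ENNReal.one_ne_top (fun t ht _ => ?_)
    fun t ht => ?_).trans_eq (one_mul _)
  · rw [one_mul, scaleWeight, ← ENNReal.ofReal_rpow_of_pos (by positivity)]
    gcongr
    exact min_le_right _ _
  · have := hs.trans ht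
    rw [one_mul, scaleWeight, ← ENNReal.ofReal_rpow_of_pos (by positivity)]
    gcongr
    exact min_le_left _ _

theorem ENNReal.tsum_pow_natAbs_le {q : ℝ≥0∞} (hq : q ≤ 1) :
    ∑' i : ℤ, q ^ i.natAbs ≤ 2 * ∑' i : ℕ, q ^ i := by
  have h := HasSum.of_nat_of_neg_add_one (f := fun i : ℤ => q ^ i.natAbs)
    ENNReal.summable.hasSum ENNReal.summable.hasSum
  rw [h.tsum_eq, two_mul]
  refine add_le_add (ENNReal.tsum_le_tsum fun i => ?_) (ENNReal.tsum_le_tsum fun i => ?_)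
  · simp
  · have : (-((i : ℤ) + 1)).natAbs = i + 1 := by omega
    rw [this]
    exact pow_le_pow_of_le_one bot_le hq (Nat.le_succ i)

theorem tsum_scaleWeight_le {ε : ℝ} (hε : 0 < ε) :
    ∃ C : ℝ≥0, ∀ t, 0 < t → ∑' k : ℤ, scaleWeight ε (dyadicSide k) t ≤ C := by
  set q : ℝ≥0∞ := (2⁻¹ : ℝ≥0∞) ^ ε with hq
  have hq1 : q < 1 := ENNReal.rpow_lt_one (by norm_num) hε
  have hfin : (2 : ℝ≥0∞) ^ ε * (2 * ∑' i : ℕ, q ^ i) ≠ ⊤ := by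
    rw [ENNReal.tsum_geometric]
    refine ENNReal.mul_ne_top (ENNReal.rpow_ne_top_of_nonneg hε.le (by simp))
      (ENNReal.mul_ne_top (by simp) ?_)
    simpa [tsub_eq_zero_iff_le] using hq1
  refine ⟨((2 : ℝ≥0∞) ^ ε * (2 * ∑' i : ℕ, q ^ i)).toNNReal, fun t ht => ?_⟩
  rw [ENNReal.coe_toNNReal hfin]
  -- With 2^j ≤ t < 2^{j+1} the ratio of scales is at most 2 · 2^{-|k+j|}, so a two-sided geometric
  -- series bounds the sum uniformly in t.
  obtain ⟨j, hj1, hj2⟩ := exists_mem_Ico_zpow ht one_lt_two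
  calc ∑' k : ℤ, scaleWeight ε (dyadicSide k) t
      ≤ ∑' k : ℤ, (2 : ℝ≥0∞) ^ ε * q ^ (k + j).natAbs := by
        refine ENNReal.tsum_le_tsum fun k => ?_
        have hs := dyadicSide_pos k
        have hmin : min (dyadicSide k / t) (t / dyadicSide k) ≤
            2 * (2⁻¹ : ℝ) ^ (k + j).natAbs := by
          rcases le_total 0 (k + j) with hkj | hkj
          · refine (min_le_left _ _).trans ?_
            rw [div_le_iff₀ ht, inv_pow, ← zpow_natCast, Int.natAbs_of_nonneg hkj, ← zpow_neg]
            calc dyadicSide k = 2 ^ (-(k + j)) * 2 ^ j := by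
                  rw [dyadicSide, ← zpow_add₀ two_ne_zero]; congr 1; ring
              _ ≤ 2 * 2 ^ (-(k + j)) * t := by
                  have : (0 : ℝ) < 2 ^ (-(k + j)) := by positivity
                  nlinarith
          · refine (min_le_right _ _).trans ?_
            rw [div_le_iff₀ hs, inv_pow, ← zpow_natCast, Int.ofNat_natAbs_of_nonpos hkj,
              ← zpow_neg, neg_neg, mul_assoc, dyadicSide, ← zpow_add₀ two_ne_zero,
              add_neg_cancel_comm, ← zpow_one_add₀ two_ne_zero, add_comm]
            exact hj2.le
        calc scaleWeight ε (dyadicSide k) t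
            ≤ ENNReal.ofReal (2 * (2⁻¹ : ℝ) ^ (k + j).natAbs) ^ ε := by
              unfold scaleWeight
              gcongr
          _ = _ := by
              rw [ENNReal.ofReal_mul zero_le_two, ENNReal.mul_rpow_of_nonneg _ _ hε.le,
                ENNReal.ofReal_pow (by norm_num), ENNReal.ofReal_inv_of_pos zero_lt_two,
                ENNReal.ofReal_ofNat, hq, ← ENNReal.rpow_natCast, ← ENNReal.rpow_natCast,
                ← ENNReal.rpow_mul, ← ENNReal.rpow_mul, mul_comm ε]
    _ = (2 : ℝ≥0∞) ^ ε * ∑' i : ℤ, q ^ i.natAbs := by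
        rw [ENNReal.tsum_mul_left, ← (Equiv.addRight j).tsum_eq fun i : ℤ => q ^ i.natAbs]
        rfl
    _ ≤ _ := by
        gcongr
        exact ENNReal.tsum_pow_natAbs_le hq1.le

end Scales

/-! ### Martingale differences and the square function estimate -/

section SquareFunctionSum

variable {n : ℕ} {𝕜 : Type*} [RCLike 𝕜] {α : ℝ}

theorem lintegral_sq_intrinsicA_le_scaleWeight (hn : 1 ≤ n) (hα0 : 0 < α) (hα1 : α ≤ 1) :
    ∃ C : ℝ≥0, ∀ (t : ℝ) (k : ℤ) (F : EuclideanSpace ℝ (Fin n) → 𝕜), 0 < t → Measurable F →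
      Integrable F → (∀ m, ∫ x in dyadicCube k m, F x = 0) →
      (∀ x z, cubeIdx (k + 1) x = cubeIdx (k + 1) z → F x = F z) →
      ∫⁻ y, intrinsicA α F y t ^ 2 ≤
        C * scaleWeight (min α (1 / 2)) (dyadicSide k) t ^ 2 * ∫⁻ x, ‖F x‖ₑ ^ 2 := by
  set C₁ := (ENNReal.ofReal (√n ^ α * (1 + √n) ^ n) * unitBallVolume n) ^ 2 with hC₁
  -- Twice the constant 36 n: the function is constant on cubes of generation k + 1, whose side is
  -- half of that of generation k.
  set C₂ := 72 * (n : ℝ≥0∞) * unitBallVolume n ^ 2 with hC₂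
  have hv := unitBallVolume_ne_top (n := n)
  have hC : C₁ + C₂ ≠ ⊤ := by finiteness
  refine ⟨(C₁ + C₂).toNNReal, fun t k F ht hFm hFi hF hF' => ?_⟩
  rw [ENNReal.coe_toNNReal hC]
  have hs := dyadicSide_pos k
  -- The gain in the L² norm is (s/t)^α for fine cubes and (t/s)^{1/2} for coarse ones.
  set ε := min α (1 / 2) with hε
  have hw : ∀ b : ℝ≥0∞, (b ^ ε) ^ 2 = b ^ (2 * ε) := fun b => by
    rw [mul_comm, ENNReal.rpow_mul, ENNReal.rpow_two]
  rcases le_or_gt (dyadicSide k) t with hk | hk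
  · refine (lintegral_sq_intrinsicA_le_of_mean_zero hn hα0 hα1 ht hk hFm hFi hF).trans ?_
    have h1 : dyadicSide k / t ≤ 1 := (div_le_one ht).2 hk
    have h2 : 1 ≤ t / dyadicSide k := (one_le_div hs).2 hk
    rw [scaleWeight, min_eq_left (h1.trans h2), hw]
    gcongr ?_ * ?_ * _
    · exact le_self_add
    · refine ENNReal.rpow_le_rpow_of_exponent_ge (by simpa using h1) ?_
      have := min_le_left α (1 / 2)
      linarith
  · refine (lintegral_sq_intrinsicA_le_of_const hn hα0 hα1 ht hFm hFi hF').trans ?_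
    have h1 : t / dyadicSide k ≤ 1 := (div_le_one hs).2 hk.le
    have h2 : 1 ≤ dyadicSide k / t := (one_le_div ht).2 hk.le
    rw [scaleWeight, min_eq_right (h1.trans h2), hw]
    have h3 : ENNReal.ofReal (t / dyadicSide (k + 1)) = 2 * ENNReal.ofReal (t / dyadicSide k) := by
      have := dyadicSide_pos (k + 1)
      rw [dyadicSide_succ k, ← ENNReal.ofReal_ofNat, ← ENNReal.ofReal_mul zero_le_two]
      congr 1
      field_simp
    rw [h3]
    calc _ = C₂ * ENNReal.ofReal (t / dyadicSide k) ^ (1 : ℝ) * ∫⁻ x, ‖F x‖ₑ ^ 2 := by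
          rw [hC₂, ENNReal.rpow_one]
          ring
      _ ≤ _ := by
          gcongr ?_ * ?_ * _
          · exact le_add_self
          · refine ENNReal.rpow_le_rpow_of_exponent_ge (by simpa using h1) ?_
            have := min_le_right α (1 / 2)
            linarith

/-- The dyadic martingale differences of a function. -/
noncomputable def dyadicDiff (k : ℤ) (f : EuclideanSpace ℝ (Fin n) → 𝕜)
    (x : EuclideanSpace ℝ (Fin n)) : 𝕜 :=
  dyadicAvg (k + 1) f x - dyadicAvg k f x

theorem measurable_dyadicDiff (k : ℤ) (f : EuclideanSpace ℝ (Fin n) → 𝕜) :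
    Measurable (dyadicDiff k f) :=
  (measurable_dyadicAvg _ f).sub (measurable_dyadicAvg _ f)

theorem integrable_dyadicDiff (k : ℤ) {f : EuclideanSpace ℝ (Fin n) → 𝕜} (hf : Integrable f) :
    Integrable (dyadicDiff k f) :=
  (integrable_dyadicAvg _ hf).sub (integrable_dyadicAvg _ hf)

theorem setIntegral_dyadicDiff (k : ℤ) (m : Fin n → ℤ) {f : EuclideanSpace ℝ (Fin n) → 𝕜}
    (hf : Integrable f) : ∫ x in dyadicCube k m, dyadicDiff k f x = 0 := by
  unfold dyadicDiff
  rw [integral_sub (integrable_dyadicAvg _ hf).integrableOn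
    (integrable_dyadicAvg _ hf).integrableOn, setIntegral_dyadicAvg_of_le (by omega) m hf,
    setIntegral_dyadicAvg, sub_self]

theorem dyadicDiff_congr {k : ℤ} (f : EuclideanSpace ℝ (Fin n) → 𝕜)
    {x z : EuclideanSpace ℝ (Fin n)} (h : cubeIdx (k + 1) x = cubeIdx (k + 1) z) :
    dyadicDiff k f x = dyadicDiff k f z := by
  rw [dyadicDiff, dyadicAvg_congr f h, dyadicAvg_congr f (cubeIdx_congr (by omega) h), dyadicDiff]

theorem integrable_norm_sq_of_bounded {f : EuclideanSpace ℝ (Fin n) → 𝕜} (hf : Integrable f)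
    {L : ℝ} (hL : ∀ x, ‖f x‖ ≤ L) : Integrable fun x => ‖f x‖ ^ 2 := by
  simp only [pow_two]
  exact hf.norm.bdd_mul (c := L) hf.norm.aestronglyMeasurable
    (Filter.Eventually.of_forall fun x => by simpa using hL x)

/-- Pythagoras: the difference has mean zero on the generation k cubes, where the average is
constant, so the cross term integrates to 0. -/
theorem integral_norm_sq_dyadicAvg_succ {k : ℤ} {f : EuclideanSpace ℝ (Fin n) → 𝕜}
    (hf : Integrable f) {L : ℝ} (hL : ∀ k x, ‖dyadicAvg k f x‖ ≤ L) :
    ∫ x, ‖dyadicAvg (k + 1) f x‖ ^ 2 =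
      (∫ x, ‖dyadicAvg k f x‖ ^ 2) + ∫ x, ‖dyadicDiff k f x‖ ^ 2 := by
  have hE := integrable_dyadicAvg k hf
  have hD := integrable_dyadicDiff k hf
  have hDb : ∀ x, ‖dyadicDiff k f x‖ ≤ L + L := fun x =>
    (norm_sub_le _ _).trans (add_le_add (hL _ x) (hL _ x))
  have hi : Integrable fun x => (starRingEnd 𝕜) (dyadicAvg k f x) * dyadicDiff k f x :=
    hD.bdd_mul (c := L) (RCLike.continuous_conj.comp_aestronglyMeasurable hE.aestronglyMeasurable)
      (Filter.Eventually.of_forall fun x => by simpa using hL k x)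
  have h0 : ∫ x, (starRingEnd 𝕜) (dyadicAvg k f x) * dyadicDiff k f x = 0 :=
    integral_comp_cubeIdx_mul_eq_zero (fun m => setIntegral_dyadicDiff k m hf)
      (fun m => (starRingEnd 𝕜) ((dyadicSide k ^ n)⁻¹ • ∫ z in dyadicCube k m, f z)) hi
  have hpt : ∀ x, ‖dyadicAvg (k + 1) f x‖ ^ 2 = ‖dyadicAvg k f x‖ ^ 2 +
      ‖dyadicDiff k f x‖ ^ 2 +
        2 * RCLike.re ((starRingEnd 𝕜) (dyadicAvg k f x) * dyadicDiff k f x) := by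
    intro x
    have h1 : dyadicAvg (k + 1) f x = dyadicAvg k f x + dyadicDiff k f x := by
      rw [dyadicDiff, add_sub_cancel]
    rw [h1, norm_add_sq (𝕜 := 𝕜), RCLike.inner_apply, mul_comm (dyadicDiff k f x)]
    ring
  simp only [hpt]
  have h2 := integrable_norm_sq_of_bounded hE (hL k)
  have h3 := integrable_norm_sq_of_bounded hD hDb
  have h4 := (hi.re.const_mul 2)
  rw [integral_add (f := fun x => ‖dyadicAvg k f x‖ ^ 2 + ‖dyadicDiff k f x‖ ^ 2) (h2.add h3) h4,
    integral_add h2 h3, integral_const_mul, integral_re hi, h0]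
  simp

/-- The squared norms telescope, and any finite stretch is dominated by the squared norm of the
finest average, at most L times its L¹ norm. Neither a bound on f itself nor convergence of the
averages is needed. -/
theorem tsum_lintegral_sq_dyadicDiff_le {f : EuclideanSpace ℝ (Fin n) → 𝕜}
    (hf : Integrable f) {L : ℝ≥0} (hL : ∀ k x, ‖dyadicAvg k f x‖ₑ ≤ L) :
    ∑' k : ℤ, ∫⁻ x, ‖dyadicDiff k f x‖ₑ ^ 2 ≤ L * ∫⁻ x, ‖f x‖ₑ := by
  have hL' : ∀ k x, ‖dyadicAvg k f x‖ ≤ L := fun k x => by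
    simpa [enorm, ENNReal.coe_le_coe, ← NNReal.coe_le_coe] using hL k x
  have hDb : ∀ k x, ‖dyadicDiff k f x‖ ≤ L + L := fun k x =>
    (norm_sub_le _ _).trans (add_le_add (hL' _ x) (hL' _ x))
  have hD : ∀ k, ∫⁻ x, ‖dyadicDiff k f x‖ₑ ^ 2 =
      ENNReal.ofReal (∫ x, ‖dyadicDiff k f x‖ ^ 2) := fun k => by
    rw [ofReal_integral_eq_lintegral_ofReal
      (integrable_norm_sq_of_bounded (integrable_dyadicDiff k hf) (hDb k))
      (Filter.Eventually.of_forall fun x => by positivity)]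
    simp only [ENNReal.ofReal_pow (norm_nonneg _), ofReal_norm]
  have htel : ∀ a b : ℤ, a ≤ b → (∫ x, ‖dyadicAvg a f x‖ ^ 2) +
      ∑ k ∈ Finset.Ico a b, ∫ x, ‖dyadicDiff k f x‖ ^ 2 = ∫ x, ‖dyadicAvg b f x‖ ^ 2 := by
    intro a b hab
    induction b, hab using Int.leInduction with
    | base => simp
    | succ b hab ih =>
      rw [← Finset.insert_Ico_right_eq_Ico_add_one hab, Finset.sum_insert (by simp),
        integral_norm_sq_dyadicAvg_succ hf hL', ← ih]
      ring
  have hE : ∀ b : ℤ, ∫ x, ‖dyadicAvg b f x‖ ^ 2 ≤ (L * ∫⁻ x, ‖f x‖ₑ).toReal := by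
    intro b
    rw [← ENNReal.ofReal_le_iff_le_toReal (ENNReal.mul_ne_top ENNReal.coe_ne_top hf.2.ne),
      ofReal_integral_eq_lintegral_ofReal
      (integrable_norm_sq_of_bounded (integrable_dyadicAvg b hf) (hL' b))
      (Filter.Eventually.of_forall fun x => by positivity)]
    simp only [ENNReal.ofReal_pow (norm_nonneg _), ofReal_norm]
    calc ∫⁻ x, ‖dyadicAvg b f x‖ₑ ^ 2 ≤ ∫⁻ x, L * ‖dyadicAvg b f x‖ₑ := by
          refine lintegral_mono fun x => ?_
          rw [pow_two]
          exact mul_le_mul_left (hL b x) _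
      _ ≤ _ := by
          rw [lintegral_const_mul' _ _ ENNReal.coe_ne_top]
          exact mul_le_mul_right (lintegral_enorm_dyadicAvg_le b f) _
  refine ENNReal.summable.tsum_le_of_sum_le fun s => ?_
  obtain ⟨a, b, hab, hs⟩ : ∃ a b : ℤ, a ≤ b ∧ s ⊆ Finset.Ico a b := by
    obtain ⟨a, ha⟩ := s.bddBelow
    obtain ⟨b, hb⟩ := s.bddAbove
    refine ⟨min a 0, max (b + 1) 0, by omega, fun k hk => ?_⟩
    have h1 := ha hk
    have h2 := hb hk
    rw [Finset.mem_Ico]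
    omega
  calc ∑ k ∈ s, ∫⁻ x, ‖dyadicDiff k f x‖ₑ ^ 2
      ≤ ∑ k ∈ Finset.Ico a b, ∫⁻ x, ‖dyadicDiff k f x‖ₑ ^ 2 := Finset.sum_le_sum_of_subset hs
    _ = ENNReal.ofReal (∑ k ∈ Finset.Ico a b, ∫ x, ‖dyadicDiff k f x‖ ^ 2) := by
        rw [ENNReal.ofReal_sum_of_nonneg fun k _ => integral_nonneg fun x => by positivity]
        simp only [hD]
    _ ≤ _ := by
        refine ENNReal.ofReal_le_of_le_toReal (le_trans ?_ (hE b))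
        have h1 := htel a b hab
        have h2 : 0 ≤ ∫ x, ‖dyadicAvg a f x‖ ^ 2 := integral_nonneg fun x => by positivity
        linarith

/-- Weak convergence suffices and is cheap: f minus its average has mean zero on cubes of side
2^{-N}, so the Hölder gain tends to 0 while the L¹ norm stays at most 2 ‖f‖₁. -/
theorem IsTestAt.tendsto_integral_mul_dyadicAvg (hα0 : 0 < α) {y : EuclideanSpace ℝ (Fin n)}
    {t : ℝ} (ht : 0 < t) {ψ : EuclideanSpace ℝ (Fin n) → 𝕜} (hψ : IsTestAt α y t ψ)
    {f : EuclideanSpace ℝ (Fin n) → 𝕜} (hf : Integrable f) :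
    Filter.Tendsto (fun N : ℕ => ∫ z, ψ z * dyadicAvg N f z) Filter.atTop
      (nhds (∫ z, ψ z * f z)) := by
  rw [tendsto_iff_edist_tendsto_0]
  set M := ∫⁻ z, ‖f z‖ₑ with hM
  have hMt : M ≠ ⊤ := hf.2.ne
  have hlim : Filter.Tendsto (fun N : ℕ =>
      ENNReal.ofReal ((t ^ n)⁻¹ * (√n * dyadicSide N / t) ^ α) * (M + M))
      Filter.atTop (nhds 0) := by
    have h1 : Filter.Tendsto (fun N : ℕ => dyadicSide N) Filter.atTop (nhds 0) := by
      have := tendsto_pow_atTop_nhds_zero_of_lt_one (r := (2⁻¹ : ℝ)) (by norm_num) (by norm_num)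
      refine this.congr fun N => ?_
      rw [dyadicSide, zpow_neg, zpow_natCast, inv_pow]
    have h2 : Filter.Tendsto (fun N : ℕ => (t ^ n)⁻¹ * (√n * dyadicSide N / t) ^ α)
        Filter.atTop (nhds 0) := by
      have h3 := ((h1.const_mul √n).div_const t).rpow_const (p := α) (Or.inr hα0.le)
      simpa [Real.zero_rpow hα0.ne'] using h3.const_mul (t ^ n)⁻¹
    have h4 := ENNReal.Tendsto.mul_const (b := M + M) (ENNReal.tendsto_ofReal h2)
      (Or.inr (by finiteness))
    simpa using h4
  refine tendsto_of_tendsto_of_tendsto_of_le_of_le tendsto_const_nhds hlim (fun _ => bot_le)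
    fun N => ?_
  have hE := integrable_dyadicAvg N hf
  have h1 := hψ.enorm_integral_mul_le_of_mean_zero hα0 ht (hf.sub hE)
    (setIntegral_sub_dyadicAvg N hf)
  rw [edist_comm, edist_eq_enorm_sub, ← integral_sub (hψ.integrable_mul hf.locallyIntegrable)
    (hψ.integrable_mul hE.locallyIntegrable)]
  simp only [← mul_sub]
  refine h1.trans (mul_le_mul_right ?_ _)
  calc ∫⁻ z in Metric.closedBall y (t + √n * dyadicSide N), ‖(f - dyadicAvg N f) z‖ₑ
      ≤ ∫⁻ z, ‖(f - dyadicAvg N f) z‖ₑ := setLIntegral_le_lintegral _ _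
    _ ≤ ∫⁻ z, (‖f z‖ₑ + ‖dyadicAvg N f z‖ₑ) := lintegral_mono fun z => enorm_sub_le
    _ ≤ M + M := by
        rw [lintegral_add_right _ (measurable_dyadicAvg _ f).enorm]
        exact add_le_add_right (lintegral_enorm_dyadicAvg_le _ f) _

/-- Averages over cubes of side 2^N are at most 2^{-Nn} ‖f‖₁, which tends to 0 since n ≥ 1. -/
theorem IsTestAt.tendsto_integral_mul_dyadicAvg_neg (hn : 1 ≤ n) {y : EuclideanSpace ℝ (Fin n)}
    {t : ℝ} {ψ : EuclideanSpace ℝ (Fin n) → 𝕜} (hψ : IsTestAt α y t ψ)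
    {f : EuclideanSpace ℝ (Fin n) → 𝕜} (hf : Integrable f) :
    Filter.Tendsto (fun N : ℕ => ∫ z, ψ z * dyadicAvg (-N : ℤ) f z) Filter.atTop (nhds 0) := by
  rw [tendsto_iff_edist_tendsto_0]
  set M := ∫⁻ z, ‖f z‖ₑ with hM
  have hMt : M ≠ ⊤ := hf.2.ne
  set P := ∫⁻ z, ‖ψ z‖ₑ with hP
  have hPt : P ≠ ⊤ := hψ.integrable.2.ne
  have hlim : Filter.Tendsto (fun N : ℕ =>
      (ENNReal.ofReal (dyadicSide (-N : ℤ) ^ n))⁻¹ * (M * P)) Filter.atTop (nhds 0) := by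
    have h1 : Filter.Tendsto (fun N : ℕ => ENNReal.ofReal (dyadicSide (-N : ℤ) ^ n))
        Filter.atTop (nhds ⊤) := by
      refine ENNReal.tendsto_ofReal_nhds_top.2 ?_
      refine (Filter.tendsto_pow_atTop (by omega)).comp ?_
      have := tendsto_pow_atTop_atTop_of_one_lt (r := (2 : ℝ)) (by norm_num)
      refine this.congr fun N => ?_
      rw [dyadicSide, neg_neg, zpow_natCast]
    have h4 := ENNReal.Tendsto.mul_const (b := M * P) h1.inv (Or.inr (by finiteness))
    simpa using h4
  refine tendsto_of_tendsto_of_tendsto_of_le_of_le tendsto_const_nhds hlim (fun _ => bot_le)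
    fun N => ?_
  rw [edist_zero_right]
  refine (enorm_integral_le_lintegral_enorm _).trans ?_
  calc ∫⁻ z, ‖ψ z * dyadicAvg (-N : ℤ) f z‖ₑ
      ≤ ∫⁻ z, (ENNReal.ofReal (dyadicSide (-N : ℤ) ^ n))⁻¹ * M * ‖ψ z‖ₑ := by
        refine lintegral_mono fun z => ?_
        rw [enorm_mul, mul_comm]
        exact mul_le_mul_left ((enorm_dyadicAvg_le _ f z).trans (dyadicLAvg_le_lintegral _ _ z)) _
    _ = _ := by
        rw [lintegral_const_mul _ hψ.continuous.measurable.enorm, mul_assoc]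

theorem IsTestAt.enorm_integral_mul_le_tsum_dyadicDiff (hn : 1 ≤ n) (hα0 : 0 < α)
    {y : EuclideanSpace ℝ (Fin n)} {t : ℝ} (ht : 0 < t) {ψ : EuclideanSpace ℝ (Fin n) → 𝕜}
    (hψ : IsTestAt α y t ψ) {f : EuclideanSpace ℝ (Fin n) → 𝕜} (hf : Integrable f) :
    ‖∫ z, ψ z * f z‖ₑ ≤ ∑' k : ℤ, ‖∫ z, ψ z * dyadicDiff k f z‖ₑ := by
  have hstep : ∀ k : ℤ, ∫ z, ψ z * dyadicAvg (k + 1) f z =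
      (∫ z, ψ z * dyadicAvg k f z) + ∫ z, ψ z * dyadicDiff k f z := fun k => by
    rw [← integral_add (hψ.integrable_mul (integrable_dyadicAvg k hf).locallyIntegrable)
      (hψ.integrable_mul (integrable_dyadicDiff k hf).locallyIntegrable)]
    simp only [← mul_add, dyadicDiff, add_sub_cancel]
  have htel : ∀ a b : ℤ, a ≤ b → (∫ z, ψ z * dyadicAvg b f z) - ∫ z, ψ z * dyadicAvg a f z =
      ∑ k ∈ Finset.Ico a b, ∫ z, ψ z * dyadicDiff k f z := by
    intro a b hab
    induction b, hab using Int.leInduction with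
    | base => simp
    | succ b hab ih =>
      rw [← Finset.insert_Ico_right_eq_Ico_add_one hab, Finset.sum_insert (by simp), hstep, ← ih]
      ring
  have hlim := ((hψ.tendsto_integral_mul_dyadicAvg hα0 ht hf).sub
    (hψ.tendsto_integral_mul_dyadicAvg_neg hn hf)).enorm
  rw [sub_zero] at hlim
  refine le_of_tendsto' hlim fun N => ?_
  rw [htel (-N) N (by omega)]
  exact (enorm_sum_le _ _).trans (ENNReal.sum_le_tsum _)

theorem measurable_intrinsicA_left (hn : 1 ≤ n) (hα0 : 0 < α) (hα1 : α ≤ 1)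
    {f : EuclideanSpace ℝ (Fin n) → 𝕜} (hf : LocallyIntegrable f) {t : ℝ} (ht : 0 < t) :
    Measurable fun y => intrinsicA α f y t := by
  have h := (measurable_indicator_intrinsicA hn hα0 hα1 hf).comp
    (measurable_prodMk_right (y := t))
  convert h using 1
  ext y
  simp [indicator, ht]

/-- The square function estimate for functions with bounded dyadic averages. -/
theorem lintegral_sq_intrinsicA_le (hn : 1 ≤ n) (hα0 : 0 < α) (hα1 : α ≤ 1) :
    ∃ C : ℝ≥0, ∀ (f : EuclideanSpace ℝ (Fin n) → 𝕜) (L : ℝ≥0), Integrable f →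
      (∀ k x, ‖dyadicAvg k f x‖ₑ ≤ L) →
      ∫⁻ t in Ioi 0, (∫⁻ y, intrinsicA α f y t ^ 2) * ENNReal.ofReal (1 / t) ≤
        C * (L * ∫⁻ x, ‖f x‖ₑ) := by
  set ε := min α (1 / 2) with hε
  have hε0 : 0 < ε := lt_min hα0 (by norm_num)
  obtain ⟨C₁, hC₁⟩ := tsum_scaleWeight_le hε0
  obtain ⟨C₂, hC₂⟩ := lintegral_sq_intrinsicA_le_scaleWeight (n := n) (𝕜 := 𝕜) hn hα0 hα1
  set C₃ : ℝ≥0∞ := ENNReal.ofReal (1 / ε) + ENNReal.ofReal (1 / ε) with hC₃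
  have hC : (C₁ * C₂ : ℝ≥0∞) * C₃ ≠ ⊤ := by finiteness
  refine ⟨((C₁ * C₂ : ℝ≥0∞) * C₃).toNNReal, fun f L hf hL => ?_⟩
  rw [ENNReal.coe_toNNReal hC]
  set d : ℤ → ℝ≥0∞ := fun k => ∫⁻ x, ‖dyadicDiff k f x‖ₑ ^ 2 with hd
  -- Cauchy–Schwarz in k with weight w costs w⁻¹ against the gain w². One factor w is left, and it
  -- is integrable in dt/t.
  have hfix : ∀ t, 0 < t → ∫⁻ y, intrinsicA α f y t ^ 2 ≤
      C₁ * C₂ * ∑' k : ℤ, d k * scaleWeight ε (dyadicSide k) t := by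
    intro t ht
    set w : ℤ → ℝ≥0∞ := fun k => scaleWeight ε (dyadicSide k) t with hw
    have hw0 : ∀ k, w k ≠ 0 := fun k => scaleWeight_ne_zero ε (dyadicSide_pos k) ht
    have hwt : ∀ k, w k ≠ ⊤ := fun k => scaleWeight_ne_top hε0 _ _
    calc ∫⁻ y, intrinsicA α f y t ^ 2
        ≤ ∫⁻ y, C₁ * ∑' k, (w k)⁻¹ * intrinsicA α (dyadicDiff k f) y t ^ 2 := by
          refine lintegral_mono fun y => ?_
          calc intrinsicA α f y t ^ 2
              ≤ (∑' k, intrinsicA α (dyadicDiff k f) y t) ^ 2 :=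
                pow_le_pow_left₀ bot_le (intrinsicA_le_tsum hn hα0 hα1 ht fun ψ hψ =>
                  hψ.enorm_integral_mul_le_tsum_dyadicDiff hn hα0 ht hf) 2
            _ ≤ (∑' k, w k) * ∑' k, (w k)⁻¹ * intrinsicA α (dyadicDiff k f) y t ^ 2 :=
                ENNReal.sq_tsum_le_mul hw0 hwt
            _ ≤ _ := mul_le_mul_left (hC₁ t ht) _
      _ = C₁ * ∑' k, (w k)⁻¹ * ∫⁻ y, intrinsicA α (dyadicDiff k f) y t ^ 2 := by
          have hm : ∀ k, Measurable fun y => intrinsicA α (dyadicDiff k f) y t := fun k =>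
            measurable_intrinsicA_left hn hα0 hα1 (integrable_dyadicDiff k hf).locallyIntegrable ht
          rw [lintegral_const_mul' _ _ ENNReal.coe_ne_top,
            lintegral_tsum fun k => (((hm k).pow_const 2).const_mul _).aemeasurable]
          simp only [lintegral_const_mul _ ((hm _).pow_const 2)]
      _ ≤ C₁ * ∑' k, (w k)⁻¹ * (C₂ * w k ^ 2 * d k) := by
          refine mul_le_mul_right (ENNReal.tsum_le_tsum fun k => mul_le_mul_right ?_ _) _
          exact hC₂ t k _ ht (measurable_dyadicDiff k f) (integrable_dyadicDiff k hf)
            (fun m => setIntegral_dyadicDiff k m hf) fun x z h => dyadicDiff_congr f h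
      _ = _ := by
          rw [mul_assoc, ← ENNReal.tsum_mul_left (a := (C₂ : ℝ≥0∞))]
          congr 2 with k
          calc (w k)⁻¹ * (C₂ * w k ^ 2 * d k) = ((w k)⁻¹ * w k) * (C₂ * (d k * w k)) := by ring
            _ = _ := by rw [ENNReal.inv_mul_cancel (hw0 k) (hwt k), one_mul]
  calc ∫⁻ t in Ioi 0, (∫⁻ y, intrinsicA α f y t ^ 2) * ENNReal.ofReal (1 / t)
      ≤ ∫⁻ t in Ioi 0, C₁ * C₂ * ∑' k : ℤ,
          d k * (scaleWeight ε (dyadicSide k) t * ENNReal.ofReal (1 / t)) := by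
        refine setLIntegral_mono' measurableSet_Ioi fun t ht => ?_
        refine (mul_le_mul_left (hfix t ht) _).trans_eq ?_
        rw [mul_assoc, ← ENNReal.tsum_mul_right]
        simp only [mul_assoc]
    _ = C₁ * C₂ * ∑' k : ℤ, d k *
          ∫⁻ t in Ioi 0, scaleWeight ε (dyadicSide k) t * ENNReal.ofReal (1 / t) := by
        have hm : ∀ k : ℤ, Measurable fun t =>
            scaleWeight ε (dyadicSide k) t * ENNReal.ofReal (1 / t) := fun k =>
          (measurable_scaleWeight _ _).mul (by fun_prop)
        rw [lintegral_const_mul' _ _ (by finiteness),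
          lintegral_tsum fun k => ((hm k).const_mul _).aemeasurable]
        simp only [lintegral_const_mul _ (hm _)]
    _ ≤ C₁ * C₂ * ∑' k : ℤ, d k * C₃ := by
        refine mul_le_mul_right (ENNReal.tsum_le_tsum fun k => mul_le_mul_right ?_ _) _
        exact setLIntegral_scaleWeight_le hε0 (dyadicSide_pos k)
    _ = C₁ * C₂ * C₃ * ∑' k : ℤ, d k := by
        rw [ENNReal.tsum_mul_right]
        ring
    _ ≤ _ := mul_le_mul_right (tsum_lintegral_sq_dyadicDiff_le hf hL) _

end SquareFunctionSum

/-! ### From bounds on A_α to bounds on g* -/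

section Tail

variable {n : ℕ} {𝕜 : Type*} [RCLike 𝕜] {α : ℝ}

theorem lintegral_one_add_norm_div_rpow {r : ℝ} (hr : n < r) :
    ∃ C : ℝ≥0, ∀ (c : EuclideanSpace ℝ (Fin n)) (ρ : ℝ), 0 < ρ →
      ∫⁻ x, ENNReal.ofReal ((1 + ‖x - c‖ / ρ) ^ (-r)) = C * ENNReal.ofReal (ρ ^ n) := by
  have hfin : ∫⁻ x : EuclideanSpace ℝ (Fin n), ENNReal.ofReal ((1 + ‖x‖) ^ (-r)) < ⊤ :=
    finite_integral_one_add_norm (by rwa [finrank_euclideanSpace_fin])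
  refine ⟨(∫⁻ x : EuclideanSpace ℝ (Fin n), ENNReal.ofReal ((1 + ‖x‖) ^ (-r))).toNNReal,
    fun c ρ hρ => ?_⟩
  rw [ENNReal.coe_toNNReal hfin.ne,
    lintegral_sub_right_eq_self (fun x => ENNReal.ofReal ((1 + ‖x‖ / ρ) ^ (-r))) c]
  have h1 : ∀ x : EuclideanSpace ℝ (Fin n), ENNReal.ofReal ((1 + ‖x‖ / ρ) ^ (-r)) =
      ENNReal.ofReal ((1 + ‖ρ⁻¹ • x‖) ^ (-r)) := fun x => by
    rw [norm_smul, Real.norm_of_nonneg (inv_pos.2 hρ).le, inv_mul_eq_div]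
  simp only [h1]
  rw [← lintegral_map (μ := volume) (f := fun x : EuclideanSpace ℝ (Fin n) =>
      ENNReal.ofReal ((1 + ‖x‖) ^ (-r))) (g := fun x => ρ⁻¹ • x) (by fun_prop) (by fun_prop),
    Measure.map_addHaar_smul _ (inv_pos.2 hρ).ne', lintegral_smul_measure,
    finrank_euclideanSpace_fin, inv_pow, inv_inv, abs_of_pos (pow_pos hρ n), smul_eq_mul, mul_comm]

theorem lintegral_div_add_norm_rpow {a : ℝ} (ha : n < a) :
    ∃ C : ℝ≥0, ∀ (x : EuclideanSpace ℝ (Fin n)) (t : ℝ), 0 < t →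
      ∫⁻ y, ENNReal.ofReal ((t / (t + ‖x - y‖)) ^ a) = C * ENNReal.ofReal (t ^ n) := by
  obtain ⟨C, hC⟩ := lintegral_one_add_norm_div_rpow (n := n) ha
  refine ⟨C, fun x t ht => ?_⟩
  rw [← hC x t ht]
  congr 1 with y
  have h1 : t / (t + ‖x - y‖) = (1 + ‖y - x‖ / t)⁻¹ := by
    rw [norm_sub_rev]
    field_simp
  rw [h1, Real.inv_rpow (by positivity), Real.rpow_neg (by positivity)]

theorem volume_restrict_upperHalf :
    (volume : Measure (EuclideanSpace ℝ (Fin n) × ℝ)).restrict (upperHalf n) =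
      (volume : Measure (EuclideanSpace ℝ (Fin n))).prod (volume.restrict (Ioi (0 : ℝ))) := by
  rw [Measure.volume_eq_prod, ← Measure.prod_restrict, Measure.restrict_univ]

theorem sq_rpow_half (b : ℝ≥0∞) : (b ^ (1 / 2 : ℝ)) ^ 2 = b := by
  rw [← ENNReal.rpow_two, ← ENNReal.rpow_mul]
  norm_num

/-- By Tonelli the x-integral falls on the weight alone. It equals a multiple of t^n as λn > n, and
this turns dt/t^{n+1} into dt/t. -/
theorem lintegral_sq_intrinsicGStar_le (hn : 1 ≤ n) (hα0 : 0 < α) (hα1 : α ≤ 1) {lam : ℝ}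
    (hlam : n < lam * n) :
    ∃ C : ℝ≥0, ∀ f : EuclideanSpace ℝ (Fin n) → 𝕜, LocallyIntegrable f →
      ∫⁻ x, intrinsicGStar lam α f x ^ 2 ≤
        C * ∫⁻ t in Ioi 0, (∫⁻ y, intrinsicA α f y t ^ 2) * ENNReal.ofReal (1 / t) := by
  obtain ⟨C, hC⟩ := lintegral_div_add_norm_rpow hlam
  refine ⟨C, fun f hf => ?_⟩
  set A := (upperHalf n).indicator fun p => intrinsicA α f p.1 p.2 with hA
  have hAm : Measurable A := measurable_indicator_intrinsicA hn hα0 hα1 hf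
  simp only [intrinsicGStar_eq_indicator, sq_rpow_half, volume_restrict_upperHalf]
  rw [lintegral_lintegral_swap
    ((measurable_gStarWeight_uncurry lam).mul
      ((hAm.comp measurable_snd).pow_const 2)).aemeasurable,
    lintegral_prod_symm]
  · rw [← lintegral_const_mul' _ _ ENNReal.coe_ne_top]
    refine setLIntegral_mono' measurableSet_Ioi fun t ht => ?_
    have ht0 : 0 < t := ht
    rw [← lintegral_mul_const' _ _ ENNReal.ofReal_ne_top,
      ← lintegral_const_mul' _ _ ENNReal.coe_ne_top]
    refine lintegral_mono fun y => ?_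
    have hAy : (upperHalf n).indicator (fun p => intrinsicA α f p.1 p.2) (y, t) =
        intrinsicA α f y t := by simp [ht0]
    have hw : Measurable fun x : EuclideanSpace ℝ (Fin n) => gStarWeight lam x (y, t) := by
      unfold gStarWeight
      fun_prop
    simp only
    rw [lintegral_mul_const _ hw, hAy]
    unfold gStarWeight
    rw [lintegral_mul_const' _ _ ENNReal.ofReal_ne_top]
    simp only [norm_sub_rev _ y]
    rw [hC y t ht0, mul_assoc (C : ℝ≥0∞), ← ENNReal.ofReal_mul (by positivity)]
    have h1 : t ^ n * (1 / t ^ (n + 1)) = 1 / t := by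
      field_simp
      ring
    rw [h1, mul_assoc, mul_comm (ENNReal.ofReal _)]
  · exact (Measurable.lintegral_prod_left'
      (f := fun q : EuclideanSpace ℝ (Fin n) × (EuclideanSpace ℝ (Fin n) × ℝ) =>
        gStarWeight lam q.1 q.2 * A q.2 ^ 2)
      ((measurable_gStarWeight_uncurry lam).mul
        ((hAm.comp measurable_snd).pow_const 2))).aemeasurable

/-- Where A_α does not vanish, t/(t+|x-y|) ≤ min(1, t/R); a power of this factor tames the
singularity at t = 0. Used with δ = α for atoms and δ = 0 for functions without cancellation. -/
theorem intrinsicGStar_le_of_decay (hn : 1 ≤ n) {lam δ : ℝ} (hδ : 0 ≤ δ)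
    (hlam : 3 * n + 2 * δ < lam * n) :
    ∃ C : ℝ≥0, ∀ (f : EuclideanSpace ℝ (Fin n) → 𝕜) (x : EuclideanSpace ℝ (Fin n)) (R : ℝ)
      (M : ℝ≥0∞), 0 < R → M ≠ ⊤ →
      (∀ y t, 0 < t → intrinsicA α f y t ≤ M * ENNReal.ofReal (t ^ (-(n + δ)))) →
      (∀ y t, 0 < t → intrinsicA α f y t ≠ 0 → R ≤ t + ‖x - y‖) →
      intrinsicGStar lam α f x ≤ C * M * ENNReal.ofReal (R ^ (-(n + δ))) := by
  -- Half of the surplus in the exponent. The split λn = (n + η) + p leaves n + η for the integral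
  -- in y, while p exceeds 2(n + δ) by η and makes the t-integral converge at 0.
  set η := (lam * n - 3 * n - 2 * δ) / 2 with hη
  have hη0 : 0 < η := by rw [hη]; linarith
  have hn0 : (1 : ℝ) ≤ n := by exact_mod_cast hn
  set p := 2 * (n + δ) + η with hp
  have hp0 : 0 < p := by rw [hp]; linarith
  have hap : lam * n = (n + η) + p := by rw [hp, hη]; ring
  obtain ⟨C, hC⟩ := lintegral_div_add_norm_rpow (n := n) (a := n + η) (by linarith)
  set K : ℝ≥0∞ := ENNReal.ofReal (1 / η) + ENNReal.ofReal (1 / (2 * (n + δ))) with hK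
  have hKt : ((C : ℝ≥0∞) * K) ^ (1 / 2 : ℝ) ≠ ⊤ :=
    ENNReal.rpow_ne_top_of_nonneg (by norm_num) (by finiteness)
  refine ⟨(((C : ℝ≥0∞) * K) ^ (1 / 2 : ℝ)).toNNReal, fun f x R M hR hM hA hsupp => ?_⟩
  rw [ENNReal.coe_toNNReal hKt]
  set u : ℝ → ℝ≥0∞ := fun t =>
    ENNReal.ofReal (min 1 (t / R) ^ p) * (M * ENNReal.ofReal (t ^ (-(n + δ)))) ^ 2 with hu
  have hum : Measurable u := by rw [hu]; fun_prop
  have hpt : ∀ q ∈ upperHalf n,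
      ENNReal.ofReal ((q.2 / (q.2 + ‖x - q.1‖)) ^ (lam * n)) * intrinsicA α f q.1 q.2 ^ 2
        * ENNReal.ofReal (1 / q.2 ^ (n + 1)) ≤
      ENNReal.ofReal ((q.2 / (q.2 + ‖x - q.1‖)) ^ (n + η)) *
        (u q.2 * ENNReal.ofReal (1 / q.2 ^ (n + 1))) := by
    rintro ⟨y, t⟩ hq
    have ht : 0 < t := by simpa using hq
    simp only
    rw [← mul_assoc]
    refine mul_le_mul_left ?_ _
    by_cases h0 : intrinsicA α f y t = 0
    · simp [h0]
    have hRt := hsupp y t ht h0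
    have hd : 0 < t + ‖x - y‖ := by positivity
    have h1 : t / (t + ‖x - y‖) ≤ min 1 (t / R) := by
      refine le_min ?_ ?_
      · rw [div_le_one hd]
        linarith [norm_nonneg (x - y)]
      · gcongr
    rw [hap, Real.rpow_add (by positivity), ENNReal.ofReal_mul (by positivity), mul_assoc]
    refine mul_le_mul_right ?_ _
    rw [hu]
    exact mul_le_mul' (ENNReal.ofReal_le_ofReal (Real.rpow_le_rpow (by positivity) h1 hp0.le))
      (pow_le_pow_left₀ bot_le (hA y t ht) 2)
  have hcalc : ∫⁻ q in upperHalf n,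
      ENNReal.ofReal ((q.2 / (q.2 + ‖x - q.1‖)) ^ (lam * n)) * intrinsicA α f q.1 q.2 ^ 2
        * ENNReal.ofReal (1 / q.2 ^ (n + 1)) ≤
      (C * K) * (M * ENNReal.ofReal (R ^ (-(n + δ)))) ^ 2 := by
    calc _ ≤ ∫⁻ q in upperHalf n, ENNReal.ofReal ((q.2 / (q.2 + ‖x - q.1‖)) ^ (n + η)) *
          (u q.2 * ENNReal.ofReal (1 / q.2 ^ (n + 1))) :=
          setLIntegral_mono' measurableSet_upperHalf hpt
      _ = ∫⁻ t in Ioi 0, C * (u t * ENNReal.ofReal (1 / t)) := by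
          rw [volume_restrict_upperHalf, lintegral_prod_symm _ (by fun_prop)]
          refine setLIntegral_congr_fun measurableSet_Ioi fun t ht => ?_
          have ht0 : 0 < t := ht
          simp only
          rw [lintegral_mul_const _ (by fun_prop), hC x t ht0]
          have h1 : ENNReal.ofReal (1 / t) =
              ENNReal.ofReal (t ^ n) * ENNReal.ofReal (1 / t ^ (n + 1)) := by
            rw [← ENNReal.ofReal_mul (by positivity)]
            congr 1
            field_simp
            ring
          rw [h1]
          ring
      _ = C * ∫⁻ t in Ioi 0, u t * ENNReal.ofReal (1 / t) :=
          lintegral_const_mul' _ _ ENNReal.coe_ne_top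
      _ ≤ C * ((M * ENNReal.ofReal (R ^ (-(n + δ)))) ^ 2 * K) := by
          refine mul_le_mul_right ?_ _
          have hsq : ∀ t, 0 < t → ENNReal.ofReal (t ^ (-(n + δ))) =
              ENNReal.ofReal (R ^ (-(n + δ))) * ENNReal.ofReal ((R / t) ^ (n + δ)) := by
            intro t ht
            rw [← ENNReal.ofReal_mul (by positivity), Real.div_rpow hR.le ht.le,
              Real.rpow_neg hR.le, Real.rpow_neg ht.le]
            congr 1
            field_simp
          have hsq2 : ∀ t, 0 < t → ENNReal.ofReal ((R / t) ^ (n + δ)) ^ 2 =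
              ENNReal.ofReal ((R / t) ^ (2 * (n + δ))) := by
            intro t ht
            rw [← ENNReal.ofReal_pow (by positivity), ← Real.rpow_natCast,
              ← Real.rpow_mul (by positivity), mul_comm]
            norm_num
          refine setLIntegral_Ioi_le_of_min hη0 (by linarith) hR (by finiteness)
            (fun t ht htR => ?_) fun t htR => ?_
          · simp only [hu]
            rw [hsq t ht, min_eq_right ((div_le_one hR).2 htR), ← mul_assoc M, mul_pow, hsq2 t ht,
              mul_comm, mul_assoc, ← ENNReal.ofReal_mul (by positivity)]
            refine le_of_eq ?_
            congr 2
            rw [hp, Real.rpow_add (by positivity), ← mul_assoc,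
              ← Real.mul_rpow (by positivity) (by positivity),
              div_mul_div_cancel₀ ht.ne', div_self hR.ne', Real.one_rpow, one_mul]
          · have ht : 0 < t := hR.trans htR
            simp only [hu]
            rw [hsq t ht, min_eq_left ((one_le_div hR).2 htR.le), ← mul_assoc M, mul_pow,
              hsq2 t ht, Real.one_rpow, ENNReal.ofReal_one, one_mul]
      _ = _ := by ring
  rw [intrinsicGStar]
  refine (ENNReal.rpow_le_rpow hcalc (by norm_num)).trans_eq ?_
  rw [ENNReal.mul_rpow_of_nonneg _ _ (by norm_num), ← ENNReal.rpow_two, ← ENNReal.rpow_mul]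
  norm_num
  rw [mul_assoc]

end Tail

/-! ### Calderón–Zygmund decomposition by stopping cubes -/

section StoppingCubes

variable {n : ℕ} {𝕜 : Type*} [RCLike 𝕜] {α : ℝ}

/-- `k` is the first generation at which the dyadic average of `u` at `x` exceeds `σ`. -/
def IsStoppingGen (u : EuclideanSpace ℝ (Fin n) → ℝ≥0∞) (σ : ℝ≥0∞) (k : ℤ)
    (x : EuclideanSpace ℝ (Fin n)) : Prop :=
  σ < dyadicLAvg k u x ∧ ∀ j < k, dyadicLAvg j u x ≤ σ

variable {u : EuclideanSpace ℝ (Fin n) → ℝ≥0∞} {σ : ℝ≥0∞}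

theorem IsStoppingGen.congr {j k : ℤ} (hjk : j ≤ k) {x z : EuclideanSpace ℝ (Fin n)}
    (h : IsStoppingGen u σ j x) (hxz : cubeIdx k x = cubeIdx k z) : IsStoppingGen u σ j z := by
  refine ⟨?_, fun l hl => ?_⟩
  · rw [← dyadicLAvg_congr u (cubeIdx_congr hjk hxz)]
    exact h.1
  · rw [← dyadicLAvg_congr u (cubeIdx_congr (hl.le.trans hjk) hxz)]
    exact h.2 l hl

theorem IsStoppingGen.unique {j k : ℤ} {x : EuclideanSpace ℝ (Fin n)}
    (hj : IsStoppingGen u σ j x) (hk : IsStoppingGen u σ k x) : j = k := by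
  rcases lt_trichotomy j k with h | h | h
  · exact absurd hj.1 (not_lt.2 (hk.2 j h))
  · exact h
  · exact absurd hk.1 (not_lt.2 (hj.2 k h))

/-- Since u has finite integral, averages over huge cubes fall below σ. The generations exceeding σ
are thus bounded below and have a least element. -/
theorem exists_isStoppingGen (hn : 1 ≤ n) (hu : ∫⁻ x, u x ≠ ⊤) (hσ : σ ≠ 0) {k : ℤ}
    {x : EuclideanSpace ℝ (Fin n)} (hk : σ < dyadicLAvg k u x) :
    ∃ j ≤ k, IsStoppingGen u σ j x := by
  obtain ⟨N, hN⟩ : ∃ N : ℕ, ∀ j : ℤ, j ≤ -N → dyadicLAvg j u x ≤ σ := by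
    have h1 : Filter.Tendsto (fun N : ℕ => ENNReal.ofReal ((2 : ℝ) ^ N))
        Filter.atTop (nhds ⊤) :=
      ENNReal.tendsto_ofReal_nhds_top.2 (tendsto_pow_atTop_atTop_of_one_lt (by norm_num))
    have h2 := ENNReal.Tendsto.mul_const (b := ∫⁻ x, u x) h1.inv (Or.inr hu)
    rw [ENNReal.inv_top, zero_mul] at h2
    obtain ⟨N, hN⟩ := (h2.eventually (gt_mem_nhds (pos_iff_ne_zero.2 hσ))).exists
    refine ⟨N, fun j hj => (dyadicLAvg_le_lintegral j u x).trans (le_trans ?_ hN.le)⟩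
    gcongr
    have h3 : (2 : ℝ) ^ N ≤ dyadicSide j := by
      rw [dyadicSide, ← zpow_natCast]
      exact zpow_le_zpow_right₀ one_le_two (by omega)
    have h4 : (1 : ℝ) ≤ dyadicSide j := le_trans (one_le_pow₀ one_le_two) h3
    exact h3.trans (le_self_pow₀ h4 (by omega))
  obtain ⟨j, hj, hmin⟩ := Int.exists_least_of_bdd (P := fun j => σ < dyadicLAvg j u x)
    ⟨-N, fun j hj => by
      by_contra h
      exact absurd hj (not_lt.2 (hN j (by omega)))⟩ ⟨k, hk⟩
  refine ⟨j, hmin k hk, hj, fun l hl => ?_⟩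
  by_contra h
  exact absurd (hmin l (not_le.1 h)) (by omega)

/-- The dyadic cube with generation `i.1` and index `i.2`, if it is a maximal cube over which the
average of `u` exceeds `σ`, and the empty set otherwise. -/
def stoppingCube (u : EuclideanSpace ℝ (Fin n) → ℝ≥0∞) (σ : ℝ≥0∞) (i : ℤ × (Fin n → ℤ)) :
    Set (EuclideanSpace ℝ (Fin n)) :=
  {x | IsStoppingGen u σ i.1 x ∧ cubeIdx i.1 x = i.2}

theorem stoppingCube_eq {i : ℤ × (Fin n → ℤ)} {x : EuclideanSpace ℝ (Fin n)}
    (hx : x ∈ stoppingCube u σ i) : stoppingCube u σ i = dyadicCube i.1 i.2 := by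
  ext z
  refine ⟨fun hz => hz.2, fun hz => ⟨?_, hz⟩⟩
  exact hx.1.congr le_rfl (hx.2.trans (Eq.symm hz))

theorem stoppingCube_eq_or (u : EuclideanSpace ℝ (Fin n) → ℝ≥0∞) (σ : ℝ≥0∞)
    (i : ℤ × (Fin n → ℤ)) :
    stoppingCube u σ i = ∅ ∨ stoppingCube u σ i = dyadicCube i.1 i.2 := by
  rcases (stoppingCube u σ i).eq_empty_or_nonempty with h | ⟨x, hx⟩
  · exact Or.inl h
  · exact Or.inr (stoppingCube_eq hx)

theorem measurableSet_stoppingCube (i : ℤ × (Fin n → ℤ)) :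
    MeasurableSet (stoppingCube u σ i) := by
  rcases stoppingCube_eq_or u σ i with h | h
  · rw [h]; exact MeasurableSet.empty
  · rw [h]; exact measurableSet_dyadicCube _ _

theorem disjoint_stoppingCube :
    Pairwise fun i j => Disjoint (stoppingCube u σ i) (stoppingCube u σ j) := by
  intro i j hij
  refine Set.disjoint_left.2 fun x hx hx' => hij ?_
  have h1 := hx.1.unique hx'.1
  refine Prod.ext h1 ?_
  rw [← hx.2, ← hx'.2, h1]

theorem mul_volume_stoppingCube_le (i : ℤ × (Fin n → ℤ)) :
    σ * volume (stoppingCube u σ i) ≤ ∫⁻ x in stoppingCube u σ i, u x := by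
  rcases (stoppingCube u σ i).eq_empty_or_nonempty with h | ⟨x, hx⟩
  · simp [h]
  · have h1 := hx.1.1
    rw [dyadicLAvg, hx.2, ← volume_dyadicCube i.1 i.2] at h1
    rw [stoppingCube_eq hx, mul_comm]
    have h0 : volume (dyadicCube i.1 i.2) ≠ 0 := by
      rw [volume_dyadicCube]
      exact ofReal_dyadicSide_pow_ne_zero _
    have ht : volume (dyadicCube i.1 i.2) ≠ ⊤ := by
      rw [volume_dyadicCube]
      exact ENNReal.ofReal_ne_top
    refine (mul_le_mul_right h1.le _).trans_eq ?_
    rw [← mul_assoc, ENNReal.mul_inv_cancel h0 ht, one_mul]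

theorem tsum_volume_stoppingCube_le :
    σ * ∑' i, volume (stoppingCube u σ i) ≤ ∫⁻ x, u x := by
  rw [← ENNReal.tsum_mul_left]
  refine (ENNReal.tsum_le_tsum fun i => mul_volume_stoppingCube_le i).trans ?_
  rw [← lintegral_iUnion measurableSet_stoppingCube disjoint_stoppingCube]
  exact setLIntegral_le_lintegral _ _

open Classical in
/-- The good part of the Calderón–Zygmund decomposition of `F` at height `σ`. -/
noncomputable def goodPart (F : EuclideanSpace ℝ (Fin n) → 𝕜) (σ : ℝ≥0∞)
    (x : EuclideanSpace ℝ (Fin n)) : 𝕜 :=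
  if h : ∃ k, IsStoppingGen (fun z => ‖F z‖ₑ) σ k x then dyadicAvg h.choose F x else F x

variable {F : EuclideanSpace ℝ (Fin n) → 𝕜}

theorem goodPart_of_isStoppingGen {k : ℤ} {x : EuclideanSpace ℝ (Fin n)}
    (h : IsStoppingGen (fun z => ‖F z‖ₑ) σ k x) : goodPart F σ x = dyadicAvg k F x := by
  have h' : ∃ k, IsStoppingGen (fun z => ‖F z‖ₑ) σ k x := ⟨k, h⟩
  rw [goodPart, dif_pos h', h'.choose_spec.unique h]

theorem goodPart_of_notMem {x : EuclideanSpace ℝ (Fin n)}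
    (hx : x ∉ ⋃ i, stoppingCube (fun z => ‖F z‖ₑ) σ i) : goodPart F σ x = F x := by
  rw [goodPart, dif_neg]
  rintro ⟨k, hk⟩
  exact hx (mem_iUnion.2 ⟨(k, cubeIdx k x), hk, rfl⟩)

theorem measurableSet_iUnion_stoppingCube : MeasurableSet (⋃ i, stoppingCube u σ i) :=
  MeasurableSet.iUnion measurableSet_stoppingCube

/-- Averaging over a stopping cube does not increase the L¹ norm there, so the bound holds on any
set that cuts no stopping cube. -/
theorem setLIntegral_enorm_goodPart_le {T : Set (EuclideanSpace ℝ (Fin n))}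
    (hT : MeasurableSet T)
    (h : ∀ i, stoppingCube (fun z => ‖F z‖ₑ) σ i ⊆ T ∨
      Disjoint (stoppingCube (fun z => ‖F z‖ₑ) σ i) T) :
    ∫⁻ x in T, ‖goodPart F σ x‖ₑ ≤ ∫⁻ x in T, ‖F x‖ₑ := by
  set S := stoppingCube (fun z => ‖F z‖ₑ) σ with hS
  have hU : MeasurableSet (⋃ i, S i) := measurableSet_iUnion_stoppingCube
  rw [← lintegral_inter_add_sdiff _ T hU, ← lintegral_inter_add_sdiff (fun x => ‖F x‖ₑ) T hU]
  refine add_le_add ?_ (le_of_eq ?_)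
  · have hm : ∀ i, MeasurableSet (T ∩ S i) := fun i => hT.inter (measurableSet_stoppingCube i)
    have hd : Pairwise fun i j => Disjoint (T ∩ S i) (T ∩ S j) := fun i j hij =>
      (disjoint_stoppingCube hij).mono inter_subset_right inter_subset_right
    rw [inter_iUnion, lintegral_iUnion hm hd, lintegral_iUnion hm hd]
    refine ENNReal.tsum_le_tsum fun i => ?_
    rcases h i with hi | hi
    · rw [inter_eq_right.2 hi]
      rw [setLIntegral_congr_fun (measurableSet_stoppingCube i)
        (g := fun x => ‖dyadicAvg i.1 F x‖ₑ)
        fun x hx => by simp only [goodPart_of_isStoppingGen hx.1]]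
      rcases stoppingCube_eq_or (fun z => ‖F z‖ₑ) σ i with h0 | h0
      · simp [hS, h0]
      · simp only [hS, h0]
        exact (lintegral_mono (enorm_dyadicAvg_le i.1 F)).trans_eq
          (setLIntegral_dyadicLAvg _ _ _)
    · simp [hi.symm.inter_eq]
  · refine setLIntegral_congr_fun (MeasurableSet.diff hT hU) fun x hx => ?_
    simp only [goodPart_of_notMem hx.2]

theorem lintegral_enorm_goodPart_le : ∫⁻ x, ‖goodPart F σ x‖ₑ ≤ ∫⁻ x, ‖F x‖ₑ := by
  simpa using setLIntegral_enorm_goodPart_le (F := F) (σ := σ) MeasurableSet.univ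
    fun i => Or.inl (subset_univ _)

theorem aestronglyMeasurable_goodPart (hF : Integrable F) :
    AEStronglyMeasurable (goodPart F σ) := by
  set S := stoppingCube (fun z => ‖F z‖ₑ) σ with hS
  have hU : MeasurableSet (⋃ i, S i) := measurableSet_iUnion_stoppingCube
  rw [← Measure.restrict_univ (μ := volume), ← union_compl_self (⋃ i, S i),
    aestronglyMeasurable_union_iff, aestronglyMeasurable_iUnion_iff]
  refine ⟨fun i => ?_, ?_⟩
  · refine (measurable_dyadicAvg i.1 F).aestronglyMeasurable.congr ?_
    filter_upwards [ae_restrict_mem (measurableSet_stoppingCube i)] with x hx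
    rw [goodPart_of_isStoppingGen hx.1]
  · refine hF.aestronglyMeasurable.restrict.congr ?_
    filter_upwards [ae_restrict_mem hU.compl] with x hx
    rw [goodPart_of_notMem hx]

theorem integrable_goodPart (hF : Integrable F) : Integrable (goodPart F σ) :=
  ⟨aestronglyMeasurable_goodPart hF, lintegral_enorm_goodPart_le.trans_lt hF.2⟩

/-- This replaces the usual almost everywhere bound on the good part. A cube strictly inside a
stopping cube sees a single average; any other cube cuts no stopping cube. In both cases the
relevant parent has average at most σ, and passing to a child costs 2^n. -/
theorem enorm_dyadicAvg_goodPart_le (hn : 1 ≤ n) (hF : Integrable F) (hσ : σ ≠ 0) (k : ℤ)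
    (x : EuclideanSpace ℝ (Fin n)) : ‖dyadicAvg k (goodPart F σ) x‖ₑ ≤ 2 ^ n * σ := by
  have hup : ∀ j : ℤ, dyadicLAvg (j - 1) (fun z => ‖F z‖ₑ) x ≤ σ →
      dyadicLAvg j (fun z => ‖F z‖ₑ) x ≤ 2 ^ n * σ := fun j hj => by
    have := dyadicLAvg_succ_le (j - 1) (fun z => ‖F z‖ₑ) x
    rw [sub_add_cancel] at this
    exact this.trans (mul_le_mul_right hj _)
  refine (enorm_dyadicAvg_le k _ x).trans ?_
  by_cases h : ∃ j < k, IsStoppingGen (fun z => ‖F z‖ₑ) σ j x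
  · obtain ⟨j, hjk, hj⟩ := h
    have hconst : ∀ z ∈ dyadicCube k (cubeIdx k x), ‖goodPart F σ z‖ₑ = ‖dyadicAvg j F x‖ₑ := by
      intro z hz
      have hz' : cubeIdx k x = cubeIdx k z := Eq.symm hz
      rw [goodPart_of_isStoppingGen (hj.congr hjk.le hz'),
        dyadicAvg_congr F (cubeIdx_congr hjk.le hz')]
    rw [dyadicLAvg, setLIntegral_congr_fun (measurableSet_dyadicCube k _) hconst,
      setLIntegral_const, volume_dyadicCube, mul_comm, mul_assoc,
      ENNReal.mul_inv_cancel (ofReal_dyadicSide_pow_ne_zero k) ENNReal.ofReal_ne_top, mul_one]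
    exact (enorm_dyadicAvg_le j F x).trans (hup j (hj.2 _ (by omega)))
  · refine le_trans ?_ (hup k ?_)
    · unfold dyadicLAvg
      refine mul_le_mul_right (setLIntegral_enorm_goodPart_le (measurableSet_dyadicCube k _)
        fun i => ?_) _
      by_cases hi : Disjoint (stoppingCube (fun z => ‖F z‖ₑ) σ i) (dyadicCube k (cubeIdx k x))
      · exact Or.inr hi
      · obtain ⟨z, hz, hzk⟩ := Set.not_disjoint_iff.1 hi
        refine Or.inl fun w hw => ?_
        have hki : k ≤ i.1 := by
          by_contra hlt
          exact h ⟨i.1, not_le.1 hlt, hz.1.congr (not_le.1 hlt).le hzk⟩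
        exact (cubeIdx_congr hki (hw.2.trans hz.2.symm)).trans hzk
    · by_contra hlt
      obtain ⟨j, hj, hj'⟩ := exists_isStoppingGen hn hF.2.ne hσ (not_le.1 hlt)
      exact h ⟨j, by omega, hj'⟩

/-- Makes each piece of the bad part an atom: mean zero on its own cube, and zero on the other cubes
of that generation. -/
theorem setIntegral_indicator_sub_goodPart (hF : Integrable F) (i : ℤ × (Fin n → ℤ))
    (m : Fin n → ℤ) :
    ∫ x in dyadicCube i.1 m,
      (stoppingCube (fun z => ‖F z‖ₑ) σ i).indicator (F - goodPart F σ) x = 0 := by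
  rw [setIntegral_indicator (measurableSet_stoppingCube i)]
  rcases stoppingCube_eq_or (fun z => ‖F z‖ₑ) σ i with h | h
  · simp [h]
  · by_cases hm : m = i.2
    · subst hm
      have h1 : dyadicCube i.1 i.2 ∩ stoppingCube (fun z => ‖F z‖ₑ) σ i =
          stoppingCube (fun z => ‖F z‖ₑ) σ i := by rw [h, inter_self]
      rw [h1, setIntegral_congr_fun (measurableSet_stoppingCube i)
        (g := fun x => F x - dyadicAvg i.1 F x)
        fun x hx => by simp only [Pi.sub_apply, goodPart_of_isStoppingGen hx.1], h]
      exact setIntegral_sub_dyadicAvg i.1 hF i.2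
    · rw [h, (disjoint_dyadicCube i.1 hm).inter_eq]
      simp

end StoppingCubes

/-! ### The weak type (1,1) estimate -/

section WeakType

variable {n : ℕ} {𝕜 : Type*} [RCLike 𝕜] {α : ℝ}

/-- Off a neighbourhood of its cube, the `g*`-function of an atom is integrable. -/
theorem setLIntegral_intrinsicGStar_atom_le (hn : 1 ≤ n) (hα0 : 0 < α) (hα1 : α ≤ 1) {lam : ℝ}
    (hlam : 3 * n + 2 * α < lam * n) :
    ∃ C : ℝ≥0, ∀ (k : ℤ) (m : Fin n → ℤ) (b : EuclideanSpace ℝ (Fin n) → 𝕜), Integrable b →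
      (∀ m, ∫ x in dyadicCube k m, b x = 0) → (∀ x, x ∉ dyadicCube k m → b x = 0) →
      ∫⁻ x in (Metric.ball (cubeCorner k m) (2 * (√n * dyadicSide k)))ᶜ,
        intrinsicGStar lam α b x ≤ C * ∫⁻ x, ‖b x‖ₑ := by
  obtain ⟨C₁, hC₁⟩ := intrinsicGStar_le_of_decay (n := n) (𝕜 := 𝕜) (α := α) hn hα0.le hlam
  obtain ⟨C₂, hC₂⟩ := lintegral_one_add_norm_div_rpow (n := n) (r := n + α) (by linarith)
  refine ⟨C₁ * C₂ * Real.toNNReal (3 ^ (n + α)), fun k m b hb hb0 hbs => ?_⟩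
  set ρ := √n * dyadicSide k with hρ
  have hn0 : (0 : ℝ) < n := by exact_mod_cast hn
  have hρ0 : 0 < ρ := mul_pos (Real.sqrt_pos.2 hn0) (dyadicSide_pos k)
  set c := cubeCorner k m with hc
  set N := ∫⁻ x, ‖b x‖ₑ with hN
  have hNt : N ≠ ⊤ := hb.2.ne
  have hpt : ∀ x ∈ (Metric.ball c (2 * ρ))ᶜ, intrinsicGStar lam α b x ≤
      C₁ * (ENNReal.ofReal (ρ ^ α) * N) * ENNReal.ofReal ((ρ / 3) ^ (-(n + α))) *
        ENNReal.ofReal ((1 + ‖x - c‖ / ρ) ^ (-(n + α))) := by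
    intro x hx
    have hx' : 2 * ρ ≤ ‖x - c‖ := by simpa [dist_eq_norm] using hx
    -- The choice R = |x - c|/2 works because b lives within ρ ≤ |x - c|/2 of c: kernels with t + |x
    -- - y| < R miss its support.
    have hR : 0 < ‖x - c‖ / 2 := by linarith
    refine (hC₁ b x (‖x - c‖ / 2) (ENNReal.ofReal (ρ ^ α) * N) hR (by finiteness) ?_ ?_).trans ?_
    · intro y t ht
      refine (intrinsicA_le_of_mean_zero hn hα0 hα1 ht hb hb0).trans ?_
      rw [mul_right_comm, ← ENNReal.ofReal_mul (by positivity)]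
      refine mul_le_mul' (ENNReal.ofReal_le_ofReal (le_of_eq ?_)) (setLIntegral_le_lintegral _ _)
      rw [Real.div_rpow hρ0.le ht.le, neg_add, Real.rpow_add ht, Real.rpow_neg ht.le,
        Real.rpow_neg ht.le, Real.rpow_natCast]
      field_simp
    · intro y t ht hA
      by_contra hlt
      refine hA (intrinsicA_eq_zero hn hα0 hα1 ht fun z hz => ?_)
      by_contra hbz
      have hzc : dist z c ≤ ρ := by
        refine dist_le_of_cubeIdx_eq ?_
        rw [hc, cubeIdx_cubeCorner]
        by_contra hzm
        exact hbz (hbs z hzm)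
      rw [dist_eq_norm] at hz hzc
      have h1 : x - c = (x - y) + (z - c) - (z - y) := by abel
      have h2 : ‖x - c‖ ≤ ‖x - y‖ + ‖z - c‖ + ‖z - y‖ := by
        rw [h1]
        exact (norm_sub_le _ _).trans (add_le_add_left (norm_add_le _ _) _)
      linarith
    · rw [mul_assoc _ (ENNReal.ofReal ((ρ / 3) ^ _)), ← ENNReal.ofReal_mul (by positivity),
        ← Real.mul_rpow (by positivity) (by positivity)]
      refine mul_le_mul_right (ENNReal.ofReal_le_ofReal ?_) _
      -- Since |x - c| ≥ 2ρ, the quantity (ρ/3)(1 + |x - c|/ρ) is at most |x - c|/2. This is the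
      -- source of 3^{n+α}.
      refine Real.rpow_le_rpow_of_nonpos (by positivity) ?_ (by linarith)
      field_simp
      linarith
  calc ∫⁻ x in (Metric.ball c (2 * ρ))ᶜ, intrinsicGStar lam α b x
      ≤ ∫⁻ x, C₁ * (ENNReal.ofReal (ρ ^ α) * N) * ENNReal.ofReal ((ρ / 3) ^ (-(n + α))) *
        ENNReal.ofReal ((1 + ‖x - c‖ / ρ) ^ (-(n + α))) :=
        (setLIntegral_mono' Metric.isOpen_ball.measurableSet.compl hpt).trans
          (setLIntegral_le_lintegral _ _)
    _ = C₁ * C₂ * (ENNReal.ofReal (ρ ^ α) * ENNReal.ofReal ((ρ / 3) ^ (-(n + α))) *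
          ENNReal.ofReal (ρ ^ n)) * N := by
        rw [lintegral_const_mul' _ _ (by finiteness), hC₂ c ρ hρ0]
        ring
    _ = _ := by
        rw [← ENNReal.ofReal_mul (by positivity), ← ENNReal.ofReal_mul (by positivity),
          ENNReal.coe_mul, ENNReal.coe_mul]
        change _ = _ * ENNReal.ofReal (3 ^ (n + α)) * N
        congr 3
        rw [← Real.rpow_natCast, Real.div_rpow hρ0.le (by norm_num), Real.rpow_neg hρ0.le,
          Real.rpow_neg (by norm_num), Real.rpow_add hρ0]
        field_simp

/-- The weak type `(1,1)` estimate for the intrinsic `g*`-function. -/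
theorem weakType_intrinsicGStar (hn : 1 ≤ n) (hα0 : 0 < α) (hα1 : α ≤ 1) {lam : ℝ}
    (hlam : 3 * n + 2 * α < lam * n) :
    ∃ C : ℝ≥0, ∀ (F : EuclideanSpace ℝ (Fin n) → 𝕜) (τ : ℝ≥0), Integrable F → 0 < τ →
      τ * volume {x | (τ : ℝ≥0∞) < intrinsicGStar lam α F x} ≤ C * ∫⁻ x, ‖F x‖ₑ := by
  have hn0 : (0 : ℝ) < n := by exact_mod_cast hn
  obtain ⟨C₁, hC₁⟩ := lintegral_sq_intrinsicGStar_le (n := n) (𝕜 := 𝕜) hn hα0 hα1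
    (lam := lam) (by linarith)
  obtain ⟨C₂, hC₂⟩ := lintegral_sq_intrinsicA_le (n := n) (𝕜 := 𝕜) hn hα0 hα1
  obtain ⟨C₃, hC₃⟩ := setLIntegral_intrinsicGStar_atom_le (n := n) (𝕜 := 𝕜) hn hα0 hα1 hlam
  set C₄ : ℝ≥0∞ := ENNReal.ofReal ((2 * √n) ^ n) * unitBallVolume n with hC₄
  have hC₄t : C₄ ≠ ⊤ := ENNReal.mul_ne_top ENNReal.ofReal_ne_top unitBallVolume_ne_top
  have hCt : 4 * 2 ^ n * (C₁ * C₂ : ℝ≥0∞) + C₄ + 4 * C₃ ≠ ⊤ := by finiteness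
  refine ⟨(4 * 2 ^ n * (C₁ * C₂ : ℝ≥0∞) + C₄ + 4 * C₃).toNNReal, fun F τ hF hτ => ?_⟩
  rw [ENNReal.coe_toNNReal hCt]
  have hτ0 : (τ : ℝ≥0∞) ≠ 0 := by simpa using hτ.ne'
  have hτt : (τ : ℝ≥0∞) ≠ ⊤ := ENNReal.coe_ne_top
  set M := ∫⁻ x, ‖F x‖ₑ with hM
  set g := goodPart F τ with hg
  set b := F - g with hb
  set S := stoppingCube (fun z => ‖F z‖ₑ) τ with hS
  have hgi : Integrable g := integrable_goodPart hF
  have hbi : Integrable b := hF.sub hgi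
  have hbS : ∀ x, x ∉ ⋃ i, S i → b x = 0 := fun x hx => by
    rw [hb, Pi.sub_apply, hg, goodPart_of_notMem hx, sub_self]
  open Classical in
  set B : ℤ × (Fin n → ℤ) → Set (EuclideanSpace ℝ (Fin n)) := fun i =>
    if (S i).Nonempty then Metric.ball (cubeCorner i.1 i.2) (2 * (√n * dyadicSide i.1)) else ∅
    with hB
  have hBm : MeasurableSet (⋃ i, B i) := by
    refine MeasurableSet.iUnion fun i => ?_
    simp only [hB]
    split_ifs
    · exact Metric.isOpen_ball.measurableSet
    · exact MeasurableSet.empty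
  -- Chebyshev for the square at height τ/2 gives the 4; the averages of g are at most 2^n τ, and
  -- this τ cancels one of the two on the left.
  have hgood : τ * volume {x | ((τ / 2 : ℝ≥0) : ℝ≥0∞) ≤ intrinsicGStar lam α g x} ≤
      4 * 2 ^ n * (C₁ * C₂ : ℝ≥0∞) * M := by
    set E := {x | ((τ / 2 : ℝ≥0) : ℝ≥0∞) ≤ intrinsicGStar lam α g x} with hE
    have h1 : ((τ / 2 : ℝ≥0) : ℝ≥0∞) ^ 2 * volume E ≤ C₁ * (C₂ * (2 ^ n * τ * M)) := by
      calc ((τ / 2 : ℝ≥0) : ℝ≥0∞) ^ 2 * volume E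
          ≤ ((τ / 2 : ℝ≥0) : ℝ≥0∞) ^ 2 *
            volume {x | ((τ / 2 : ℝ≥0) : ℝ≥0∞) ^ 2 ≤ intrinsicGStar lam α g x ^ 2} := by
            refine mul_le_mul_right (measure_mono fun x hx => ?_) _
            have hx' : ((τ / 2 : ℝ≥0) : ℝ≥0∞) ≤ intrinsicGStar lam α g x := hx
            exact pow_le_pow_left₀ bot_le hx' 2
        _ ≤ ∫⁻ x, intrinsicGStar lam α g x ^ 2 := mul_meas_ge_le_lintegral
            ((measurable_intrinsicGStar hn hα0 hα1 lam hgi.locallyIntegrable).pow_const 2) _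
        _ ≤ _ := by
            refine (hC₁ g hgi.locallyIntegrable).trans (mul_le_mul_right ?_ _)
            refine (hC₂ g (2 ^ n * τ) hgi fun k x => ?_).trans ?_
            · simpa using enorm_dyadicAvg_goodPart_le hn hF hτ0 k x
            · refine mul_le_mul_right ?_ _
              push_cast
              exact mul_le_mul_right lintegral_enorm_goodPart_le _
    have h2 : (τ : ℝ≥0∞) * ((τ : ℝ≥0∞) * volume E) ≤
        τ * (4 * 2 ^ n * (C₁ * C₂ : ℝ≥0∞) * M) := by
      calc (τ : ℝ≥0∞) * ((τ : ℝ≥0∞) * volume E)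
          = 4 * (((τ / 2 : ℝ≥0) : ℝ≥0∞) ^ 2 * volume E) := by
            have h3 : (4 : ℝ≥0∞) * ((τ / 2 : ℝ≥0) : ℝ≥0∞) ^ 2 = τ * τ := by
              have : 4 * (τ / 2) ^ 2 = τ * τ := by field_simp; ring
              exact_mod_cast congrArg ((↑) : ℝ≥0 → ℝ≥0∞) this
            rw [← mul_assoc, ← mul_assoc, h3]
        _ ≤ 4 * (C₁ * (C₂ * (2 ^ n * τ * M))) := mul_le_mul_right h1 _
        _ = _ := by ring
    exact (ENNReal.mul_le_mul_iff_right hτ0 hτt).1 h2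
  -- Each exceptional ball is comparable in volume to its stopping cube, and the stopping cubes have
  -- total volume at most M/τ.
  have hexc : τ * volume (⋃ i, B i) ≤ C₄ * M := by
    have h1 : ∀ i, volume (B i) ≤ C₄ * volume (S i) := by
      intro i
      simp only [hB]
      split_ifs with hi
      · obtain ⟨x, hx⟩ := hi
        have hs := dyadicSide_pos i.1
        rw [hS, stoppingCube_eq hx, volume_dyadicCube]
        refine (measure_mono Metric.ball_subset_closedBall).trans_eq ?_
        rw [volume_closedBall_eq _ (by positivity), hC₄, mul_right_comm,
          ← ENNReal.ofReal_mul (by positivity)]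
        congr 2
        ring
      · simp
    calc τ * volume (⋃ i, B i) ≤ τ * ∑' i, C₄ * volume (S i) :=
          mul_le_mul_right ((measure_iUnion_le _).trans (ENNReal.tsum_le_tsum h1)) _
      _ = C₄ * (τ * ∑' i, volume (S i)) := by
          rw [ENNReal.tsum_mul_left]
          ring
      _ ≤ _ := mul_le_mul_right tsum_volume_stoppingCube_le _
  -- Chebyshev in L¹ off the exceptional set, atom by atom. One factor 2 comes from the height τ/2,
  -- the other from ‖b‖₁ ≤ 2 ‖F‖₁.
  have hbad : τ * volume ({x | ((τ / 2 : ℝ≥0) : ℝ≥0∞) ≤ intrinsicGStar lam α b x} ∩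
      (⋃ i, B i)ᶜ) ≤ 4 * C₃ * M := by
    have hi : ∀ i, ∫⁻ x in (⋃ i, B i)ᶜ, intrinsicGStar lam α ((S i).indicator b) x ≤
        C₃ * ∫⁻ x in S i, ‖b x‖ₑ := by
      intro i
      have hSm : MeasurableSet (S i) := measurableSet_stoppingCube i
      by_cases hne : (S i).Nonempty
      · obtain ⟨z, hz⟩ := hne
        have hz' : (S i).Nonempty := ⟨z, hz⟩
        have h1 := hC₃ i.1 i.2 ((S i).indicator b) (hbi.indicator hSm)
          (setIntegral_indicator_sub_goodPart hF i) fun x hx => by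
            rw [← stoppingCube_eq hz] at hx
            exact indicator_of_notMem hx _
        have h2 : ∫⁻ x, ‖(S i).indicator b x‖ₑ = ∫⁻ x in S i, ‖b x‖ₑ := by
          rw [← lintegral_indicator hSm]
          congr 1 with x
          exact enorm_indicator_eq_indicator_enorm _ _
        rw [h2] at h1
        refine le_trans (lintegral_mono_set (compl_subset_compl.2 ?_)) h1
        refine subset_iUnion_of_subset i ?_
        simp only [hB, if_pos hz']
        exact subset_rfl
      · have h0 : (S i).indicator b = 0 := by
          rw [Set.not_nonempty_iff_eq_empty.1 hne, indicator_empty]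
          rfl
        have hG : ∀ x, intrinsicGStar lam α ((S i).indicator b) x = 0 := fun x => by
          rw [h0, intrinsicGStar_eq]
          simp [intrinsicA]
        simp [hG]
    have h1 : ((τ / 2 : ℝ≥0) : ℝ≥0∞) * volume ({x | ((τ / 2 : ℝ≥0) : ℝ≥0∞) ≤
        intrinsicGStar lam α b x} ∩ (⋃ i, B i)ᶜ) ≤ C₃ * (2 * M) := by
      have hbm := measurable_intrinsicGStar (𝕜 := 𝕜) hn hα0 hα1 lam hbi.locallyIntegrable
      have h2 := mul_meas_ge_le_lintegral (μ := volume.restrict (⋃ i, B i)ᶜ) hbm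
        ((τ / 2 : ℝ≥0) : ℝ≥0∞)
      rw [Measure.restrict_apply (measurableSet_le measurable_const hbm)] at h2
      refine h2.trans ?_
      calc ∫⁻ x in (⋃ i, B i)ᶜ, intrinsicGStar lam α b x
          ≤ ∫⁻ x in (⋃ i, B i)ᶜ, ∑' i, intrinsicGStar lam α ((S i).indicator b) x :=
            lintegral_mono fun x => intrinsicGStar_le_tsum_indicator hn hα0 hα1 lam
              measurableSet_stoppingCube disjoint_stoppingCube hbi.locallyIntegrable hbS x
        _ = ∑' i, ∫⁻ x in (⋃ i, B i)ᶜ, intrinsicGStar lam α ((S i).indicator b) x :=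
            lintegral_tsum fun i => (measurable_intrinsicGStar hn hα0 hα1 lam
              (hbi.indicator (measurableSet_stoppingCube i)).locallyIntegrable).aemeasurable
        _ ≤ ∑' i, C₃ * ∫⁻ x in S i, ‖b x‖ₑ := ENNReal.tsum_le_tsum hi
        _ = C₃ * ∫⁻ x in ⋃ i, S i, ‖b x‖ₑ := by
            rw [ENNReal.tsum_mul_left,
              lintegral_iUnion measurableSet_stoppingCube disjoint_stoppingCube]
        _ ≤ C₃ * (2 * M) := by
            refine mul_le_mul_right ((setLIntegral_le_lintegral _ _).trans ?_) _
            calc ∫⁻ x, ‖b x‖ₑ ≤ ∫⁻ x, (‖F x‖ₑ + ‖g x‖ₑ) :=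
                  lintegral_mono fun x => enorm_sub_le
              _ = M + ∫⁻ x, ‖g x‖ₑ := lintegral_add_left' hF.aestronglyMeasurable.enorm _
              _ ≤ 2 * M := by
                  rw [two_mul]
                  exact add_le_add_right lintegral_enorm_goodPart_le _
    calc _ = 2 * (((τ / 2 : ℝ≥0) : ℝ≥0∞) * volume ({x | ((τ / 2 : ℝ≥0) : ℝ≥0∞) ≤
          intrinsicGStar lam α b x} ∩ (⋃ i, B i)ᶜ)) := by
          have h3 : (2 : ℝ≥0∞) * ((τ / 2 : ℝ≥0) : ℝ≥0∞) = τ := by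
            have : 2 * (τ / 2) = τ := by field_simp
            exact_mod_cast congrArg ((↑) : ℝ≥0 → ℝ≥0∞) this
          rw [← mul_assoc, h3]
      _ ≤ 2 * (C₃ * (2 * M)) := mul_le_mul_right h1 _
      _ = _ := by ring
  have hsub : {x | (τ : ℝ≥0∞) < intrinsicGStar lam α F x} ⊆
      ({x | ((τ / 2 : ℝ≥0) : ℝ≥0∞) ≤ intrinsicGStar lam α g x} ∪ ⋃ i, B i) ∪
        ({x | ((τ / 2 : ℝ≥0) : ℝ≥0∞) ≤ intrinsicGStar lam α b x} ∩ (⋃ i, B i)ᶜ) := by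
    intro x hx
    by_contra hcon
    simp only [mem_union, mem_inter_iff, mem_compl_iff, mem_ofPred_eq, not_or, not_and,
      not_le, not_not] at hcon
    obtain ⟨⟨h1, h2⟩, h3⟩ := hcon
    have h4 : intrinsicGStar lam α b x < ((τ / 2 : ℝ≥0) : ℝ≥0∞) := by
      by_contra h5
      exact h2 (h3 (not_lt.1 h5))
    have h5 := intrinsicGStar_add_le hn hα0 hα1 lam hgi.locallyIntegrable hbi.locallyIntegrable x
    rw [hb, add_sub_cancel] at h5
    have h6 := (hx.trans_le h5).trans (ENNReal.add_lt_add h1 h4)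
    rw [← ENNReal.coe_add, add_halves] at h6
    exact lt_irrefl _ h6
  calc τ * volume {x | (τ : ℝ≥0∞) < intrinsicGStar lam α F x}
      ≤ τ * (volume {x | ((τ / 2 : ℝ≥0) : ℝ≥0∞) ≤ intrinsicGStar lam α g x} +
          volume (⋃ i, B i) + volume ({x | ((τ / 2 : ℝ≥0) : ℝ≥0∞) ≤ intrinsicGStar lam α b x} ∩
            (⋃ i, B i)ᶜ)) := by
        refine mul_le_mul_right ((measure_mono hsub).trans ?_) _
        exact (measure_union_le _ _).trans (add_le_add_left (measure_union_le _ _) _)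
    _ ≤ 4 * 2 ^ n * (C₁ * C₂ : ℝ≥0∞) * M + C₄ * M + 4 * C₃ * M := by
        rw [mul_add, mul_add]
        exact add_le_add (add_le_add hgood hexc) hbad
    _ = _ := by ring

end WeakType

/-! ### Passage to Morrey spaces -/

section Morrey

variable {n : ℕ} {𝕜 : Type*} [RCLike 𝕜] {α : ℝ}

theorem doubling_pow_le {Φ : ℝ → ℝ} {D : ℝ} (hD : 0 ≤ D)
    (hΦD : ∀ r, 0 < r → Φ (2 * r) ≤ D * Φ r) {r : ℝ} (hr : 0 < r) (j : ℕ) :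
    Φ (2 ^ j * r) ≤ D ^ j * Φ r := by
  induction j with
  | zero => simp
  | succ j ih =>
    calc Φ (2 ^ (j + 1) * r) = Φ (2 * (2 ^ j * r)) := by rw [pow_succ']; ring_nf
      _ ≤ D * Φ (2 ^ j * r) := hΦD _ (by positivity)
      _ ≤ D * (D ^ j * Φ r) := by gcongr
      _ = D ^ (j + 1) * Φ r := by ring

/-- The dyadic annulus `{2^{j+1} r ≤ |z - x₀| < 2^{j+2} r}`. -/
def dyadicAnnulus (x₀ : EuclideanSpace ℝ (Fin n)) (r : ℝ) (j : ℕ) :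
    Set (EuclideanSpace ℝ (Fin n)) :=
  Metric.ball x₀ (2 ^ (j + 2) * r) \ Metric.ball x₀ (2 ^ (j + 1) * r)

theorem measurableSet_dyadicAnnulus (x₀ : EuclideanSpace ℝ (Fin n)) (r : ℝ) (j : ℕ) :
    MeasurableSet (dyadicAnnulus x₀ r j) :=
  Metric.isOpen_ball.measurableSet.diff Metric.isOpen_ball.measurableSet

theorem disjoint_dyadicAnnulus (x₀ : EuclideanSpace ℝ (Fin n)) {r : ℝ} (hr : 0 < r) :
    Pairwise fun i j => Disjoint (dyadicAnnulus x₀ r i) (dyadicAnnulus x₀ r j) := by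
  have key : ∀ i j, i < j → Disjoint (dyadicAnnulus x₀ r i) (dyadicAnnulus x₀ r j) := by
    intro i j hij
    refine Set.disjoint_left.2 fun x hx hx' => hx'.2 (Metric.ball_subset_ball ?_ hx.1)
    exact mul_le_mul_of_nonneg_right (pow_le_pow_right₀ one_le_two (by omega)) hr.le
  intro i j hij
  rcases lt_or_gt_of_ne hij with h | h
  · exact key i j h
  · exact (key j i h).symm

theorem mem_iUnion_dyadicAnnulus {x₀ x : EuclideanSpace ℝ (Fin n)} {r : ℝ} (hr : 0 < r)
    (hx : x ∉ Metric.ball x₀ (2 * r)) : x ∈ ⋃ j, dyadicAnnulus x₀ r j := by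
  have hx' : 2 ≤ dist x x₀ / r := by
    rw [le_div_iff₀ hr]
    simpa using hx
  obtain ⟨j, hj1, hj2⟩ := exists_nat_pow_near (by linarith : (1 : ℝ) ≤ dist x x₀ / r) one_lt_two
  -- Points outside the doubled ball have dyadic exponent at least 1; the annuli are indexed by the
  -- exponent minus one.
  have hj : j ≠ 0 := by
    rintro rfl
    norm_num at hj2
    linarith
  obtain ⟨i, rfl⟩ := Nat.exists_eq_succ_of_ne_zero hj
  rw [le_div_iff₀ hr] at hj1
  rw [div_lt_iff₀ hr] at hj2
  exact mem_iUnion.2 ⟨i, by simpa using hj2, by simpa using hj1⟩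

/-- The contribution to the `g*`-function on a ball of the values outside the doubled ball. -/
theorem intrinsicGStar_far_le (hn : 1 ≤ n) (hα0 : 0 < α) (hα1 : α ≤ 1) {lam : ℝ}
    (hlam : 3 * n < lam * n) {Φ : ℝ → ℝ} (hΦpos : ∀ r, 0 < r → 0 < Φ r) {D : ℝ}
    (hD1 : 1 ≤ D) (hD2 : D < 2 ^ n) (hΦD : ∀ r, 0 < r → Φ (2 * r) ≤ D * Φ r) :
    ∃ K : ℝ≥0, ∀ (f : EuclideanSpace ℝ (Fin n) → 𝕜) (C : ℝ≥0), LocallyIntegrable f →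
      IsMorreyBound Φ f C → ∀ (x₀ : EuclideanSpace ℝ (Fin n)) (r : ℝ), 0 < r →
      ∀ x ∈ Metric.ball x₀ r,
        intrinsicGStar lam α ((Metric.ball x₀ (2 * r))ᶜ.indicator f) x ≤
          K * C * ENNReal.ofReal (Φ r / r ^ n) := by
  obtain ⟨C₁, hC₁⟩ := intrinsicGStar_le_of_decay (n := n) (𝕜 := 𝕜) (α := α) hn le_rfl
    (lam := lam) (by linarith)
  set q : ℝ≥0∞ := ENNReal.ofReal (D / 2 ^ n) with hq
  have hq1 : q < 1 := by
    rw [hq, ENNReal.ofReal_lt_one, div_lt_one (by positivity)]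
    exact hD2
  have hKt : (C₁ : ℝ≥0∞) * 3 * ENNReal.ofReal (D ^ 2) * (1 - q)⁻¹ ≠ ⊤ := by
    refine ENNReal.mul_ne_top (by finiteness) (ENNReal.inv_ne_top.2 ?_)
    simpa [tsub_eq_zero_iff_le] using hq1
  refine ⟨((C₁ : ℝ≥0∞) * 3 * ENNReal.ofReal (D ^ 2) * (1 - q)⁻¹).toNNReal,
    fun f C hf hC x₀ r hr x hx => ?_⟩
  rw [ENNReal.coe_toNNReal hKt]
  set f₂ := (Metric.ball x₀ (2 * r))ᶜ.indicator f with hf₂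
  have hf₂i : LocallyIntegrable f₂ := hf.indicator Metric.isOpen_ball.measurableSet.compl
  have hΦr := hΦpos r hr
  -- The kernel bound 3 times the mass of the ball of radius 2^{j+2} r, with the doubling of Φ
  -- applied j + 2 times.
  set M : ℕ → ℝ≥0∞ := fun j => 3 * (C * ENNReal.ofReal (D ^ (j + 2) * Φ r)) with hM
  have hterm : ∀ j, intrinsicGStar lam α ((dyadicAnnulus x₀ r j).indicator f₂) x ≤
      C₁ * M j * ENNReal.ofReal ((2 ^ j * r) ^ (-(n + 0) : ℝ)) := by
    intro j
    -- The annulus starts at 2^{j+1} r from x₀ and x is within r of x₀, so its distance from x is at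
    -- least 2^j r.
    refine hC₁ _ x (2 ^ j * r) (M j) (by positivity) (by finiteness) ?_ ?_
    · intro y t ht
      refine (intrinsicA_le_closedBall hn hα0 hα1 ht _).trans ?_
      have h1 : ∫⁻ z in Metric.closedBall y t, ‖(dyadicAnnulus x₀ r j).indicator f₂ z‖ₑ ≤
          C * ENNReal.ofReal (D ^ (j + 2) * Φ r) := by
        calc _ ≤ ∫⁻ z, ‖(dyadicAnnulus x₀ r j).indicator f₂ z‖ₑ := setLIntegral_le_lintegral _ _
          _ ≤ ∫⁻ z, (Metric.ball x₀ (2 ^ (j + 2) * r)).indicator (fun z => ‖f z‖ₑ) z := by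
              refine lintegral_mono fun z => ?_
              by_cases hz : z ∈ dyadicAnnulus x₀ r j
              · rw [indicator_of_mem hz, indicator_of_mem hz.1, hf₂,
                  enorm_indicator_eq_indicator_enorm]
                exact indicator_le_self _ _ _
              · rw [indicator_of_notMem hz]
                simp
          _ = ∫⁻ z in Metric.ball x₀ (2 ^ (j + 2) * r), ‖f z‖ₑ :=
              lintegral_indicator Metric.isOpen_ball.measurableSet _
          _ ≤ C * ENNReal.ofReal (Φ (2 ^ (j + 2) * r)) := hC x₀ _ (by positivity)
          _ ≤ _ := mul_le_mul_right (ENNReal.ofReal_le_ofReal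
              (doubling_pow_le (by linarith) hΦD hr _)) _
      refine (mul_le_mul_right h1 _).trans_eq ?_
      rw [add_zero, Real.rpow_neg ht.le, Real.rpow_natCast, ENNReal.ofReal_mul (by norm_num),
        ENNReal.ofReal_ofNat]
      simp only [hM]
      ring
    · intro y t ht hA
      by_contra hlt
      refine hA (intrinsicA_eq_zero hn hα0 hα1 ht fun z hz => ?_)
      refine indicator_of_notMem (fun hzA => ?_) _
      have h1 : 2 ^ (j + 1) * r ≤ dist z x₀ := by simpa using hzA.2
      have h2 : dist x x₀ < r := hx
      have h3 : dist z x₀ ≤ dist z y + dist y x + dist x x₀ := dist_triangle4 _ _ _ _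
      rw [dist_comm y x, dist_eq_norm x y] at h3
      have h4 : (1 : ℝ) ≤ 2 ^ j := one_le_pow₀ one_le_two
      rw [pow_succ] at h1
      nlinarith
  calc intrinsicGStar lam α f₂ x
      ≤ ∑' j, intrinsicGStar lam α ((dyadicAnnulus x₀ r j).indicator f₂) x :=
        intrinsicGStar_le_tsum_indicator hn hα0 hα1 lam (measurableSet_dyadicAnnulus x₀ r)
          (disjoint_dyadicAnnulus x₀ hr) hf₂i (fun z hz => by
            refine indicator_of_notMem (fun hz' => hz ?_) _
            exact mem_iUnion_dyadicAnnulus hr hz') x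
    _ ≤ ∑' j, (C₁ : ℝ≥0∞) * 3 * ENNReal.ofReal (D ^ 2) * C * ENNReal.ofReal (Φ r / r ^ n) *
          q ^ j := by
        refine ENNReal.tsum_le_tsum fun j => (hterm j).trans_eq ?_
        have h1 : ENNReal.ofReal (D ^ (j + 2) * Φ r) *
            ENNReal.ofReal ((2 ^ j * r) ^ (-(n + 0) : ℝ)) =
            ENNReal.ofReal (D ^ 2) * ENNReal.ofReal (Φ r / r ^ n) * q ^ j := by
          rw [hq, ← ENNReal.ofReal_pow (by positivity), ← ENNReal.ofReal_mul (by positivity),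
            ← ENNReal.ofReal_mul (by positivity), ← ENNReal.ofReal_mul (by positivity), add_zero,
            Real.rpow_neg (by positivity), Real.rpow_natCast]
          congr 1
          rw [mul_pow, div_pow, ← pow_mul, ← pow_mul, mul_comm n j]
          field_simp
          ring
        simp only [hM]
        calc _ = C₁ * 3 * C * (ENNReal.ofReal (D ^ (j + 2) * Φ r) *
            ENNReal.ofReal ((2 ^ j * r) ^ (-(n + 0) : ℝ))) := by ring
          _ = _ := by rw [h1]; ring
    _ = _ := by
        rw [ENNReal.tsum_mul_left, ENNReal.tsum_geometric]
        ring

/-- The near part pays one doubling Φ(2r) ≤ D Φ(r) through the weak type bound, the far part is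
bounded pointwise on the ball, and each is tested at height τ/2. -/
theorem isWeakMorreyBound_intrinsicGStar (hn : 1 ≤ n) (hα0 : 0 < α) (hα1 : α ≤ 1) {lam : ℝ}
    (hlam : 3 * n + 2 * α < lam * n) {Φ : ℝ → ℝ} (hΦpos : ∀ r, 0 < r → 0 < Φ r) {D : ℝ}
    (hD1 : 1 ≤ D) (hD2 : D < 2 ^ n) (hΦD : ∀ r, 0 < r → Φ (2 * r) ≤ D * Φ r) :
    ∃ K : ℝ≥0, 0 < K ∧ ∀ (f : EuclideanSpace ℝ (Fin n) → 𝕜) (C : ℝ≥0), LocallyIntegrable f →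
      IsMorreyBound Φ f C → IsWeakMorreyBound Φ (intrinsicGStar lam α f) (K * C) := by
  obtain ⟨K₁, hK₁⟩ := weakType_intrinsicGStar (n := n) (𝕜 := 𝕜) hn hα0 hα1 hlam
  obtain ⟨K₂, hK₂⟩ := intrinsicGStar_far_le (n := n) (𝕜 := 𝕜) hn hα0 hα1
    (lam := lam) (by linarith) hΦpos hD1 hD2 hΦD
  have hKt : 2 * (K₁ * ENNReal.ofReal D) + 2 * (K₂ * unitBallVolume n) ≠ ⊤ := by
    have := unitBallVolume_ne_top (n := n)
    finiteness
  -- The added 1 only makes the constant positive.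
  refine ⟨(2 * (K₁ * ENNReal.ofReal D) + 2 * (K₂ * unitBallVolume n)).toNNReal + 1,
    by positivity, fun f C hf hC x₀ r hr => iSup₂_le fun τ hτ => ?_⟩
  rw [ENNReal.coe_add, ENNReal.coe_toNNReal hKt]
  have hΦr := hΦpos r hr
  set f₁ := (Metric.ball x₀ (2 * r)).indicator f with hf₁
  set f₂ := (Metric.ball x₀ (2 * r))ᶜ.indicator f with hf₂
  have hBm : MeasurableSet (Metric.ball x₀ (2 * r)) := Metric.isOpen_ball.measurableSet
  have hf₁i : Integrable f₁ := by
    rw [hf₁, integrable_indicator_iff hBm]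
    exact (hf.integrableOn_isCompact (isCompact_closedBall x₀ (2 * r))).mono_set
      Metric.ball_subset_closedBall
  have hf₂i : LocallyIntegrable f₂ := hf.indicator hBm.compl
  have hhalf : 2 * ((τ / 2 : ℝ≥0) : ℝ≥0∞) = τ := by
    have : 2 * (τ / 2) = τ := by field_simp
    exact_mod_cast congrArg ((↑) : ℝ≥0 → ℝ≥0∞) this
  have hlocal : τ * volume {x | ((τ / 2 : ℝ≥0) : ℝ≥0∞) < intrinsicGStar lam α f₁ x} ≤
      2 * (K₁ * ENNReal.ofReal D) * C * ENNReal.ofReal (Φ r) := by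
    have h1 := hK₁ f₁ (τ / 2) hf₁i (by positivity)
    have h2 : ∫⁻ x, ‖f₁ x‖ₑ ≤ C * (ENNReal.ofReal D * ENNReal.ofReal (Φ r)) := by
      simp only [hf₁, enorm_indicator_eq_indicator_enorm]
      rw [lintegral_indicator hBm, ← ENNReal.ofReal_mul (by linarith)]
      exact (hC x₀ (2 * r) (by positivity)).trans
        (mul_le_mul_right (ENNReal.ofReal_le_ofReal (hΦD r hr)) _)
    rw [← hhalf, mul_assoc 2]
    refine (mul_le_mul_right (h1.trans (mul_le_mul_right h2 _)) _).trans_eq ?_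
    ring
  have hfar : τ * volume {x ∈ Metric.ball x₀ r |
      ((τ / 2 : ℝ≥0) : ℝ≥0∞) ≤ intrinsicGStar lam α f₂ x} ≤
      2 * (K₂ * unitBallVolume n) * C * ENNReal.ofReal (Φ r) := by
    -- Either the set is empty, or a single point of it already bounds τ/2 by a multiple of
    -- Φ(r)/r^n; then the volume of the whole ball is affordable.
    rcases {x ∈ Metric.ball x₀ r |
      ((τ / 2 : ℝ≥0) : ℝ≥0∞) ≤ intrinsicGStar lam α f₂ x}.eq_empty_or_nonempty with h | ⟨x, hx⟩
    · rw [h]; simp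
    · have h1 : ((τ / 2 : ℝ≥0) : ℝ≥0∞) ≤ K₂ * C * ENNReal.ofReal (Φ r / r ^ n) :=
        hx.2.trans (hK₂ f C hf hC x₀ r hr x hx.1)
      have h2 : volume {x ∈ Metric.ball x₀ r |
          ((τ / 2 : ℝ≥0) : ℝ≥0∞) ≤ intrinsicGStar lam α f₂ x} ≤
          ENNReal.ofReal (r ^ n) * unitBallVolume n := by
        rw [← volume_closedBall_eq x₀ hr.le]
        exact measure_mono fun z hz => Metric.ball_subset_closedBall hz.1
      rw [← hhalf, mul_assoc 2]
      refine (mul_le_mul_right (mul_le_mul' h1 h2) _).trans_eq ?_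
      have h3 : ENNReal.ofReal (Φ r) = ENNReal.ofReal (Φ r / r ^ n) * ENNReal.ofReal (r ^ n) := by
        rw [← ENNReal.ofReal_mul (by positivity), div_mul_cancel₀ _ (by positivity)]
      rw [h3]
      ring
  have hsub : {x ∈ Metric.ball x₀ r | (τ : ℝ≥0∞) < intrinsicGStar lam α f x} ⊆
      {x | ((τ / 2 : ℝ≥0) : ℝ≥0∞) < intrinsicGStar lam α f₁ x} ∪
        {x ∈ Metric.ball x₀ r | ((τ / 2 : ℝ≥0) : ℝ≥0∞) ≤ intrinsicGStar lam α f₂ x} := by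
    rintro x ⟨hxB, hx⟩
    by_contra hcon
    simp only [mem_union, mem_ofPred_eq, not_or, not_and, not_le, not_lt] at hcon
    have h5 := intrinsicGStar_add_le hn hα0 hα1 lam hf₁i.locallyIntegrable hf₂i x
    rw [hf₁, hf₂, indicator_self_add_compl] at h5
    have h6 := (hx.trans_le h5).trans_le (add_le_add hcon.1 (hcon.2 hxB).le)
    rw [← ENNReal.coe_add, add_halves] at h6
    exact lt_irrefl _ h6
  calc τ * volume {x ∈ Metric.ball x₀ r | (τ : ℝ≥0∞) < intrinsicGStar lam α f x}
      ≤ τ * (volume {x | ((τ / 2 : ℝ≥0) : ℝ≥0∞) < intrinsicGStar lam α f₁ x} +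
          volume {x ∈ Metric.ball x₀ r |
            ((τ / 2 : ℝ≥0) : ℝ≥0∞) ≤ intrinsicGStar lam α f₂ x}) :=
        mul_le_mul_right ((measure_mono hsub).trans (measure_union_le _ _)) _
    _ ≤ 2 * (K₁ * ENNReal.ofReal D) * C * ENNReal.ofReal (Φ r) +
          2 * (K₂ * unitBallVolume n) * C * ENNReal.ofReal (Φ r) := by
        rw [mul_add]
        exact add_le_add hlocal hfar
    _ = (2 * (K₁ * ENNReal.ofReal D) + 2 * (K₂ * unitBallVolume n)) * C *
          ENNReal.ofReal (Φ r) := by ring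
    _ ≤ _ := by
        refine mul_le_mul_left (mul_le_mul_left ?_ _) _
        exact le_self_add

end Morrey

theorem theorem1p5 {𝕜 : Type*} [RCLike 𝕜] (n : ℕ) (hn : 1 ≤ n)
    (α : ℝ) (hα0 : 0 < α) (hα1 : α ≤ 1)
    (lam : ℝ) (hlam : (3 * n + 2 * α) / n < lam)
    (Φ : ℝ → ℝ) (hΦpos : ∀ r, 0 < r → 0 < Φ r) (hΦmono : MonotoneOn Φ (Ioi 0))
    (D : ℝ) (hD1 : 1 ≤ D) (hD2 : D < 2 ^ n)
    (hΦD : ∀ r, 0 < r → Φ (2 * r) ≤ D * Φ r) :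
    ∃ C : ℝ, 0 < C ∧ ∀ f : EuclideanSpace ℝ (Fin n) → 𝕜, MemMorrey Φ f →
      MemWeakMorrey Φ (intrinsicGStar lam α f) ∧
        weakMorreyNorm Φ (intrinsicGStar lam α f) ≤ ENNReal.ofReal C * morreyNorm Φ f := by
  have hn0 : (0 : ℝ) < n := by exact_mod_cast hn
  obtain ⟨K, hK0, hK⟩ := isWeakMorreyBound_intrinsicGStar (n := n) (𝕜 := 𝕜) hn hα0 hα1
    ((div_lt_iff₀ hn0).1 hlam) hΦpos hD1 hD2 hΦD
  refine ⟨K, by exact_mod_cast hK0, fun f ⟨hf, C₀, hC₀⟩ => ⟨⟨?_, K * C₀, ?_⟩, ?_⟩⟩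
  · exact measurable_intrinsicGStar hn hα0 hα1 lam hf
  · rw [ENNReal.coe_mul]
    exact hK f C₀ hf hC₀
  -- Dividing by K > 0 isolates the infimum on the right, so the inequality can be checked on each
  -- admissible constant, the infinite one being trivial.
  · rw [ENNReal.ofReal_coe_nnreal, mul_comm,
      ← ENNReal.div_le_iff (by simpa using hK0.ne') ENNReal.coe_ne_top]
    refine le_sInf fun C hC => ?_
    rw [ENNReal.div_le_iff (by simpa using hK0.ne') ENNReal.coe_ne_top, mul_comm]
    rcases eq_or_ne C ⊤ with rfl | hCt
    · rw [ENNReal.mul_top (by simpa using hK0.ne')]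
      exact le_top
    · lift C to ℝ≥0 using hCt
      exact sInf_le (hK f C hf hC)
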